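/- **Setting.** Let $N\ge 1$ and let $R\subset\mathbb R^N$ be a normalized root system: $R$ is finite, $|\alpha|=\sqrt2$, $R\cap\mathbb R\alpha=\{\pm\alpha\}$ and $\sigma_\alpha R=R$ for all $\alpha\in R$, where $\sigma_\alpha$ is the reflection in $\alpha^\perp$. Let $G$ be the finite group generated by the $\sigma_\alpha$, put $d(x,y)=\min_{\sigma\in G}|x-\sigma(y)|$ and $\mathcal O_B(x,r)=\{y: d(x,y)<r\}$. Functions are real-valued, or all complex-valued. For $\eta>0$ let $C^\eta_G$ be the space of continuous functions $f$ on $\mathbb R^N$ with $\|f\|_{G,\eta}:=\sup_{d(x,y)\neq0}|f(x)-f(y)|/d(x,y)^\eta<\infty$, let $C^\eta_{G,0}$ be its subspace of compactly supported functions, and let $C^\eta_{G,0,0}=\{g\in C^\eta_{G,0}:\int g=0\}$. Let $\eta_0>0$ and $0<\varepsilon\le1$, let $K$ be a measurable kernel on $\mathbb R^N\times\mathbb R^N$, and let $T$ be a linear map that sends each $f\in C^{\eta_0}_{G,0}$ to a linear functional $g\mapsto\langle Tf,g\rangle$ on $C^{\eta_0}_{G,0}$, such that, with a constant $C$, for $d(x,y)\ne0$: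 * $|K(x,y)|\le C\,d(x,y)^{-N}$; * $|K(x,y)-K(x',y)|\le C\,d(x,x')^\varepsilon\, d(x,y)^{-N-\varepsilon}$ if $d(x,x')\le\frac12 d(x,y)$; * $\langle Tf,g\rangle=\iint K(x,y)f(y)g(x)\,dy\,dx$ for all $f,g\in C^{\eta_0}_{G,0}$ for which the integral converges absolutely. For $g\in C^{\eta_0}_{G,0,0}$ with $\operatorname{supp}g\subset\mathcal O_B(x_0,r)$, a function $\xi\in C^{\eta_0}_{G,0}$ with $\xi=1$ on $\mathcal O_B(x_0,2r)$ and $\xi=0$ off $\mathcal O_B(x_0,4r)$, and a function $f$ with $\xi f\in C^{\eta_0}_{G,0}$ that is either bounded or in $C^\eta_G$ for some $\eta<\varepsilon$, put $$\langle Tf,g\rangle:=\langle T(\xi f),g\rangle+\iint[K(x,y)-K(x_0,y)](1-\xi(y))f(y)g(x)\,dy\,dx .\qquad(*)$$ Suppose that 1. $T(1)=0$, that is, $\langle T1,g\rangle=0$ in the sense of $(*)$ for all $g\in C^{\eta_0}_{G,0,0}$ (and all $x_0,r,\xi$ as above); 2. $T\in WBP_G$, that is, there is a constant $C$ such that $|\langle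 Tf,g\rangle|\le Cr^N$ for all $x_0,y_0\in\mathbb R^N$, $r>0$ and $f,g\in C^{\eta_0}_{G,0}$ with $\operatorname{supp}f\subset\mathcal O_B(y_0,r)$, $\operatorname{supp}g\subset\mathcal O_B(x_0,r)$, $\|f\|_\infty,\|g\|_\infty\le1$ and $\|f\|_{G,\eta_0},\|g\|_{G,\eta_0}\le r^{-\eta_0}$. **Theorem.** For every $0<\eta<\varepsilon$, $T$ extends to a bounded operator on $C^\eta_G$: there are a linear map $S:C^\eta_G\to C^\eta_G$ and a constant $C$ with $\|Sf\|_{G,\eta}\le C\|f\|_{G,\eta}$ for all $f\in C^\eta_G$, such that * $\langle Tf,g\rangle=\int (Sf)\,g\,dx$ for all $f\in C^\eta_G\cap C^{\eta_0}_{G,0}$ and $g\in C^{\eta_0}_{G,0}$; * $\langle Tf,g\rangle=\int (Sf)\,g\,dx$ for $f\in C^\eta_G$ and $g\in C^{\eta_0}_{G,0,0}$, whenever the left side is defined by $(*)$ (for $\eta\ge\eta_0$ this is every $f\in C^\eta_G$); * if $\sup_n\|f_n\|_{G,\eta}<\infty$ and $f_n\to f$ pointwise, where $f_n,f\in C^\eta_G$,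 then $\int (Sf_n)\,g\,dx\to\int (Sf)\,g\,dx$ for all $g\in C^{\eta_0}_{G,0,0}$. In particular, $Sf$ is $G$-invariant: $Sf(\sigma(x))=Sf(x)$ for all $f\in C^\eta_G$, $\sigma\in G$ and $x\in\mathbb R^N$. -/

import Mathlib

open MeasureTheory Filter Topology

noncomputable section

namespace ReflectionSI

/-- Normalized root systems in `ℝ^N`; the normalization `|α| = √2` makes roots nonzero. -/
structure IsNormalizedRootSystem {N : ℕ} (R : Set (EuclideanSpace ℝ (Fin N))) : Prop where
  finite : R.Finite
  norm_eq : ∀ α ∈ R, ‖α‖ = Real.sqrt 2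
  inter_line : ∀ α ∈ R, R ∩ (Submodule.span ℝ {α} : Set (EuclideanSpace ℝ (Fin N))) = {α, -α}
  reflection_image : ∀ α ∈ R, (Submodule.span ℝ {α})ᗮ.reflection '' R = R

/-- The reflection group: generated by the reflections in the hyperplanes `α^⊥`, `α ∈ R`. -/
def reflectionGroup {N : ℕ} (R : Set (EuclideanSpace ℝ (Fin N))) :
    Subgroup (EuclideanSpace ℝ (Fin N) ≃ₗᵢ[ℝ] EuclideanSpace ℝ (Fin N)) :=
  Subgroup.closure ((fun α => (Submodule.span ℝ {α})ᗮ.reflection) '' R)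

/-- The distance between orbits, `d(x,y) = min_{σ ∈ G} |x - σ y|` (the group is finite, so that
the infimum is a minimum). -/
def orbitDist {N : ℕ} (R : Set (EuclideanSpace ℝ (Fin N))) (x y : EuclideanSpace ℝ (Fin N)) : ℝ :=
  ⨅ σ : reflectionGroup R, ‖x - (σ : EuclideanSpace ℝ (Fin N) ≃ₗᵢ[ℝ] EuclideanSpace ℝ (Fin N)) y‖

/-- The orbit ball `{y : d(x,y) < r}`. -/
def orbitBall {N : ℕ} (R : Set (EuclideanSpace ℝ (Fin N))) (x : EuclideanSpace ℝ (Fin N)) (r : ℝ) :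
    Set (EuclideanSpace ℝ (Fin N)) :=
  {y | orbitDist R x y < r}

theorem orbitDist_nonneg {N : ℕ} (R : Set (EuclideanSpace ℝ (Fin N)))
    (x y : EuclideanSpace ℝ (Fin N)) : 0 ≤ orbitDist R x y :=
  Real.iInf_nonneg fun _ => norm_nonneg _

/-- The Hölder quotients `|f(x) - f(y)| / d(x,y)^η` with `d(x,y) ≠ 0`. -/
def holderQuotients {N : ℕ} {𝕜 : Type*} [RCLike 𝕜] (R : Set (EuclideanSpace ℝ (Fin N))) (η : ℝ)
    (f : EuclideanSpace ℝ (Fin N) → 𝕜) : Set ℝ :=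
  {t | ∃ x y, orbitDist R x y ≠ 0 ∧ t = ‖f x - f y‖ / orbitDist R x y ^ η}

/-- The norm `‖f‖_{G,η}`, the supremum of the Hölder quotients. -/
def holderNorm {N : ℕ} {𝕜 : Type*} [RCLike 𝕜] (R : Set (EuclideanSpace ℝ (Fin N))) (η : ℝ)
    (f : EuclideanSpace ℝ (Fin N) → 𝕜) : ℝ :=
  sSup (holderQuotients R η f)

/-- The space `C^η_G` of continuous functions with `‖f‖_{G,η} < ∞`. -/
def holderSpace {N : ℕ} (𝕜 : Type*) [RCLike 𝕜] (R : Set (EuclideanSpace ℝ (Fin N))) (η : ℝ) :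
    Submodule 𝕜 (EuclideanSpace ℝ (Fin N) → 𝕜) where
  carrier := {f | Continuous f ∧ BddAbove (holderQuotients R η f)}
  zero_mem' := by
    refine ⟨continuous_zero, 0, ?_⟩
    rintro t ⟨x, y, -, rfl⟩
    simp
  add_mem' := by
    rintro f g ⟨hf, A, hA⟩ ⟨hg, B, hB⟩
    refine ⟨hf.add hg, A + B, ?_⟩
    rintro t ⟨x, y, h, rfl⟩
    have h1 := hA ⟨x, y, h, rfl⟩
    have h2 := hB ⟨x, y, h, rfl⟩
    refine le_trans ?_ (add_le_add h1 h2)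
    rw [← add_div]
    refine div_le_div_of_nonneg_right ?_ (Real.rpow_nonneg (orbitDist_nonneg R x y) η)
    have h3 : (f + g) x - (f + g) y = (f x - f y) + (g x - g y) := by
      simp only [Pi.add_apply]; ring
    rw [h3]
    exact norm_add_le _ _
  smul_mem' := by
    rintro c f ⟨hf, A, hA⟩
    refine ⟨hf.const_smul c, ‖c‖ * A, ?_⟩
    rintro t ⟨x, y, h, rfl⟩
    have h1 := mul_le_mul_of_nonneg_left (hA ⟨x, y, h, rfl⟩) (norm_nonneg c)
    refine le_trans (le_of_eq ?_) h1
    simp only [Pi.smul_apply]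
    rw [← smul_sub, norm_smul, mul_div_assoc]

/-- The space `C^η_{G,0}` of compactly supported functions in `C^η_G`. -/
def holderCompact {N : ℕ} (𝕜 : Type*) [RCLike 𝕜] (R : Set (EuclideanSpace ℝ (Fin N))) (η : ℝ) :
    Submodule 𝕜 (EuclideanSpace ℝ (Fin N) → 𝕜) where
  carrier := {f | f ∈ holderSpace 𝕜 R η ∧ HasCompactSupport f}
  zero_mem' := ⟨Submodule.zero_mem _, HasCompactSupport.zero⟩
  add_mem' := fun hf hg => ⟨Submodule.add_mem _ hf.1 hg.1, hf.2.add hg.2⟩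
  smul_mem' := fun c _ hf => ⟨Submodule.smul_mem _ c hf.1, hf.2.mono (Function.support_const_smul_subset c _)⟩

/-- `T` sends `f` in `C^η_{G,0}` to the linear functional `g ↦ ⟨T f, g⟩ = T f g` on `C^η_{G,0}`.
It is a singular integral with kernel `K` (which matters only where `d(x,y) ≠ 0`), if `K` satisfies
the size condition and the `ε`-smoothness condition in the first variable, and represents `T`
whenever the double integral converges absolutely. -/
structure IsSingularIntegral {N : ℕ} {𝕜 : Type*} [RCLike 𝕜] (R : Set (EuclideanSpace ℝ (Fin N)))
    (η ε : ℝ) (T : holderCompact 𝕜 R η →ₗ[𝕜] holderCompact 𝕜 R η →ₗ[𝕜] 𝕜)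
    (K : EuclideanSpace ℝ (Fin N) → EuclideanSpace ℝ (Fin N) → 𝕜) : Prop where
  measurable : Measurable (Function.uncurry K)
  size : ∃ C : ℝ, ∀ x y, orbitDist R x y ≠ 0 → ‖K x y‖ ≤ C * (1 / orbitDist R x y ^ N)
  smooth : ∃ C : ℝ, ∀ x x' y, orbitDist R x y ≠ 0 → orbitDist R x x' ≤ 1 / 2 * orbitDist R x y →
    ‖K x y - K x' y‖ ≤ C * (orbitDist R x x' ^ ε / orbitDist R x y ^ ((N : ℝ) + ε))
  repr : ∀ f g : holderCompact 𝕜 R η,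
    Integrable (fun p : EuclideanSpace ℝ (Fin N) × EuclideanSpace ℝ (Fin N) =>
      K p.1 p.2 * (f : EuclideanSpace ℝ (Fin N) → 𝕜) p.2 *
        (g : EuclideanSpace ℝ (Fin N) → 𝕜) p.1) (volume.prod volume) →
    T f g = ∫ x, ∫ y, K x y * (f : EuclideanSpace ℝ (Fin N) → 𝕜) y *
      (g : EuclideanSpace ℝ (Fin N) → 𝕜) x

/-- A cutoff function `ξ` in `C^η_{G,0}`: equal to `1` on the orbit ball of radius `2r` and to `0`
off the orbit ball of radius `4r`. -/
def IsCutoff {N : ℕ} {𝕜 : Type*} [RCLike 𝕜] (R : Set (EuclideanSpace ℝ (Fin N))) (η : ℝ)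
    (x₀ : EuclideanSpace ℝ (Fin N)) (r : ℝ) (ξ : EuclideanSpace ℝ (Fin N) → 𝕜) : Prop :=
  ξ ∈ holderCompact 𝕜 R η ∧ (∀ y ∈ orbitBall R x₀ (2 * r), ξ y = 1) ∧
    ∀ y ∉ orbitBall R x₀ (4 * r), ξ y = 0

/-- The pairing `⟨T f, g⟩` for functions `f` without compact support and `g` with `∫ g = 0` and
support in the orbit ball of centre `x₀` and radius `r`, where `ξ` is a cutoff function for that
ball: `⟨T(ξ f), g⟩ + ∬ [K(x,y) - K(x₀,y)] (1 - ξ(y)) f(y) g(x) dy dx`. -/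
def extPairing {N : ℕ} {𝕜 : Type*} [RCLike 𝕜] {R : Set (EuclideanSpace ℝ (Fin N))} {η : ℝ}
    (T : holderCompact 𝕜 R η →ₗ[𝕜] holderCompact 𝕜 R η →ₗ[𝕜] 𝕜)
    (K : EuclideanSpace ℝ (Fin N) → EuclideanSpace ℝ (Fin N) → 𝕜)
    (x₀ : EuclideanSpace ℝ (Fin N)) (ξ f : EuclideanSpace ℝ (Fin N) → 𝕜)
    (h : ξ * f ∈ holderCompact 𝕜 R η) (g : holderCompact 𝕜 R η) : 𝕜 :=
  T ⟨ξ * f, h⟩ g +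
    ∫ x, ∫ y, (K x y - K x₀ y) * ((1 - ξ y) * f y) * (g : EuclideanSpace ℝ (Fin N) → 𝕜) x

/-- `T(1) = 0`: the functional `T(1)` vanishes on all `g` in `C^η_{G,0}` with `∫ g = 0`. -/
def AnnihilatesOne {N : ℕ} {𝕜 : Type*} [RCLike 𝕜] {R : Set (EuclideanSpace ℝ (Fin N))} {η : ℝ}
    (T : holderCompact 𝕜 R η →ₗ[𝕜] holderCompact 𝕜 R η →ₗ[𝕜] 𝕜)
    (K : EuclideanSpace ℝ (Fin N) → EuclideanSpace ℝ (Fin N) → 𝕜) : Prop :=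
  ∀ g : holderCompact 𝕜 R η, ∫ x, (g : EuclideanSpace ℝ (Fin N) → 𝕜) x = 0 →
    ∀ (x₀ : EuclideanSpace ℝ (Fin N)) (r : ℝ) (ξ : EuclideanSpace ℝ (Fin N) → 𝕜), 0 < r →
      IsCutoff R η x₀ r ξ → tsupport (g : EuclideanSpace ℝ (Fin N) → 𝕜) ⊆ orbitBall R x₀ r →
        ∀ h : ξ * 1 ∈ holderCompact 𝕜 R η, extPairing T K x₀ ξ 1 h g = 0

/-- The weak boundedness property. -/
def WeakBoundedness {N : ℕ} {𝕜 : Type*} [RCLike 𝕜] {R : Set (EuclideanSpace ℝ (Fin N))} {η : ℝ}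
    (T : holderCompact 𝕜 R η →ₗ[𝕜] holderCompact 𝕜 R η →ₗ[𝕜] 𝕜) : Prop :=
  ∃ C : ℝ, ∀ (x₀ y₀ : EuclideanSpace ℝ (Fin N)) (r : ℝ) (f g : holderCompact 𝕜 R η), 0 < r →
    tsupport (f : EuclideanSpace ℝ (Fin N) → 𝕜) ⊆ orbitBall R y₀ r →
    tsupport (g : EuclideanSpace ℝ (Fin N) → 𝕜) ⊆ orbitBall R x₀ r →
    (∀ x, ‖(f : EuclideanSpace ℝ (Fin N) → 𝕜) x‖ ≤ 1) →
    (∀ x, ‖(g : EuclideanSpace ℝ (Fin N) → 𝕜) x‖ ≤ 1) →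
    holderNorm R η (f : EuclideanSpace ℝ (Fin N) → 𝕜) ≤ r ^ (-η) →
    holderNorm R η (g : EuclideanSpace ℝ (Fin N) → 𝕜) ≤ r ^ (-η) →
    ‖T f g‖ ≤ C * r ^ N

end ReflectionSI

end

/-! The argument is pointwise: it produces a formula for `T f` on each orbit ball and reads the
Hölder estimate off it. No `L²` bound enters.

The obstacle is that `K` says nothing about `T` on the diagonal. The commutator `⟨T F, G g⟩ - ⟨T G,
F g⟩` avoids this: its formal integrand carries the factor `F(y)G(x) - G(y)F(x)`, which is
`O(d(x,y)^η₀)` and makes `K` integrable. That the formal integral really is the commutator is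
`IsSingularIntegral.commutator_identity`. The test function is cut by a `G`-invariant partition of
unity of scale `ρ`. Off the diagonal the kernel represents `T`. Near it, weak boundedness, applied
after freezing `F` and `G` at the centre of the piece, bounds each error by `ρ^(N + η₀)`. There are
about `ρ^(-N)` pieces, and `ρ → 0`.

Next let `ξ` be a cutoff of an orbit ball. `T(1) = 0` says that on this ball `T ξ` is a constant `c`
minus `∫ [K(x,y) - K(x₀,y)] (1 - ξ(y)) dy` (`exists_localization`), and weak boundedness bounds `c`
uniformly over all balls for the standard cutoffs (`Localization.exists_uniform`). The commutator
identity with `F = ξ f` and `G = ξ` transfers this to `f`: adding the far term of the extended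
pairing gives `T f(x) = c f(x) + ∫ [K(x,y) - (1 - ξ(y)) K(x₀,y)] (f(y) - f(x)) dy` on the ball
(`Localization.extPairing_eq`). For `f` in `C^η_G` the integral converges, near the diagonal since
`η > 0` and at infinity since `η < ε`, and on a ball of radius `r` it is `O(r^η)`.

Formulas from different balls differ by a constant where they overlap (`Localization.op_sub_op`), so
they glue to `globalOp`, normalized to vanish at `0`. The oscillation of `T f` between two points is
estimated in a ball barely larger than their distance (`exists_holderBound_globalOp`). Weak
continuity is dominated convergence in the same formula. Finally an additive constant, linear in
`f`, is adjusted so that `S` agrees with `T` on compactly supported `f` against test functions of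
any mean; the seminorm does not see it. -/

namespace ReflectionSI

/-! ### The reflection group and the orbit pseudometric -/

section Geometry

variable {N : ℕ} {R : Set (EuclideanSpace ℝ (Fin N))}

theorem image_eq_and_fixes_of_mem_reflectionGroup (hR : IsNormalizedRootSystem R)
    {σ : EuclideanSpace ℝ (Fin N) ≃ₗᵢ[ℝ] EuclideanSpace ℝ (Fin N)} (hσ : σ ∈ reflectionGroup R) :
    σ '' R = R ∧ ∀ v ∈ (Submodule.span ℝ R)ᗮ, σ v = v := by
  induction hσ using Subgroup.closure_induction with
  | mem s hs =>
    obtain ⟨α, hα, rfl⟩ := hs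
    refine ⟨hR.reflection_image α hα, fun v hv => ?_⟩
    exact Submodule.reflection_mem_subspace_eq_self
      (Submodule.orthogonal_le (Submodule.span_mono (Set.singleton_subset_iff.2 hα)) hv)
  | one => exact ⟨by simp, fun v _ => rfl⟩
  | mul s t _ _ hs ht =>
    refine ⟨?_, fun v hv => ?_⟩
    · have : (⇑(s * t) : EuclideanSpace ℝ (Fin N) → EuclideanSpace ℝ (Fin N)) = s ∘ t := rfl
      rw [this, Set.image_comp, ht.1, hs.1]
    · change s (t v) = v
      rw [ht.2 v hv, hs.2 v hv]
  | inv s _ hs =>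
    refine ⟨?_, fun v hv => ?_⟩
    · conv_lhs => rw [← hs.1]
      rw [← Set.image_comp]
      convert Set.image_id R
      rename_i v _
      exact s.symm_apply_apply v
    · conv_lhs => rw [← hs.2 v hv]
      exact s.symm_apply_apply v

/-- The group acts faithfully on the finite set `R`: an element permutes `R` and fixes the
orthogonal complement of its span, so its action on `R` determines it. -/
theorem finite_reflectionGroup (hR : IsNormalizedRootSystem R) : Finite (reflectionGroup R) := by
  have : Finite R := hR.finite
  have hmem : ∀ (σ : reflectionGroup R) (α : R), (σ : EuclideanSpace ℝ (Fin N) ≃ₗᵢ[ℝ] EuclideanSpace ℝ (Fin N)) α ∈ R := by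
    intro σ α
    have h := (image_eq_and_fixes_of_mem_reflectionGroup hR σ.2).1
    exact h.subset ⟨α, α.2, rfl⟩
  refine Finite.of_injective (fun (σ : reflectionGroup R) (α : R) => (⟨_, hmem σ α⟩ : R)) ?_
  intro σ τ h
  ext1
  ext1 v
  obtain ⟨y, hy, z, hz, rfl⟩ := (Submodule.span ℝ R).exists_add_mem_mem_orthogonal v
  rw [map_add, map_add, (image_eq_and_fixes_of_mem_reflectionGroup hR σ.2).2 z hz,
    (image_eq_and_fixes_of_mem_reflectionGroup hR τ.2).2 z hz]
  congr 1
  refine LinearMap.eqOn_span (f := (σ : EuclideanSpace ℝ (Fin N) ≃ₗᵢ[ℝ] EuclideanSpace ℝ (Fin N)).toLinearEquiv.toLinearMap)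
    (g := (τ : EuclideanSpace ℝ (Fin N) ≃ₗᵢ[ℝ] EuclideanSpace ℝ (Fin N)).toLinearEquiv.toLinearMap) ?_ hy
  intro α hα
  exact congrArg Subtype.val (congrFun h ⟨α, hα⟩)

theorem orbitDist_le (σ : reflectionGroup R) (x y : EuclideanSpace ℝ (Fin N)) :
    orbitDist R x y ≤ ‖x - (σ : EuclideanSpace ℝ (Fin N) ≃ₗᵢ[ℝ] EuclideanSpace ℝ (Fin N)) y‖ :=
  ciInf_le ⟨0, by rintro _ ⟨σ, rfl⟩; exact norm_nonneg _⟩ σ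

theorem orbitDist_le_norm (x y : EuclideanSpace ℝ (Fin N)) : orbitDist R x y ≤ ‖x - y‖ :=
  orbitDist_le 1 x y

theorem orbitDist_self (x : EuclideanSpace ℝ (Fin N)) : orbitDist R x x = 0 :=
  le_antisymm (by simpa using orbitDist_le_norm (R := R) x x) (orbitDist_nonneg R x x)

theorem orbitDist_apply (σ : reflectionGroup R) (x : EuclideanSpace ℝ (Fin N)) :
    orbitDist R ((σ : EuclideanSpace ℝ (Fin N) ≃ₗᵢ[ℝ] EuclideanSpace ℝ (Fin N)) x) x = 0 :=
  le_antisymm ((orbitDist_le σ _ x).trans (by simp)) (orbitDist_nonneg _ _ _)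

theorem mem_orbitBall_self {x : EuclideanSpace ℝ (Fin N)} {r : ℝ} (hr : 0 < r) :
    x ∈ orbitBall R x r := by
  simpa [orbitBall, orbitDist_self] using hr

variable [Finite (reflectionGroup R)]

variable (R) in
theorem exists_orbitDist_eq (x y : EuclideanSpace ℝ (Fin N)) : ∃ σ : reflectionGroup R,
    orbitDist R x y = ‖x - (σ : EuclideanSpace ℝ (Fin N) ≃ₗᵢ[ℝ] EuclideanSpace ℝ (Fin N)) y‖ := by
  obtain ⟨σ, hσ⟩ := exists_eq_ciInf_of_finite (f := fun σ : reflectionGroup R =>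
    ‖x - (σ : EuclideanSpace ℝ (Fin N) ≃ₗᵢ[ℝ] EuclideanSpace ℝ (Fin N)) y‖)
  exact ⟨σ, hσ.symm⟩

theorem orbitDist_comm (x y : EuclideanSpace ℝ (Fin N)) : orbitDist R x y = orbitDist R y x := by
  have key : ∀ x y : EuclideanSpace ℝ (Fin N), orbitDist R x y ≤ orbitDist R y x := by
    intro x y
    obtain ⟨σ, hσ⟩ := exists_orbitDist_eq R y x
    rw [hσ]
    refine (orbitDist_le σ⁻¹ x y).trans (le_of_eq ?_)
    rw [← (σ : EuclideanSpace ℝ (Fin N) ≃ₗᵢ[ℝ] EuclideanSpace ℝ (Fin N)).norm_map, map_sub,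
      norm_sub_rev]
    congr 2
    exact (σ : EuclideanSpace ℝ (Fin N) ≃ₗᵢ[ℝ] EuclideanSpace ℝ (Fin N)).apply_symm_apply y
  exact le_antisymm (key x y) (key y x)

theorem orbitDist_triangle (x y z : EuclideanSpace ℝ (Fin N)) :
    orbitDist R x z ≤ orbitDist R x y + orbitDist R y z := by
  obtain ⟨σ, hσ⟩ := exists_orbitDist_eq R x y
  obtain ⟨τ, hτ⟩ := exists_orbitDist_eq R y z
  rw [hσ, hτ]
  refine (orbitDist_le (σ * τ) x z).trans ?_
  rw [← (σ : EuclideanSpace ℝ (Fin N) ≃ₗᵢ[ℝ] EuclideanSpace ℝ (Fin N)).norm_map (y - _), map_sub]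
  refine le_trans (le_of_eq ?_) (norm_add_le _ _)
  congr 1
  rw [sub_add_sub_cancel]
  rfl

theorem abs_orbitDist_sub_le (z x y : EuclideanSpace ℝ (Fin N)) :
    |orbitDist R z x - orbitDist R z y| ≤ orbitDist R x y := by
  rw [abs_le]
  constructor
  · linarith [orbitDist_triangle (R := R) z x y]
  · linarith [orbitDist_triangle (R := R) z y x, orbitDist_comm (R := R) x y]

/-- Group elements are isometries fixing the origin, so the norm is constant on orbits. This makes
orbit balls bounded, and orbit balls centred at `0` Euclidean balls. -/
theorem norm_le_add_orbitDist (x y : EuclideanSpace ℝ (Fin N)) : ‖x‖ ≤ ‖y‖ + orbitDist R x y := by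
  obtain ⟨σ, hσ⟩ := exists_orbitDist_eq R x y
  rw [hσ, ← (σ : EuclideanSpace ℝ (Fin N) ≃ₗᵢ[ℝ] EuclideanSpace ℝ (Fin N)).norm_map y, add_comm]
  exact norm_le_norm_sub_add _ _

theorem orbitDist_zero_left (x : EuclideanSpace ℝ (Fin N)) : orbitDist R 0 x = ‖x‖ := by
  refine le_antisymm ?_ ?_
  · simpa using orbitDist_le_norm (R := R) 0 x
  · have := norm_le_add_orbitDist (R := R) x 0
    rw [orbitDist_comm]
    simpa using this

variable (R) in
theorem continuous_orbitDist_right (x : EuclideanSpace ℝ (Fin N)) :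
    Continuous fun y => orbitDist R x y := by
  rw [continuous_iff_continuousAt]
  intro y
  rw [ContinuousAt, tendsto_iff_dist_tendsto_zero]
  refine squeeze_zero (fun _ => dist_nonneg)
    (fun z => (abs_orbitDist_sub_le x z y).trans (orbitDist_le_norm z y)) ?_
  have h : Continuous fun z : EuclideanSpace ℝ (Fin N) => ‖z - y‖ := by fun_prop
  simpa using h.tendsto y

theorem finite_orbitDist_eq_zero (x : EuclideanSpace ℝ (Fin N)) :
    {y | orbitDist R y x = 0}.Finite := by
  refine (Set.finite_range fun σ : reflectionGroup R =>
    (σ : EuclideanSpace ℝ (Fin N) ≃ₗᵢ[ℝ] EuclideanSpace ℝ (Fin N)) x).subset ?_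
  intro y hy
  obtain ⟨σ, hσ⟩ := exists_orbitDist_eq R y x
  refine ⟨σ, ?_⟩
  rw [Set.mem_ofPred_eq, hσ, norm_eq_zero, sub_eq_zero] at hy
  exact hy.symm

theorem isOpen_orbitBall (x : EuclideanSpace ℝ (Fin N)) (r : ℝ) : IsOpen (orbitBall R x r) :=
  isOpen_lt (continuous_orbitDist_right R x) continuous_const

end Geometry

/-! ### Hölder functions for the orbit distance -/

section Holder

variable {N : ℕ} {𝕜 : Type*} [RCLike 𝕜] {R : Set (EuclideanSpace ℝ (Fin N))}

variable (R) in
/-- `A` is a Hölder constant of exponent `η` for `f` with respect to the orbit distance. -/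
def HolderBound (η A : ℝ) (f : EuclideanSpace ℝ (Fin N) → 𝕜) : Prop :=
  ∀ x y, ‖f x - f y‖ ≤ A * orbitDist R x y ^ η

theorem orbitDist_rpow_nonneg (x y : EuclideanSpace ℝ (Fin N)) (η : ℝ) :
    0 ≤ orbitDist R x y ^ η :=
  Real.rpow_nonneg (orbitDist_nonneg R x y) η

theorem HolderBound.mono {η A B : ℝ} {f : EuclideanSpace ℝ (Fin N) → 𝕜} (h : HolderBound R η A f)
    (hAB : A ≤ B) : HolderBound R η B f := fun x y =>
  (h x y).trans (mul_le_mul_of_nonneg_right hAB (orbitDist_rpow_nonneg x y η))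

theorem HolderBound.const_mul {η A : ℝ} {f : EuclideanSpace ℝ (Fin N) → 𝕜}
    (hf : HolderBound R η A f) (c : 𝕜) : HolderBound R η (‖c‖ * A) (fun x => c * f x) := by
  intro x y
  simp only
  rw [← mul_sub, norm_mul, mul_assoc]
  exact mul_le_mul_of_nonneg_left (hf x y) (norm_nonneg c)

theorem HolderBound.sub {η A B : ℝ} {f g : EuclideanSpace ℝ (Fin N) → 𝕜} (hf : HolderBound R η A f)
    (hg : HolderBound R η B g) : HolderBound R η (A + B) (fun x => f x - g x) := by
  intro x y
  have h : (f x - g x) - (f y - g y) = (f x - f y) - (g x - g y) := by ring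
  simp only
  rw [h, add_mul]
  exact (norm_sub_le _ _).trans (add_le_add (hf x y) (hg x y))

theorem HolderBound.sub_const {η A : ℝ} {f : EuclideanSpace ℝ (Fin N) → 𝕜}
    (hf : HolderBound R η A f) (c : 𝕜) : HolderBound R η A (fun x => f x - c) := by
  intro x y
  simpa using hf x y

/-- In a product `a * b`, the size of `a` matters only on the support of `b`. -/
theorem HolderBound.mul_of_support {η A B α β : ℝ} {a b : EuclideanSpace ℝ (Fin N) → 𝕜}
    (hα : HolderBound R η α a) (hβ : HolderBound R η β b) (hα0 : 0 ≤ α) (hβ0 : 0 ≤ β) (hA0 : 0 ≤ A)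
    (hB0 : 0 ≤ B) (hA : ∀ x, b x ≠ 0 → ‖a x‖ ≤ A) (hB : ∀ x, ‖b x‖ ≤ B) :
    HolderBound R η (A * β + α * B) (fun x => a x * b x) := by
  intro x y
  have hd := orbitDist_rpow_nonneg (R := R) x y η
  by_cases hx : b x = 0
  · by_cases hy : b y = 0
    · simp only [hx, hy, mul_zero, sub_zero, norm_zero]
      positivity
    -- Since `b x = 0`, nothing bounds `a x`; this splitting evaluates `a` alone only at `y`, where
    -- `b` does not vanish.
    · have h : a x * b x - a y * b y = a y * (b x - b y) + (a x - a y) * b x := by ring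
      simp only
      rw [h]
      refine (norm_add_le _ _).trans ?_
      rw [norm_mul, norm_mul, add_mul, mul_assoc, mul_right_comm]
      exact add_le_add (mul_le_mul (hA y hy) (hβ x y) (norm_nonneg _) hA0)
        (mul_le_mul (hα x y) (hB x) (norm_nonneg _) (by positivity))
  · have h : a x * b x - a y * b y = a x * (b x - b y) + (a x - a y) * b y := by ring
    simp only
    rw [h]
    refine (norm_add_le _ _).trans ?_
    rw [norm_mul, norm_mul, add_mul, mul_assoc, mul_right_comm]
    exact add_le_add (mul_le_mul (hA x hx) (hβ x y) (norm_nonneg _) hA0)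
      (mul_le_mul (hα x y) (hB y) (norm_nonneg _) (by positivity))

/-- A function that oscillates by at most `L * min 1 (d / ρ)` is Hölder of every exponent
`η ≤ 1`. -/
theorem HolderBound.of_lipschitz {η L ρ : ℝ} (hη : 0 < η) (hη1 : η ≤ 1) (hρ : 0 < ρ)
    {f : EuclideanSpace ℝ (Fin N) → 𝕜} (hL : ∀ x y, ‖f x - f y‖ ≤ L * (orbitDist R x y / ρ))
    (h1 : ∀ x y, ‖f x - f y‖ ≤ L) : HolderBound R η (L * ρ ^ (-η)) f := by
  intro x y
  have hL0 : 0 ≤ L := (norm_nonneg _).trans (h1 x y)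
  have hd := orbitDist_nonneg R x y
  have hq : 0 ≤ orbitDist R x y / ρ := by positivity
  have h : L * ρ ^ (-η) * orbitDist R x y ^ η = L * (orbitDist R x y / ρ) ^ η := by
    rw [Real.div_rpow hd hρ.le, Real.rpow_neg hρ.le]
    field_simp
  rw [h]
  -- For `η ≤ 1`, `t ≤ t ^ η` when `t ≤ 1` and `1 ≤ t ^ η` when `t ≥ 1`.
  rcases le_total (orbitDist R x y / ρ) 1 with h2 | h2
  · refine (hL x y).trans (mul_le_mul_of_nonneg_left ?_ hL0)
    rcases hq.eq_or_lt with h3 | h3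
    · rw [← h3, Real.zero_rpow hη.ne']
    · simpa using Real.rpow_le_rpow_of_exponent_ge h3 h2 hη1
  · refine (h1 x y).trans (le_mul_of_one_le_right hL0 (Real.one_le_rpow h2 hη.le))

theorem HolderBound.continuous {η A : ℝ} (hη : 0 < η) {f : EuclideanSpace ℝ (Fin N) → 𝕜}
    (h : HolderBound R η A f) : Continuous f := by
  have h' : HolderBound R η |A| f := h.mono (le_abs_self A)
  rw [continuous_iff_continuousAt]
  intro x
  rw [ContinuousAt, tendsto_iff_norm_sub_tendsto_zero]
  refine squeeze_zero (g := fun z => |A| * ‖z - x‖ ^ η) (fun _ => norm_nonneg _) (fun z => ?_) ?_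
  · refine (h' z x).trans ?_
    gcongr
    · exact orbitDist_nonneg _ _ _
    · exact orbitDist_le_norm z x
  · have h : Continuous fun z : EuclideanSpace ℝ (Fin N) => |A| * ‖z - x‖ ^ η :=
      continuous_const.mul ((continuous_id.sub continuous_const).norm.rpow_const
        fun _ => Or.inr hη.le)
    have h2 := h.tendsto x
    simpa [Real.zero_rpow hη.ne'] using h2

theorem HolderBound.mem_holderSpace {η A : ℝ} (hη : 0 < η) {f : EuclideanSpace ℝ (Fin N) → 𝕜}
    (h : HolderBound R η A f) : f ∈ holderSpace 𝕜 R η := by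
  refine ⟨h.continuous hη, A, ?_⟩
  rintro t ⟨x, y, hxy, rfl⟩
  have hd : 0 < orbitDist R x y := (orbitDist_nonneg R x y).lt_of_ne hxy.symm
  rw [div_le_iff₀ (Real.rpow_pos_of_pos hd η)]
  exact h x y

theorem HolderBound.holderNorm_le {η A : ℝ} (hA : 0 ≤ A) {f : EuclideanSpace ℝ (Fin N) → 𝕜}
    (h : HolderBound R η A f) : holderNorm R η f ≤ A := by
  refine Real.sSup_le ?_ hA
  rintro t ⟨x, y, hxy, rfl⟩
  have hd : 0 < orbitDist R x y := (orbitDist_nonneg R x y).lt_of_ne hxy.symm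
  rw [div_le_iff₀ (Real.rpow_pos_of_pos hd η)]
  exact h x y

theorem holderNorm_nonneg (η : ℝ) (f : EuclideanSpace ℝ (Fin N) → 𝕜) : 0 ≤ holderNorm R η f := by
  refine Real.sSup_nonneg ?_
  rintro t ⟨x, y, hxy, rfl⟩
  exact div_nonneg (norm_nonneg _) (orbitDist_rpow_nonneg x y η)

theorem orbitDist_le_subset_closedBall [Finite (reflectionGroup R)] (x : EuclideanSpace ℝ (Fin N)) (r : ℝ) :
    {y | orbitDist R x y ≤ r} ⊆ Metric.closedBall 0 (‖x‖ + r) := by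
  intro y hy
  rw [Metric.mem_closedBall, dist_zero_right]
  have := norm_le_add_orbitDist (R := R) y x
  rw [orbitDist_comm] at this
  exact this.trans (add_le_add le_rfl hy)

theorem isClosed_orbitDist_le [Finite (reflectionGroup R)] (x : EuclideanSpace ℝ (Fin N)) (r : ℝ) :
    IsClosed {y | orbitDist R x y ≤ r} :=
  isClosed_le (continuous_orbitDist_right R x) continuous_const

theorem tsupport_subset_orbitDist_le [Finite (reflectionGroup R)] {x : EuclideanSpace ℝ (Fin N)}
    {r : ℝ} {f : EuclideanSpace ℝ (Fin N) → 𝕜} (h : ∀ y, r < orbitDist R x y → f y = 0) :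
    tsupport f ⊆ {y | orbitDist R x y ≤ r} := by
  refine closure_minimal (fun y hy => ?_) (isClosed_orbitDist_le x r)
  by_contra h'
  exact hy (h y (not_le.1 h'))

theorem tsupport_subset_orbitBall [Finite (reflectionGroup R)] {x : EuclideanSpace ℝ (Fin N)}
    {r s : ℝ} (hrs : r < s) {f : EuclideanSpace ℝ (Fin N) → 𝕜}
    (h : ∀ y, r < orbitDist R x y → f y = 0) : tsupport f ⊆ orbitBall R x s :=
  (tsupport_subset_orbitDist_le h).trans fun _ hy => lt_of_le_of_lt hy hrs

theorem HolderBound.mem_holderCompact [Finite (reflectionGroup R)] {η A : ℝ} (hη : 0 < η)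
    {f : EuclideanSpace ℝ (Fin N) → 𝕜} (hf : HolderBound R η A f) {x : EuclideanSpace ℝ (Fin N)}
    {r : ℝ} (h : ∀ y, r < orbitDist R x y → f y = 0) : f ∈ holderCompact 𝕜 R η :=
  ⟨hf.mem_holderSpace hη, HasCompactSupport.intro' (isCompact_closedBall 0 (‖x‖ + r))
    Metric.isClosed_closedBall fun y hy => h y (not_le.1 fun h' => hy (orbitDist_le_subset_closedBall x r h'))⟩

/-- The seminorm tests only pairs in different orbits. An orbit is finite, so its complement is
dense when `N ≥ 1`, and continuity carries the estimate to pairs in one orbit, where it forces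
equality. -/
theorem holderBound_of_mem_holderSpace [Finite (reflectionGroup R)] (hN : 1 ≤ N) {η : ℝ}
    (hη : 0 < η) {f : EuclideanSpace ℝ (Fin N) → 𝕜} (hf : f ∈ holderSpace 𝕜 R η) :
    HolderBound R η (holderNorm R η f) f := by
  have : Nonempty (Fin N) := ⟨⟨0, hN⟩⟩
  intro x y
  have hc : IsClosed {z | ‖f z - f y‖ ≤ holderNorm R η f * orbitDist R z y ^ η} := by
    refine isClosed_le (hf.1.sub continuous_const).norm (continuous_const.mul ?_)
    simp_rw [fun z => orbitDist_comm (R := R) z y]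
    exact (continuous_orbitDist_right R y).rpow_const fun _ => Or.inr hη.le
  have hd : Dense {z : EuclideanSpace ℝ (Fin N) | orbitDist R z y = 0}ᶜ :=
    (finite_orbitDist_eq_zero y).countable.dense_compl ℝ
  have hsub : {z | orbitDist R z y = 0}ᶜ ⊆
      {z | ‖f z - f y‖ ≤ holderNorm R η f * orbitDist R z y ^ η} := by
    intro z hz
    have hd : 0 < orbitDist R z y := (orbitDist_nonneg R z y).lt_of_ne (Ne.symm hz)
    have := le_csSup hf.2 ⟨z, y, hz, rfl⟩
    rwa [div_le_iff₀ (Real.rpow_pos_of_pos hd η)] at this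
  exact closure_minimal hsub hc (hd x)

theorem exists_norm_le_of_mem_holderCompact {η : ℝ} {f : EuclideanSpace ℝ (Fin N) → 𝕜}
    (hf : f ∈ holderCompact 𝕜 R η) : ∃ M, 0 < M ∧ ∀ x, ‖f x‖ ≤ M := by
  obtain ⟨M, hM⟩ := hf.2.exists_bound_of_continuous hf.1.1
  exact ⟨max M 1, by positivity, fun x => (hM x).trans (le_max_left _ _)⟩

theorem exists_orbitDist_le_of_mem_holderCompact [Finite (reflectionGroup R)] {η : ℝ}
    {f : EuclideanSpace ℝ (Fin N) → 𝕜} (hf : f ∈ holderCompact 𝕜 R η) :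
    ∃ r, 0 < r ∧ ∀ x, r < ‖x‖ → f x = 0 := by
  obtain ⟨r, hr⟩ := hf.2.isCompact.isBounded.subset_closedBall 0
  refine ⟨max r 1, by positivity, fun x hx => ?_⟩
  by_contra h
  have h1 := hr (subset_tsupport f h)
  rw [Metric.mem_closedBall, dist_zero_right] at h1
  exact absurd (h1.trans (le_max_left r 1)) (not_le.2 hx)

theorem mul_mem_holderCompact [Finite (reflectionGroup R)] (hN : 1 ≤ N) {η : ℝ}
    (hη : 0 < η) {f g : EuclideanSpace ℝ (Fin N) → 𝕜} (hf : f ∈ holderCompact 𝕜 R η)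
    (hg : g ∈ holderCompact 𝕜 R η) : f * g ∈ holderCompact 𝕜 R η := by
  obtain ⟨A, hA, hA'⟩ := exists_norm_le_of_mem_holderCompact hf
  obtain ⟨B, hB, hB'⟩ := exists_norm_le_of_mem_holderCompact hg
  refine ⟨((holderBound_of_mem_holderSpace hN hη hf.1).mul_of_support
    (holderBound_of_mem_holderSpace hN hη hg.1) (holderNorm_nonneg _ _) (holderNorm_nonneg _ _)
    hA.le hB.le (fun x _ => hA' x) hB').mem_holderSpace hη, hf.2.mul_right⟩

/-- The orbit distance is at most the Euclidean one, so an exponent above `1` makes increments `o(‖z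
- x‖)`. With compact support only the zero function is left, which disposes of the case `η₀ > 1`. -/
theorem hasFDerivAt_zero_of_holderBound {η A : ℝ} (hη : 1 < η)
    {f : EuclideanSpace ℝ (Fin N) → 𝕜} (hf : HolderBound R η A f) (x : EuclideanSpace ℝ (Fin N)) :
    HasFDerivAt f (0 : EuclideanSpace ℝ (Fin N) →L[ℝ] 𝕜) x := by
  rw [hasFDerivAt_iff_isLittleO]
  have h1 : (fun z => f z - f x - (0 : EuclideanSpace ℝ (Fin N) →L[ℝ] 𝕜) (z - x)) =O[𝓝 x]
      fun z => ‖z - x‖ ^ η := by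
    refine Asymptotics.IsBigO.of_bound |A| (Eventually.of_forall fun z => ?_)
    simp only [zero_apply, sub_zero]
    refine (hf.mono (le_abs_self A) z x).trans ?_
    rw [Real.norm_of_nonneg (by positivity)]
    gcongr
    · exact orbitDist_nonneg _ _ _
    · exact orbitDist_le_norm z x
  refine h1.trans_isLittleO ?_
  have h : Continuous fun z : EuclideanSpace ℝ (Fin N) => ‖z - x‖ ^ (η - 1) :=
    (continuous_id.sub continuous_const).norm.rpow_const fun _ => Or.inr (by linarith)
  have h2 : Tendsto (fun z => ‖z - x‖ ^ (η - 1)) (𝓝 x) (𝓝 0) := by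
    simpa [Real.zero_rpow (by linarith : η - 1 ≠ 0)] using h.tendsto x
  have h3 := ((Asymptotics.isLittleO_one_iff ℝ).2 h2).mul_isBigO
    (Asymptotics.isBigO_refl (fun z => ‖z - x‖) (𝓝 x))
  refine Asymptotics.IsLittleO.of_norm_right ?_
  refine h3.congr (fun z => ?_) (fun z => one_mul _)
  rcases (norm_nonneg (z - x)).eq_or_lt with h4 | h4
  · rw [← h4, mul_zero, Real.zero_rpow (by linarith)]
  · rw [← Real.rpow_add_one h4.ne', sub_add_cancel]

theorem eq_zero_of_mem_holderCompact [Finite (reflectionGroup R)] (hN : 1 ≤ N) {η : ℝ} (hη : 1 < η)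
    {f : EuclideanSpace ℝ (Fin N) → 𝕜} (hf : f ∈ holderCompact 𝕜 R η) : f = 0 := by
  have : Nonempty (Fin N) := ⟨⟨0, hN⟩⟩
  have hd := hasFDerivAt_zero_of_holderBound hη
    (holderBound_of_mem_holderSpace hN (by linarith) hf.1)
  obtain ⟨r, hr, h⟩ := exists_orbitDist_le_of_mem_holderCompact hf
  obtain ⟨y, hy⟩ := NormedSpace.exists_lt_norm ℝ (EuclideanSpace ℝ (Fin N)) r
  ext x
  rw [is_const_of_fderiv_eq_zero (𝕜 := ℝ) (fun x => (hd x).differentiableAt)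
    (fun x => (hd x).fderiv) x y, h y hy, Pi.zero_apply]

end Holder

/-! ### Standard cutoff functions -/

section Cutoff

theorem abs_clamp_sub_clamp_le (a b : ℝ) :
    |max 0 (min 1 a) - max 0 (min 1 b)| ≤ |a - b| := by
  refine (abs_max_sub_max_le_max _ _ _ _).trans (max_le (by simp) ?_)
  exact (abs_min_sub_min_le_max _ _ _ _).trans (max_le (by simp) le_rfl)

variable {N : ℕ} {R : Set (EuclideanSpace ℝ (Fin N))}

variable (R) in
/-- The standard cutoff function: `1` where `d(x₀,y) ≤ 2r`, and `0` where `d(x₀,y) ≥ 4r`. -/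
noncomputable def cutoff (x₀ : EuclideanSpace ℝ (Fin N)) (r : ℝ) (y : EuclideanSpace ℝ (Fin N)) : ℝ :=
  max 0 (min 1 (2 - orbitDist R x₀ y / (2 * r)))

theorem cutoff_nonneg (x₀ : EuclideanSpace ℝ (Fin N)) (r : ℝ) (y : EuclideanSpace ℝ (Fin N)) :
    0 ≤ cutoff R x₀ r y := le_max_left _ _

theorem cutoff_le_one (x₀ : EuclideanSpace ℝ (Fin N)) (r : ℝ) (y : EuclideanSpace ℝ (Fin N)) :
    cutoff R x₀ r y ≤ 1 := max_le zero_le_one (min_le_left _ _)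

theorem cutoff_eq_one {x₀ y : EuclideanSpace ℝ (Fin N)} {r : ℝ} (hr : 0 < r)
    (h : orbitDist R x₀ y ≤ 2 * r) : cutoff R x₀ r y = 1 := by
  have : orbitDist R x₀ y / (2 * r) ≤ 1 := by rwa [div_le_one (by positivity)]
  rw [cutoff, min_eq_left (by linarith), max_eq_right zero_le_one]

theorem cutoff_eq_zero {x₀ y : EuclideanSpace ℝ (Fin N)} {r : ℝ} (hr : 0 < r)
    (h : 4 * r ≤ orbitDist R x₀ y) : cutoff R x₀ r y = 0 := by
  have : 2 ≤ orbitDist R x₀ y / (2 * r) := by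
    rw [le_div_iff₀ (by positivity)]
    linarith
  rw [cutoff, max_eq_left]
  exact (min_le_right _ _).trans (by linarith)

theorem abs_cutoff_sub_le_one (x₀ : EuclideanSpace ℝ (Fin N)) (r : ℝ)
    (x y : EuclideanSpace ℝ (Fin N)) : |cutoff R x₀ r x - cutoff R x₀ r y| ≤ 1 := by
  rw [abs_le]
  constructor <;> linarith [cutoff_nonneg (R := R) x₀ r x, cutoff_le_one (R := R) x₀ r x,
    cutoff_nonneg (R := R) x₀ r y, cutoff_le_one (R := R) x₀ r y]

theorem norm_ofReal_cutoff_le (𝕜 : Type*) [RCLike 𝕜] (x₀ : EuclideanSpace ℝ (Fin N)) (r : ℝ)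
    (y : EuclideanSpace ℝ (Fin N)) : ‖(cutoff R x₀ r y : 𝕜)‖ ≤ 1 := by
  rw [RCLike.norm_ofReal, abs_of_nonneg (cutoff_nonneg _ _ _)]
  exact cutoff_le_one _ _ _

variable [Finite (reflectionGroup R)]

theorem abs_cutoff_sub_le {r : ℝ} (hr : 0 < r) (x₀ x y : EuclideanSpace ℝ (Fin N)) :
    |cutoff R x₀ r x - cutoff R x₀ r y| ≤ 1 * (orbitDist R x y / r) := by
  have h1 : |cutoff R x₀ r x - cutoff R x₀ r y| ≤
      |(2 - orbitDist R x₀ x / (2 * r)) - (2 - orbitDist R x₀ y / (2 * r))| := by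
    exact abs_clamp_sub_clamp_le _ _
  refine h1.trans ?_
  have h2 : (2 - orbitDist R x₀ x / (2 * r)) - (2 - orbitDist R x₀ y / (2 * r)) =
      (orbitDist R x₀ y - orbitDist R x₀ x) / (2 * r) := by ring
  rw [h2, abs_div, abs_of_pos (by positivity : 0 < 2 * r), one_mul]
  have h3 := abs_orbitDist_sub_le (R := R) x₀ y x
  rw [orbitDist_comm y x] at h3
  have := orbitDist_nonneg R x y
  gcongr
  linarith

variable (𝕜 : Type*) [RCLike 𝕜]

theorem holderBound_cutoff {η r : ℝ} (hη : 0 < η) (hη1 : η ≤ 1) (hr : 0 < r)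
    (x₀ : EuclideanSpace ℝ (Fin N)) :
    HolderBound R η (r ^ (-η)) (fun y => (cutoff R x₀ r y : 𝕜)) := by
  rw [← one_mul (r ^ (-η))]
  refine HolderBound.of_lipschitz hη hη1 hr (fun x y => ?_) (fun x y => ?_)
  · rw [← RCLike.ofReal_sub, RCLike.norm_ofReal]
    exact abs_cutoff_sub_le hr x₀ x y
  · rw [← RCLike.ofReal_sub, RCLike.norm_ofReal]
    exact abs_cutoff_sub_le_one x₀ r x y

theorem cutoff_mem_holderCompact {η r : ℝ} (hη : 0 < η) (hη1 : η ≤ 1) (hr : 0 < r)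
    (x₀ : EuclideanSpace ℝ (Fin N)) :
    (fun y => (cutoff R x₀ r y : 𝕜)) ∈ holderCompact 𝕜 R η :=
  (holderBound_cutoff 𝕜 hη hη1 hr x₀).mem_holderCompact hη (x := x₀) (r := 4 * r) fun y hy => by
    rw [cutoff_eq_zero hr hy.le, RCLike.ofReal_zero]

theorem isCutoff_cutoff {η r : ℝ} (hη : 0 < η) (hη1 : η ≤ 1) (hr : 0 < r)
    (x₀ : EuclideanSpace ℝ (Fin N)) :
    IsCutoff R η x₀ r (fun y => (cutoff R x₀ r y : 𝕜)) := by
  refine ⟨cutoff_mem_holderCompact 𝕜 hη hη1 hr x₀, fun y hy => ?_, fun y hy => ?_⟩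
  · simp only [cutoff_eq_one hr (le_of_lt hy), RCLike.ofReal_one]
  · simp only [cutoff_eq_zero hr (not_lt.1 hy), RCLike.ofReal_zero]

end Cutoff

/-! ### Integrals of functions of the orbit distance -/

section Integrals

variable {N : ℕ} {R : Set (EuclideanSpace ℝ (Fin N))}

theorem integrable_comp_norm_sub_apply {φ : ℝ → ℝ}
    (h : Integrable fun z : EuclideanSpace ℝ (Fin N) => φ ‖z‖) (x : EuclideanSpace ℝ (Fin N))
    (σ : EuclideanSpace ℝ (Fin N) ≃ₗᵢ[ℝ] EuclideanSpace ℝ (Fin N)) :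
    (Integrable fun y => φ ‖x - σ y‖) ∧ ∫ y, φ ‖x - σ y‖ = ∫ z : EuclideanSpace ℝ (Fin N), φ ‖z‖ := by
  have hσ := σ.measurePreserving
  have h1 : Integrable fun y => φ ‖x - y‖ := h.comp_sub_left x
  refine ⟨(hσ.integrable_comp_emb σ.toMeasurableEquiv.measurableEmbedding).2 h1, ?_⟩
  rw [hσ.integral_comp σ.toMeasurableEquiv.measurableEmbedding (fun y => φ ‖x - y‖)]
  exact integral_sub_left_eq_self (fun z => φ ‖z‖) volume x

variable [Finite (reflectionGroup R)]

/-- The minimum in `d` is attained, so `φ(d(x,y))` is one of the terms `φ(‖x - σ y‖)`, and is at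
most their sum. Each term has the same integral because `σ` preserves volume. No monotonicity of `φ`
is needed. -/
theorem integrable_comp_orbitDist {φ : ℝ → ℝ} (hφ : ∀ t, 0 ≤ t → 0 ≤ φ t) (hφm : Measurable φ)
    (h : Integrable fun z : EuclideanSpace ℝ (Fin N) => φ ‖z‖) (x : EuclideanSpace ℝ (Fin N)) :
    (Integrable fun y => φ (orbitDist R x y)) ∧ ∫ y, φ (orbitDist R x y) ≤
      Nat.card (reflectionGroup R) * ∫ z : EuclideanSpace ℝ (Fin N), φ ‖z‖ := by
  obtain ⟨_⟩ := nonempty_fintype (reflectionGroup R)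
  have h1 : ∀ y, φ (orbitDist R x y) ≤ ∑ σ : reflectionGroup R,
      φ ‖x - (σ : EuclideanSpace ℝ (Fin N) ≃ₗᵢ[ℝ] EuclideanSpace ℝ (Fin N)) y‖ := by
    intro y
    obtain ⟨σ, hσ⟩ := exists_orbitDist_eq R x y
    rw [hσ]
    exact Finset.single_le_sum (f := fun σ : reflectionGroup R =>
      φ ‖x - (σ : EuclideanSpace ℝ (Fin N) ≃ₗᵢ[ℝ] EuclideanSpace ℝ (Fin N)) y‖)
      (fun σ _ => hφ _ (norm_nonneg _)) (Finset.mem_univ σ)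
  have h2 : Integrable fun y => ∑ σ : reflectionGroup R,
      φ ‖x - (σ : EuclideanSpace ℝ (Fin N) ≃ₗᵢ[ℝ] EuclideanSpace ℝ (Fin N)) y‖ :=
    integrable_finsetSum _ fun σ _ => (integrable_comp_norm_sub_apply h x σ).1
  have h3 : Integrable fun y => φ (orbitDist R x y) := by
    refine h2.mono' ?_ (Eventually.of_forall fun y => ?_)
    · exact (hφm.comp (continuous_orbitDist_right R x).measurable).aestronglyMeasurable
    · rw [Real.norm_of_nonneg (hφ _ (orbitDist_nonneg R x y))]
      exact h1 y
  refine ⟨h3, (integral_mono h3 h2 h1).trans (le_of_eq ?_)⟩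
  rw [integral_finsetSum _ fun (σ : reflectionGroup R) _ =>
      (integrable_comp_norm_sub_apply h x (σ : EuclideanSpace ℝ (Fin N) ≃ₗᵢ[ℝ] _)).1,
    Finset.sum_congr rfl fun σ _ => (integrable_comp_norm_sub_apply h x _).2,
    Finset.sum_const, Finset.card_univ, nsmul_eq_mul, Nat.card_eq_fintype_card]

theorem exists_integral_comp_orbitDist_le (hN : 1 ≤ N) : ∃ C, 0 ≤ C ∧ ∀ φ : ℝ → ℝ,
    (∀ t, 0 ≤ t → 0 ≤ φ t) → Measurable φ →
    IntegrableOn (fun t => t ^ (N - 1) * φ t) (Set.Ioi 0) → ∀ x : EuclideanSpace ℝ (Fin N),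
    (Integrable fun y => φ (orbitDist R x y)) ∧ ∫ y, φ (orbitDist R x y) ≤
      C * ∫ t in Set.Ioi 0, t ^ (N - 1) * φ t := by
  have : Nonempty (Fin N) := ⟨⟨0, hN⟩⟩
  refine ⟨Nat.card (reflectionGroup R) *
    (N * volume.real (Metric.ball (0 : EuclideanSpace ℝ (Fin N)) 1)), by positivity, ?_⟩
  intro φ hφ hφm h x
  have h1 : Integrable fun z : EuclideanSpace ℝ (Fin N) => φ ‖z‖ := by
    rw [integrable_fun_norm_addHaar volume]
    simpa using h
  have h2 := integrable_comp_orbitDist (R := R) hφ hφm h1 x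
  rw [integral_fun_norm_addHaar volume φ] at h2
  simpa [mul_assoc] using h2

/-- In polar coordinates this is `∫₀ˢ t ^ (a - 1) dt`. It controls `K` near the diagonal once a
Hölder factor has been gained. -/
theorem exists_integral_near_le (hN : 1 ≤ N) {a : ℝ} (ha : 0 < a) : ∃ C, 0 ≤ C ∧
    ∀ (x : EuclideanSpace ℝ (Fin N)) (s : ℝ), 0 < s →
    (Integrable fun y => (Set.Iio s).indicator (fun t => t ^ (a - N)) (orbitDist R x y)) ∧
      ∫ y, (Set.Iio s).indicator (fun t => t ^ (a - N)) (orbitDist R x y) ≤ C * s ^ a := by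
  obtain ⟨C, hC, h⟩ := exists_integral_comp_orbitDist_le (R := R) hN
  refine ⟨C * (1 / a), by positivity, fun x s hs => ?_⟩
  have hN' : ((N - 1 : ℕ) : ℝ) = N - 1 := by push_cast [Nat.cast_sub hN]; ring
  have heq : Set.EqOn (fun t : ℝ => t ^ (N - 1) * (Set.Iio s).indicator (fun t => t ^ (a - N)) t)
      ((Set.Ioo 0 s).indicator fun t => t ^ (a - 1)) (Set.Ioi 0) := by
    intro t ht
    have ht' : 0 < t := ht
    by_cases hts : t < s
    · simp only [Set.indicator, Set.mem_Iio, Set.mem_Ioo, hts, ht', and_self, if_true]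
      rw [← Real.rpow_natCast, ← Real.rpow_add ht', hN']
      congr 1
      ring
    · simp [Set.indicator, hts]
  have hint : IntegrableOn (fun t : ℝ => t ^ (a - 1)) (Set.Ioo 0 s) := by
    have := (intervalIntegral.intervalIntegrable_rpow' (a := 0) (b := s) (r := a - 1) (by linarith))
    exact ((intervalIntegrable_iff_integrableOn_Ioo_of_le hs.le).1 this)
  have h1 := h ((Set.Iio s).indicator fun t => t ^ (a - N)) (fun t ht =>
    Set.indicator_apply_nonneg fun _ => Real.rpow_nonneg ht _) (by measurability) ?_ x
  · refine ⟨h1.1, h1.2.trans (le_of_eq ?_)⟩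
    rw [setIntegral_congr_fun measurableSet_Ioi heq, setIntegral_indicator measurableSet_Ioo,
      Set.inter_eq_right.2 Set.Ioo_subset_Ioi_self, ← integral_Ioc_eq_integral_Ioo,
      ← intervalIntegral.integral_of_le hs.le, integral_rpow (Or.inl (by linarith))]
    rw [sub_add_cancel, Real.zero_rpow ha.ne']
    ring
  · rw [integrableOn_congr_fun heq measurableSet_Ioi]
    exact ((integrable_indicator_iff measurableSet_Ioo).2 hint).integrableOn

/-- In polar coordinates this is the tail of `t ^ (-b - 1)`. It is used with `b = ε - η`, the decay
left after smoothness of `K` has paid for the growth of `f`. -/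
theorem exists_integral_far_le (hN : 1 ≤ N) {b : ℝ} (hb : 0 < b) : ∃ C, 0 ≤ C ∧
    ∀ (x : EuclideanSpace ℝ (Fin N)) (s : ℝ), 0 < s →
    (Integrable fun y => (Set.Ici s).indicator (fun t => t ^ (-(N + b))) (orbitDist R x y)) ∧
      ∫ y, (Set.Ici s).indicator (fun t => t ^ (-(N + b))) (orbitDist R x y) ≤ C * s ^ (-b) := by
  obtain ⟨C, hC, h⟩ := exists_integral_comp_orbitDist_le (R := R) hN
  refine ⟨C * (1 / b), by positivity, fun x s hs => ?_⟩
  have hN' : ((N - 1 : ℕ) : ℝ) = N - 1 := by push_cast [Nat.cast_sub hN]; ring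
  have heq : Set.EqOn (fun t : ℝ => t ^ (N - 1) * (Set.Ici s).indicator (fun t => t ^ (-(N + b))) t)
      ((Set.Ici s).indicator fun t => t ^ (-b - 1)) (Set.Ioi 0) := by
    intro t ht
    have ht' : 0 < t := ht
    by_cases hts : s ≤ t
    · simp only [Set.indicator, Set.mem_Ici, hts, if_true]
      rw [← Real.rpow_natCast, ← Real.rpow_add ht', hN']
      congr 1
      ring
    · simp [Set.indicator, hts]
  have hint : IntegrableOn (fun t : ℝ => t ^ (-b - 1)) (Set.Ici s) := by
    rw [integrableOn_Ici_iff_integrableOn_Ioi]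
    exact integrableOn_Ioi_rpow_of_lt (by linarith) hs
  have h1 := h ((Set.Ici s).indicator fun t => t ^ (-(N + b))) (fun t ht =>
    Set.indicator_apply_nonneg fun _ => Real.rpow_nonneg ht _) (by measurability) ?_ x
  · refine ⟨h1.1, h1.2.trans (le_of_eq ?_)⟩
    have hsub : Set.Ioi 0 ∩ Set.Ici s = Set.Ici s :=
      Set.inter_eq_right.2 fun t ht => lt_of_lt_of_le hs ht
    rw [setIntegral_congr_fun measurableSet_Ioi heq, setIntegral_indicator measurableSet_Ici,
      hsub, integral_Ici_eq_integral_Ioi, integral_Ioi_rpow_of_lt (by linarith) hs, sub_add_cancel]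
    field_simp
  · rw [integrableOn_congr_fun heq measurableSet_Ioi]
    exact ((integrable_indicator_iff measurableSet_Ici).2 hint).integrableOn

theorem exists_volume_orbitBall_le (hN : 1 ≤ N) : ∃ C, 0 ≤ C ∧
    ∀ (x : EuclideanSpace ℝ (Fin N)) (s : ℝ), 0 < s →
    volume (orbitBall R x s) ≠ ⊤ ∧ volume.real (orbitBall R x s) ≤ C * s ^ N := by
  -- With `a = N` the weight is `t ^ 0 = 1`, so the integral is the volume.
  obtain ⟨C, hC, h⟩ := exists_integral_near_le (R := R) hN (a := N) (by positivity)
  refine ⟨C, hC, fun x s hs => ?_⟩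
  obtain ⟨h1, h2⟩ := h x s hs
  have heq : (fun y => (Set.Iio s).indicator (fun t : ℝ => t ^ ((N : ℝ) - N)) (orbitDist R x y)) =
      (orbitBall R x s).indicator fun _ => (1 : ℝ) := by
    ext y
    simp only [Set.indicator, orbitBall, sub_self, Real.rpow_zero]
    rfl
  rw [heq] at h1 h2
  have hm := (isOpen_orbitBall (R := R) x s).measurableSet
  rw [integral_indicator_const _ hm, Real.rpow_natCast] at h2
  rw [integrable_indicator_iff hm, integrableOn_const_iff] at h1
  refine ⟨?_, by simpa using h2⟩
  simpa [lt_top_iff_ne_top] using h1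

end Integrals

/-! ### A group-invariant Lipschitz partition of unity -/

section Partition

/-- The tent function `max 0 (1 - |s|)`, as a difference of two ramps. -/
noncomputable def tent (s : ℝ) : ℝ := max 0 (min 1 (s + 1)) - max 0 (min 1 s)

theorem tent_nonneg (s : ℝ) : 0 ≤ tent s :=
  sub_nonneg.2 (max_le_max le_rfl (min_le_min le_rfl (by linarith)))

theorem tent_le_one (s : ℝ) : tent s ≤ 1 := by
  have h1 : max 0 (min 1 (s + 1)) ≤ 1 := max_le zero_le_one (min_le_left _ _)
  have h2 : 0 ≤ max 0 (min 1 s) := le_max_left _ _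
  rw [tent]
  linarith

theorem abs_tent_sub_le (s t : ℝ) : |tent s - tent t| ≤ 2 * |s - t| := by
  have h1 := abs_clamp_sub_clamp_le (s + 1) (t + 1)
  have h2 := abs_clamp_sub_clamp_le s t
  have h3 : tent s - tent t = (max 0 (min 1 (s + 1)) - max 0 (min 1 (t + 1))) -
      (max 0 (min 1 s) - max 0 (min 1 t)) := by rw [tent, tent]; ring
  rw [add_sub_add_right_eq_sub] at h1
  rw [h3]
  linarith [abs_sub (max 0 (min 1 (s + 1)) - max 0 (min 1 (t + 1)))
    (max 0 (min 1 s) - max 0 (min 1 t))]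

theorem tent_eq_zero {s : ℝ} (h : 1 < |s|) : tent s = 0 := by
  rcases lt_abs.1 h with h | h
  · rw [tent, min_eq_left (by linarith), min_eq_left (by linarith), sub_self]
  · rw [tent, max_eq_left ((min_le_right _ _).trans (by linarith)),
      max_eq_left ((min_le_right _ _).trans (by linarith)), sub_self]

/-- Each tent is a difference of consecutive ramps, so the sum telescopes to the ramp at `s + n + 1`
minus the ramp at `s - n`. These are `1` and `0` since `|s| ≤ n`. -/
theorem sum_tent {n : ℕ} {s : ℝ} (hs : |s| ≤ n) :
    ∑ k : Fin (2 * n + 1), tent (s - ((k : ℕ) - n : ℝ)) = 1 := by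
  obtain ⟨h1, h2⟩ := abs_le.1 hs
  rw [Fin.sum_univ_eq_sum_range (fun k => tent (s - ((k : ℕ) - n : ℝ)))]
  have h3 : ∀ k : ℕ, tent (s - ((k : ℕ) - n : ℝ)) =
      (fun j : ℕ => max 0 (min 1 (s + n + 1 - j))) k -
        (fun j : ℕ => max 0 (min 1 (s + n + 1 - j))) (k + 1) := by
    intro k
    simp only [tent]
    push_cast
    ring_nf
  simp_rw [h3]
  rw [Finset.sum_range_sub']
  push_cast
  rw [min_eq_left (by linarith), max_eq_right zero_le_one, max_eq_left]
  · ring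
  · exact (min_le_right _ _).trans (by linarith)

theorem abs_prod_sub_prod_le {ι : Type*} (s : Finset ι) {a b : ι → ℝ} (ha0 : ∀ i, 0 ≤ a i)
    (ha1 : ∀ i, a i ≤ 1) (hb0 : ∀ i, 0 ≤ b i) (hb1 : ∀ i, b i ≤ 1) :
    |∏ i ∈ s, a i - ∏ i ∈ s, b i| ≤ ∑ i ∈ s, |a i - b i| := by
  classical
  induction s using Finset.induction_on with
  | empty => simp
  | insert i s hi ih =>
    rw [Finset.prod_insert hi, Finset.prod_insert hi, Finset.sum_insert hi]
    have h : a i * ∏ j ∈ s, a j - b i * ∏ j ∈ s, b j =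
        (a i - b i) * ∏ j ∈ s, a j + b i * (∏ j ∈ s, a j - ∏ j ∈ s, b j) := by ring
    have h1 : ∏ j ∈ s, a j ≤ 1 := Finset.prod_le_one (fun j _ => ha0 j) fun j _ => ha1 j
    have h2 : 0 ≤ ∏ j ∈ s, a j := Finset.prod_nonneg fun j _ => ha0 j
    rw [h]
    refine (abs_add_le _ _).trans (add_le_add ?_ (le_trans ?_ ih))
    · rw [abs_mul, abs_of_nonneg h2]
      exact mul_le_of_le_one_right (abs_nonneg _) h1
    · rw [abs_mul, abs_of_nonneg (hb0 i)]
      exact mul_le_of_le_one_left (abs_nonneg _) (hb1 i)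

variable {N : ℕ}

theorem norm_le_of_forall_abs_le {x : EuclideanSpace ℝ (Fin N)} {δ : ℝ} (hδ : 0 ≤ δ)
    (h : ∀ i, |x i| ≤ δ) : ‖x‖ ≤ N * δ := by
  rw [EuclideanSpace.norm_eq]
  refine Real.sqrt_le_iff.2 ⟨by positivity, ?_⟩
  have h1 : ∑ i, ‖x i‖ ^ 2 ≤ ∑ _i : Fin N, δ ^ 2 :=
    Finset.sum_le_sum fun i _ => pow_le_pow_left₀ (norm_nonneg _) (h i) 2
  rw [Finset.sum_const, Finset.card_univ, Fintype.card_fin, nsmul_eq_mul] at h1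
  refine h1.trans ?_
  rw [mul_pow]
  refine mul_le_mul_of_nonneg_right ?_ (sq_nonneg δ)
  exact_mod_cast Nat.le_self_pow two_ne_zero N

/-- Products of tents of width `δ` around the lattice point `δ m`. -/
noncomputable def latticeTent (δ : ℝ) (m : Fin N → ℝ) (x : EuclideanSpace ℝ (Fin N)) : ℝ :=
  ∏ i, tent (x i / δ - m i)

theorem latticeTent_nonneg (δ : ℝ) (m : Fin N → ℝ) (x : EuclideanSpace ℝ (Fin N)) :
    0 ≤ latticeTent δ m x := Finset.prod_nonneg fun _ _ => tent_nonneg _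

theorem latticeTent_le_one (δ : ℝ) (m : Fin N → ℝ) (x : EuclideanSpace ℝ (Fin N)) :
    latticeTent δ m x ≤ 1 := Finset.prod_le_one (fun _ _ => tent_nonneg _) fun _ _ => tent_le_one _

theorem abs_latticeTent_sub_le {δ : ℝ} (hδ : 0 < δ) (m : Fin N → ℝ)
    (x y : EuclideanSpace ℝ (Fin N)) :
    |latticeTent δ m x - latticeTent δ m y| ≤ 2 * N / δ * ‖x - y‖ := by
  refine (abs_prod_sub_prod_le _ (fun _ => tent_nonneg _) (fun _ => tent_le_one _)
    (fun _ => tent_nonneg _) fun _ => tent_le_one _).trans ?_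
  have h : ∀ i, |tent (x i / δ - m i) - tent (y i / δ - m i)| ≤ 2 / δ * ‖x - y‖ := by
    intro i
    refine (abs_tent_sub_le _ _).trans ?_
    have h1 : x i / δ - m i - (y i / δ - m i) = (x - y) i / δ := by
      rw [PiLp.sub_apply]; ring
    rw [h1, abs_div, abs_of_pos hδ, div_mul_eq_mul_div, mul_div_assoc]
    gcongr
    exact PiLp.norm_apply_le (x - y) i
  refine (Finset.sum_le_sum fun i _ => h i).trans (le_of_eq ?_)
  rw [Finset.sum_const, Finset.card_univ, Fintype.card_fin, nsmul_eq_mul]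
  ring

theorem norm_sub_le_of_latticeTent_ne_zero {δ : ℝ} (hδ : 0 < δ) {m : Fin N → ℝ}
    {x : EuclideanSpace ℝ (Fin N)} (h : latticeTent δ m x ≠ 0) :
    ‖x - WithLp.toLp 2 (fun i => δ * m i)‖ ≤ N * δ := by
  refine norm_le_of_forall_abs_le hδ.le fun i => ?_
  have h1 : |x i / δ - m i| ≤ 1 := by
    by_contra h'
    exact h (Finset.prod_eq_zero (Finset.mem_univ i) (tent_eq_zero (not_le.1 h')))
  have h2 : (x - WithLp.toLp 2 (fun i => δ * m i)) i = δ * (x i / δ - m i) := by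
    rw [PiLp.sub_apply]
    field_simp
  rw [h2, abs_mul, abs_of_pos hδ]
  exact mul_le_of_le_one_right hδ.le h1

theorem sum_latticeTent {n : ℕ} {δ : ℝ} (hδ : 0 < δ) {x : EuclideanSpace ℝ (Fin N)}
    (hx : ‖x‖ ≤ δ * n) :
    ∑ k : Fin N → Fin (2 * n + 1), latticeTent δ (fun i => ((k i : ℕ) - n : ℝ)) x = 1 := by
  have h := Finset.prod_univ_sum (fun _ : Fin N => (Finset.univ : Finset (Fin (2 * n + 1))))
    (fun i k => tent (x i / δ - ((k : ℕ) - n : ℝ)))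
  rw [Fintype.piFinset_univ] at h
  simp only [latticeTent]
  rw [← h]
  refine Finset.prod_eq_one fun i _ => sum_tent ?_
  rw [abs_div, abs_of_pos hδ, div_le_iff₀ hδ, mul_comm]
  exact (PiLp.norm_apply_le x i).trans hx

variable (R : Set (EuclideanSpace ℝ (Fin N))) [Fintype (reflectionGroup R)]

/-- The average of a lattice tent over the reflection group. -/
noncomputable def orbitTent (δ : ℝ) (m : Fin N → ℝ) (x : EuclideanSpace ℝ (Fin N)) : ℝ :=
  (Fintype.card (reflectionGroup R) : ℝ)⁻¹ * ∑ σ : reflectionGroup R,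
    latticeTent δ m ((σ : EuclideanSpace ℝ (Fin N) ≃ₗᵢ[ℝ] EuclideanSpace ℝ (Fin N)) x)

theorem orbitTent_nonneg (δ : ℝ) (m : Fin N → ℝ) (x : EuclideanSpace ℝ (Fin N)) :
    0 ≤ orbitTent R δ m x :=
  mul_nonneg (by positivity) (Finset.sum_nonneg fun _ _ => latticeTent_nonneg _ _ _)

theorem orbitTent_le_one (δ : ℝ) (m : Fin N → ℝ) (x : EuclideanSpace ℝ (Fin N)) :
    orbitTent R δ m x ≤ 1 := by
  have hc : (0 : ℝ) < Fintype.card (reflectionGroup R) := by exact_mod_cast Fintype.card_pos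
  rw [orbitTent, inv_mul_le_iff₀ hc]
  refine (Finset.sum_le_sum fun σ _ => latticeTent_le_one _ _ _).trans ?_
  simp

theorem orbitTent_apply (δ : ℝ) (m : Fin N → ℝ) (τ : reflectionGroup R)
    (x : EuclideanSpace ℝ (Fin N)) :
    orbitTent R δ m ((τ : EuclideanSpace ℝ (Fin N) ≃ₗᵢ[ℝ] EuclideanSpace ℝ (Fin N)) x) =
      orbitTent R δ m x := by
  rw [orbitTent, orbitTent]
  congr 1
  exact Fintype.sum_equiv (Equiv.mulRight τ) _ _ fun σ => rfl

/-- Averaging makes the tent invariant, so `y` may be replaced by the point of its orbit nearest to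
`x`. The Euclidean Lipschitz bound then becomes one for `d`. -/
theorem abs_orbitTent_sub_le {δ : ℝ} (hδ : 0 < δ) (m : Fin N → ℝ)
    (x y : EuclideanSpace ℝ (Fin N)) :
    |orbitTent R δ m x - orbitTent R δ m y| ≤ 2 * N / δ * orbitDist R x y := by
  have hc : (0 : ℝ) < Fintype.card (reflectionGroup R) := by exact_mod_cast Fintype.card_pos
  obtain ⟨τ, hτ⟩ := exists_orbitDist_eq R x y
  rw [hτ, ← orbitTent_apply R δ m τ y, orbitTent, orbitTent, ← mul_sub, ← Finset.sum_sub_distrib,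
    abs_mul, abs_of_pos (by positivity), inv_mul_le_iff₀ hc]
  refine (Finset.abs_sum_le_sum_abs _ _).trans ?_
  refine (Finset.sum_le_sum fun σ _ => (abs_latticeTent_sub_le hδ m _ _).trans (le_of_eq ?_)).trans
    (le_of_eq (Finset.sum_const (2 * N / δ *
      ‖x - (τ : EuclideanSpace ℝ (Fin N) ≃ₗᵢ[ℝ] EuclideanSpace ℝ (Fin N)) y‖))) |>.trans ?_
  · rw [← map_sub, LinearIsometryEquiv.norm_map]
  · simp

theorem orbitTent_eq_zero {δ : ℝ} (hδ : 0 < δ) {m : Fin N → ℝ} {x : EuclideanSpace ℝ (Fin N)}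
    (h : N * δ < orbitDist R (WithLp.toLp 2 (fun i => δ * m i)) x) : orbitTent R δ m x = 0 := by
  rw [orbitTent, Finset.sum_eq_zero, mul_zero]
  intro σ _
  by_contra h'
  have h1 := norm_sub_le_of_latticeTent_ne_zero hδ h'
  rw [norm_sub_rev] at h1
  exact absurd ((orbitDist_le σ _ x).trans h1) (not_le.2 h)

/-- The bound on `‖x‖` holds on the whole orbit, so the lattice tents sum to `1` at each `σ x` and
their average does too. -/
theorem sum_orbitTent {n : ℕ} {δ : ℝ} (hδ : 0 < δ) {x : EuclideanSpace ℝ (Fin N)}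
    (hx : ‖x‖ ≤ δ * n) :
    ∑ k : Fin N → Fin (2 * n + 1), orbitTent R δ (fun i => ((k i : ℕ) - n : ℝ)) x = 1 := by
  have hc : (0 : ℝ) < Fintype.card (reflectionGroup R) := by exact_mod_cast Fintype.card_pos
  simp only [orbitTent]
  rw [← Finset.mul_sum, Finset.sum_comm, Finset.sum_congr rfl fun (σ : reflectionGroup R) _ =>
    sum_latticeTent (n := n) hδ (x := (σ : EuclideanSpace ℝ (Fin N) ≃ₗᵢ[ℝ] EuclideanSpace ℝ (Fin N)) x)
    (by rwa [LinearIsometryEquiv.norm_map])]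
  rw [Finset.sum_const, Finset.card_univ, nsmul_eq_mul, mul_one, inv_mul_cancel₀ hc.ne']

end Partition

/-! ### Kernel estimates and the pairing off the diagonal -/

section Kernel

variable {N : ℕ} {𝕜 : Type*} [RCLike 𝕜] {R : Set (EuclideanSpace ℝ (Fin N))} {η₀ ε : ℝ}
  {T : holderCompact 𝕜 R η₀ →ₗ[𝕜] holderCompact 𝕜 R η₀ →ₗ[𝕜] 𝕜}
  {K : EuclideanSpace ℝ (Fin N) → EuclideanSpace ℝ (Fin N) → 𝕜}

theorem IsSingularIntegral.exists_size (hT : IsSingularIntegral R η₀ ε T K) :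
    ∃ C, 0 ≤ C ∧ ∀ x y, orbitDist R x y ≠ 0 → ‖K x y‖ ≤ C * orbitDist R x y ^ (-(N : ℝ)) := by
  obtain ⟨C, hC⟩ := hT.size
  refine ⟨max C 0, le_max_right _ _, fun x y h => (hC x y h).trans ?_⟩
  have hd := orbitDist_nonneg R x y
  rw [Real.rpow_neg hd, Real.rpow_natCast, one_div]
  exact mul_le_mul_of_nonneg_right (le_max_left _ _) (by positivity)

theorem IsSingularIntegral.exists_smooth (hT : IsSingularIntegral R η₀ ε T K) :
    ∃ C, 0 ≤ C ∧ ∀ x x' y, orbitDist R x y ≠ 0 → orbitDist R x x' ≤ 1 / 2 * orbitDist R x y →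
      ‖K x y - K x' y‖ ≤ C * (orbitDist R x x' ^ ε * orbitDist R x y ^ (-(N + ε))) := by
  obtain ⟨C, hC⟩ := hT.smooth
  refine ⟨max C 0, le_max_right _ _, fun x x' y h h' => (hC x x' y h h').trans ?_⟩
  have hd := orbitDist_nonneg R x y
  have hd' := orbitDist_nonneg R x x'
  rw [Real.rpow_neg hd, ← div_eq_mul_inv]
  exact mul_le_mul_of_nonneg_right (le_max_left _ _) (by positivity)

theorem IsSingularIntegral.measurable_right (hT : IsSingularIntegral R η₀ ε T K)
    (x : EuclideanSpace ℝ (Fin N)) : Measurable (K x) :=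
  hT.measurable.comp measurable_prodMk_left

/-- A kernel of size `d ^ (-N)`, multiplied by a function of size `d ^ η` supported in `d < s`. -/
theorem norm_kernel_mul_le {C : ℝ} (hC : 0 ≤ C)
    (hK : ∀ x y, orbitDist R x y ≠ 0 → ‖K x y‖ ≤ C * orbitDist R x y ^ (-(N : ℝ))) {η : ℝ}
    (hη : 0 < η) {A s : ℝ} (hA : 0 ≤ A) {x y : EuclideanSpace ℝ (Fin N)} {a : 𝕜}
    (ha : ‖a‖ ≤ A * orbitDist R x y ^ η) (has : a ≠ 0 → orbitDist R x y < s) :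
    ‖K x y * a‖ ≤ C * A * (Set.Iio s).indicator (fun t => t ^ (η - N)) (orbitDist R x y) := by
  have hd0 := orbitDist_nonneg R x y
  have h0 : 0 ≤ C * A * (Set.Iio s).indicator (fun t => t ^ (η - N)) (orbitDist R x y) :=
    mul_nonneg (mul_nonneg hC hA) (Set.indicator_apply_nonneg fun _ => Real.rpow_nonneg hd0 _)
  by_cases ha0 : a = 0
  · simpa [ha0] using h0
  -- On the singular set `d = 0`, where `K` is uncontrolled, the bound with `η > 0` forces `a = 0`.
  by_cases hd : orbitDist R x y = 0
  · rw [hd, Real.zero_rpow hη.ne', mul_zero, norm_le_zero_iff] at ha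
    exact absurd ha ha0
  · have hdpos := hd0.lt_of_ne (Ne.symm hd)
    have hs : orbitDist R x y ∈ Set.Iio s := has ha0
    rw [Set.indicator_of_mem hs, norm_mul, sub_eq_add_neg, Real.rpow_add hdpos]
    refine (mul_le_mul (hK x y hd) ha (norm_nonneg _) (by positivity)).trans (le_of_eq ?_)
    ring

theorem integrable_of_mem_holderCompact {η : ℝ} {f : EuclideanSpace ℝ (Fin N) → 𝕜}
    (hf : f ∈ holderCompact 𝕜 R η) : Integrable f :=
  hf.1.1.integrable_of_hasCompactSupport hf.2

/-- The weak boundedness property, in homogeneous form. -/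
theorem WeakBoundedness.exists_norm_le (hW : WeakBoundedness T) : ∃ C, 0 ≤ C ∧
    ∀ (x₀ y₀ : EuclideanSpace ℝ (Fin N)) (r A B : ℝ) (f g : holderCompact 𝕜 R η₀),
      0 < r → 0 < A → 0 < B →
      tsupport (f : EuclideanSpace ℝ (Fin N) → 𝕜) ⊆ orbitBall R y₀ r →
      tsupport (g : EuclideanSpace ℝ (Fin N) → 𝕜) ⊆ orbitBall R x₀ r →
      (∀ x, ‖(f : EuclideanSpace ℝ (Fin N) → 𝕜) x‖ ≤ A) →
      (∀ x, ‖(g : EuclideanSpace ℝ (Fin N) → 𝕜) x‖ ≤ B) →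
      HolderBound R η₀ (A * r ^ (-η₀)) (f : EuclideanSpace ℝ (Fin N) → 𝕜) →
      HolderBound R η₀ (B * r ^ (-η₀)) (g : EuclideanSpace ℝ (Fin N) → 𝕜) →
      ‖T f g‖ ≤ C * (A * B * r ^ N) := by
  obtain ⟨C, hC⟩ := hW
  refine ⟨max C 0, le_max_right _ _, fun x₀ y₀ r A B f g hr hA hB hf hg hfA hgB hfh hgh => ?_⟩
  have scale : ∀ (u : holderCompact 𝕜 R η₀) (D : ℝ), 0 < D →
      (∀ x, ‖(u : EuclideanSpace ℝ (Fin N) → 𝕜) x‖ ≤ D) →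
      HolderBound R η₀ (D * r ^ (-η₀)) (u : EuclideanSpace ℝ (Fin N) → 𝕜) →
      (∀ x, ‖((((D⁻¹ : ℝ) : 𝕜) • u : holderCompact 𝕜 R η₀) : EuclideanSpace ℝ (Fin N) → 𝕜) x‖ ≤ 1) ∧
      holderNorm R η₀ ((((D⁻¹ : ℝ) : 𝕜) • u : holderCompact 𝕜 R η₀) :
        EuclideanSpace ℝ (Fin N) → 𝕜) ≤ r ^ (-η₀) := by
    intro u D hD h1 h2
    have hn : ‖((D⁻¹ : ℝ) : 𝕜)‖ = D⁻¹ := by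
      rw [RCLike.norm_ofReal, abs_of_pos (by positivity)]
    constructor
    · intro x
      change ‖((D⁻¹ : ℝ) : 𝕜) * (u : EuclideanSpace ℝ (Fin N) → 𝕜) x‖ ≤ 1
      rw [norm_mul, hn, inv_mul_le_iff₀ hD, mul_one]
      exact h1 x
    · have h3 := h2.const_mul ((D⁻¹ : ℝ) : 𝕜)
      rw [hn, inv_mul_cancel_left₀ hD.ne'] at h3
      exact h3.holderNorm_le (by positivity)
  obtain ⟨hf1, hf2⟩ := scale f A hA hfA hfh
  obtain ⟨hg1, hg2⟩ := scale g B hB hgB hgh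
  have h := hC x₀ y₀ r (((A⁻¹ : ℝ) : 𝕜) • f) (((B⁻¹ : ℝ) : 𝕜) • g) hr
    ((closure_mono (Function.support_const_smul_subset _ _)).trans hf)
    ((closure_mono (Function.support_const_smul_subset _ _)).trans hg) hf1 hg1 hf2 hg2
  rw [map_smul, map_smul, LinearMap.smul_apply, smul_eq_mul, smul_eq_mul, norm_mul, norm_mul,
    RCLike.norm_ofReal, RCLike.norm_ofReal, abs_of_pos (by positivity : 0 < A⁻¹),
    abs_of_pos (by positivity : 0 < B⁻¹)] at h
  have h2 : ‖T f g‖ = A * B * (B⁻¹ * (A⁻¹ * ‖T f g‖)) := by field_simp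
  rw [h2]
  calc A * B * (B⁻¹ * (A⁻¹ * ‖T f g‖)) ≤ A * B * (C * r ^ N) := by gcongr
    _ ≤ A * B * (max C 0 * r ^ N) := by gcongr; exact le_max_left _ _
    _ = max C 0 * (A * B * r ^ N) := by ring

/-- Off the diagonal, `T` is given by its kernel. -/
theorem IsSingularIntegral.apply_of_separated (hT : IsSingularIntegral R η₀ ε T K)
    (f g : holderCompact 𝕜 R η₀) {s : ℝ} (hs : 0 < s)
    (hfg : ∀ x y, (g : EuclideanSpace ℝ (Fin N) → 𝕜) x ≠ 0 →
      (f : EuclideanSpace ℝ (Fin N) → 𝕜) y ≠ 0 → s ≤ orbitDist R x y) :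
    (Integrable fun x => (∫ y, K x y * (f : EuclideanSpace ℝ (Fin N) → 𝕜) y) *
      (g : EuclideanSpace ℝ (Fin N) → 𝕜) x) ∧
    T f g = ∫ x, (∫ y, K x y * (f : EuclideanSpace ℝ (Fin N) → 𝕜) y) *
      (g : EuclideanSpace ℝ (Fin N) → 𝕜) x ∧
    ∀ x, (g : EuclideanSpace ℝ (Fin N) → 𝕜) x ≠ 0 →
      Integrable fun y => K x y * (f : EuclideanSpace ℝ (Fin N) → 𝕜) y := by
  obtain ⟨C, hC, hK⟩ := hT.exists_size
  have hf := integrable_of_mem_holderCompact f.2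
  have hg := integrable_of_mem_holderCompact g.2
  -- Separation of the supports keeps `K` bounded by `C * s ^ (-N)` where the integrand lives, so
  -- the double integral converges absolutely.
  have hbd : ∀ x y, (g : EuclideanSpace ℝ (Fin N) → 𝕜) x ≠ 0 →
      ‖K x y * (f : EuclideanSpace ℝ (Fin N) → 𝕜) y‖ ≤
        C * s ^ (-(N : ℝ)) * ‖(f : EuclideanSpace ℝ (Fin N) → 𝕜) y‖ := by
    intro x y hx
    by_cases hy : (f : EuclideanSpace ℝ (Fin N) → 𝕜) y = 0
    · simp [hy]
    · have h1 := hfg x y hx hy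
      rw [norm_mul]
      refine mul_le_mul_of_nonneg_right ((hK x y (by linarith)).trans ?_) (norm_nonneg _)
      refine mul_le_mul_of_nonneg_left ?_ hC
      exact Real.rpow_le_rpow_of_nonpos hs h1 (by simp)
  have hint : Integrable (fun p : EuclideanSpace ℝ (Fin N) × EuclideanSpace ℝ (Fin N) =>
      K p.1 p.2 * (f : EuclideanSpace ℝ (Fin N) → 𝕜) p.2 *
        (g : EuclideanSpace ℝ (Fin N) → 𝕜) p.1) (volume.prod volume) := by
    refine (((hg.norm.mul_prod hf.norm).const_mul (C * s ^ (-(N : ℝ))))).mono' ?_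
      (Eventually.of_forall fun p => ?_)
    · exact ((hT.measurable.mul (f.2.1.1.measurable.comp measurable_snd)).mul
        (g.2.1.1.measurable.comp measurable_fst)).aestronglyMeasurable
    · by_cases hx : (g : EuclideanSpace ℝ (Fin N) → 𝕜) p.1 = 0
      · simp [hx]
      · rw [norm_mul]
        refine (mul_le_mul_of_nonneg_right (hbd p.1 p.2 hx) (norm_nonneg _)).trans (le_of_eq ?_)
        ring
  refine ⟨?_, ?_, fun x hx => ?_⟩
  · have := hint.integral_prod_left
    simpa only [integral_mul_const] using this
  · rw [hT.repr f g hint]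
    simp only [integral_mul_const]
  · refine (hf.norm.const_mul (C * s ^ (-(N : ℝ)))).mono' ?_
      (Eventually.of_forall fun y => hbd x y hx)
    exact ((hT.measurable_right x).mul f.2.1.1.measurable).aestronglyMeasurable

variable [Finite (reflectionGroup R)]

/-- Multiplication by `f` on compactly supported Hölder functions. -/
def mulHolder (hN : 1 ≤ N) (hη₀ : 0 < η₀) (f : holderCompact 𝕜 R η₀) :
    holderCompact 𝕜 R η₀ →ₗ[𝕜] holderCompact 𝕜 R η₀ where
  toFun g := ⟨f * g, mul_mem_holderCompact hN hη₀ f.2 g.2⟩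
  map_add' _ _ := Subtype.ext (mul_add _ _ _)
  map_smul' c _ := Subtype.ext (mul_smul_comm c _ _)

theorem mulHolder_apply (hN : 1 ≤ N) (hη₀ : 0 < η₀) (f g : holderCompact 𝕜 R η₀)
    (x : EuclideanSpace ℝ (Fin N)) :
    (mulHolder hN hη₀ f g : EuclideanSpace ℝ (Fin N) → 𝕜) x =
      (f : EuclideanSpace ℝ (Fin N) → 𝕜) x * (g : EuclideanSpace ℝ (Fin N) → 𝕜) x := rfl

end Kernel

/-! ### Rescaling bumps for the weak boundedness property -/

section LocalBounds

variable {N : ℕ} {𝕜 : Type*} [RCLike 𝕜] {R : Set (EuclideanSpace ℝ (Fin N))}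

/-- A cutoff of scale `ρ` lives on `d ≤ 4ρ`, so weak boundedness is applied in the open ball of
radius `5ρ`. For `η ≤ 1` this change of scale costs at most a factor `5`. -/
theorem le_five_mul_rpow_neg {η ρ c : ℝ} (hη1 : η ≤ 1) (hρ : 0 < ρ) (hc : 0 ≤ c) :
    c * ρ ^ (-η) ≤ 5 * c * (5 * ρ) ^ (-η) := by
  rw [Real.mul_rpow (by norm_num) hρ.le]
  have h : (5 : ℝ)⁻¹ ≤ 5 ^ (-η) := by
    rw [← Real.rpow_neg_one]
    exact Real.rpow_le_rpow_of_exponent_le (by norm_num) (by linarith)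
  have h2 : 0 ≤ c * ρ ^ (-η) := by positivity
  nlinarith [mul_le_mul_of_nonneg_right h h2]

/-- A bump of scale `ρ`, multiplied by a fixed Hölder function. -/
theorem HolderBound.mul_bump {η : ℝ} (hη : 0 < η) (hη1 : η ≤ 1) {M H L ρ : ℝ} (hM : 0 ≤ M)
    (hH : 0 ≤ H) (hL : 0 ≤ L) (hρ : 0 < ρ) (hρ1 : ρ ≤ 1) {p θ : EuclideanSpace ℝ (Fin N) → 𝕜}
    (hp : HolderBound R η H p) (hpM : ∀ x, ‖p x‖ ≤ M) (hθ : HolderBound R η (L * ρ ^ (-η)) θ)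
    (hθ1 : ∀ x, ‖θ x‖ ≤ 1) :
    (∀ x, ‖p x * θ x‖ ≤ 5 * (M * L + H) + M) ∧
      HolderBound R η ((5 * (M * L + H) + M) * (5 * ρ) ^ (-η)) (fun x => p x * θ x) := by
  constructor
  · intro x
    rw [norm_mul]
    have h1 := mul_le_mul (hpM x) (hθ1 x) (norm_nonneg _) hM
    have h2 : 0 ≤ M * L := by positivity
    linarith
  · refine (hp.mul_of_support hθ hH (by positivity) hM zero_le_one (fun x _ => hpM x) hθ1).mono ?_
    -- Since `ρ ≤ 1`, the fixed Hölder constant `H` is absorbed into `H * ρ ^ (-η)`.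
    have h1 : 1 ≤ ρ ^ (-η) := Real.one_le_rpow_of_pos_of_le_one_of_nonpos hρ hρ1 (by linarith)
    have h2 : M * (L * ρ ^ (-η)) + H * 1 ≤ (M * L + H) * ρ ^ (-η) := by nlinarith
    refine h2.trans ((le_five_mul_rpow_neg hη1 hρ (by positivity)).trans ?_)
    gcongr
    linarith

/-- A bump of scale `ρ` around `z`, multiplied by a Hölder function that vanishes at `z`. -/
theorem HolderBound.mul_bump_of_vanishing {η : ℝ} (hη : 0 < η) (hη1 : η ≤ 1) {H H' L ρ : ℝ}
    (hH : 0 ≤ H) (hH' : 0 ≤ H') (hL : 0 ≤ L) (hρ : 0 < ρ) {z : EuclideanSpace ℝ (Fin N)}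
    {q θ : EuclideanSpace ℝ (Fin N) → 𝕜} (hq : HolderBound R η H q)
    (hqz : ∀ x, ‖q x‖ ≤ H' * orbitDist R z x ^ η) (hθ : HolderBound R η (L * ρ ^ (-η)) θ)
    (hθ1 : ∀ x, ‖θ x‖ ≤ 1) (hsupp : ∀ x, 4 * ρ < orbitDist R z x → θ x = 0) :
    (∀ x, ‖q x * θ x‖ ≤ (5 * (4 * H' * L + H) + 4 * H') * ρ ^ η) ∧
      HolderBound R η ((5 * (4 * H' * L + H) + 4 * H') * ρ ^ η * (5 * ρ) ^ (-η))
        (fun x => q x * θ x) := by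
  -- The gain: on the support of `θ` the distance to `z` is at most `4ρ`, so `q` has size `ρ ^ η`.
  have h4 : ∀ x, θ x ≠ 0 → ‖q x‖ ≤ 4 * H' * ρ ^ η := by
    intro x hx
    have hx' : orbitDist R z x ≤ 4 * ρ := not_lt.1 fun h => hx (hsupp x h)
    refine (hqz x).trans ?_
    have h5 : (4 : ℝ) ^ η ≤ 4 := by
      simpa using Real.rpow_le_rpow_of_exponent_le (by norm_num : (1 : ℝ) ≤ 4) hη1
    have h6 : orbitDist R z x ^ η ≤ 4 * ρ ^ η := by
      refine (Real.rpow_le_rpow (orbitDist_nonneg R z x) hx' hη.le).trans ?_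
      rw [Real.mul_rpow (by norm_num) hρ.le]
      gcongr
    nlinarith
  have hρη : 0 < ρ ^ η := by positivity
  constructor
  · intro x
    by_cases hx : θ x = 0
    · rw [hx, mul_zero, norm_zero]; positivity
    · rw [norm_mul]
      have h1 := mul_le_mul (h4 x hx) (hθ1 x) (norm_nonneg _) (by positivity)
      rw [mul_one] at h1
      refine h1.trans ?_
      gcongr
      have : 0 ≤ 5 * (4 * H' * L + H) := by positivity
      linarith
  · refine (hq.mul_of_support hθ hH (by positivity) (by positivity) zero_le_one h4 hθ1).mono ?_
    have h1 : ρ ^ η * ρ ^ (-η) = 1 := by rw [← Real.rpow_add hρ]; simp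
    have h2 : 4 * H' * ρ ^ η * (L * ρ ^ (-η)) + H * 1 =
        (4 * H' * L + H) * ρ ^ η * ρ ^ (-η) := by
      linear_combination (H * (-1 : ℝ)) * h1
    rw [h2]
    refine (le_five_mul_rpow_neg hη1 hρ (by positivity)).trans ?_
    refine mul_le_mul_of_nonneg_right ?_ (by positivity)
    nlinarith [mul_nonneg hH' hρη.le]

end LocalBounds

/-! ### The commutator and its reduction to the diagonal -/

section Commutator

variable {N : ℕ} {𝕜 : Type*} [RCLike 𝕜] {R : Set (EuclideanSpace ℝ (Fin N))} {η₀ ε : ℝ}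
  {T : holderCompact 𝕜 R η₀ →ₗ[𝕜] holderCompact 𝕜 R η₀ →ₗ[𝕜] 𝕜}
  {K : EuclideanSpace ℝ (Fin N) → EuclideanSpace ℝ (Fin N) → 𝕜}

variable (K) in
/-- The function `x ↦ ∫ K(x,y) (F(y) G(x) - G(y) F(x)) dy`. -/
noncomputable def commutatorKernel (F G : EuclideanSpace ℝ (Fin N) → 𝕜)
    (x : EuclideanSpace ℝ (Fin N)) : 𝕜 :=
  ∫ y, K x y * (F y * G x - G y * F x)

theorem measurable_integral_kernel_mul (hK : Measurable (Function.uncurry K))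
    {a : EuclideanSpace ℝ (Fin N) → EuclideanSpace ℝ (Fin N) → 𝕜}
    (ha : Measurable (Function.uncurry a)) : Measurable fun x => ∫ y, K x y * a x y :=
  ((hK.mul ha).stronglyMeasurable.integral_prod_right (ν := volume)).measurable

/-- The expression equals `(F(y) - F(x)) G(x) - (G(y) - G(x)) F(x)`. Its Hölder vanishing at `d = 0`
turns the singularity `d ^ (-N)` into the integrable `d ^ (η - N)`. -/
theorem norm_antisymm_le {η M H : ℝ} {F G : EuclideanSpace ℝ (Fin N) → 𝕜}
    (hF : HolderBound R η H F) (hG : HolderBound R η H G) (hFM : ∀ x, ‖F x‖ ≤ M)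
    (hGM : ∀ x, ‖G x‖ ≤ M) (x y : EuclideanSpace ℝ (Fin N)) :
    ‖F y * G x - G y * F x‖ ≤ 2 * M * H * orbitDist R y x ^ η := by
  have h : F y * G x - G y * F x = (F y - F x) * G x - (G y - G x) * F x := by ring
  have hd := orbitDist_rpow_nonneg (R := R) y x η
  rw [h]
  refine (norm_sub_le _ _).trans ?_
  rw [norm_mul, norm_mul]
  have h1 := mul_le_mul (hF y x) (hGM x) (norm_nonneg _) ((norm_nonneg _).trans (hF y x))
  have h2 := mul_le_mul (hG y x) (hFM x) (norm_nonneg _) ((norm_nonneg _).trans (hG y x))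
  linarith

variable [Finite (reflectionGroup R)]

theorem IsSingularIntegral.integrable_commutator (hN : 1 ≤ N) (hη₀ : 0 < η₀)
    (hT : IsSingularIntegral R η₀ ε T K) (F G : holderCompact 𝕜 R η₀) :
    (∀ x, Integrable fun y => K x y * ((F : EuclideanSpace ℝ (Fin N) → 𝕜) y *
      (G : EuclideanSpace ℝ (Fin N) → 𝕜) x - (G : EuclideanSpace ℝ (Fin N) → 𝕜) y *
      (F : EuclideanSpace ℝ (Fin N) → 𝕜) x)) ∧
    Measurable (commutatorKernel K (F : EuclideanSpace ℝ (Fin N) → 𝕜) G) ∧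
    ∃ B, ∀ x, ‖commutatorKernel K (F : EuclideanSpace ℝ (Fin N) → 𝕜) G x‖ ≤ B := by
  obtain ⟨C, hC, hK⟩ := hT.exists_size
  obtain ⟨M₁, hM₁, hF⟩ := exists_norm_le_of_mem_holderCompact F.2
  obtain ⟨M₂, hM₂, hG⟩ := exists_norm_le_of_mem_holderCompact G.2
  obtain ⟨r₁, hr₁, hFr⟩ := exists_orbitDist_le_of_mem_holderCompact F.2
  obtain ⟨r₂, hr₂, hGr⟩ := exists_orbitDist_le_of_mem_holderCompact G.2
  obtain ⟨D, hD, hnear⟩ := exists_integral_near_le (R := R) hN hη₀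
  have hFH := holderBound_of_mem_holderSpace hN hη₀ F.2.1
  have hGH := holderBound_of_mem_holderSpace hN hη₀ G.2.1
  set M := max M₁ M₂
  set H := max (holderNorm R η₀ (F : EuclideanSpace ℝ (Fin N) → 𝕜))
    (holderNorm R η₀ (G : EuclideanSpace ℝ (Fin N) → 𝕜))
  have hH : 0 ≤ H := le_max_of_le_left (holderNorm_nonneg _ _)
  have hM : 0 ≤ M := le_max_of_le_left hM₁.le
  have hanti := norm_antisymm_le (hFH.mono (le_max_left _ _ : _ ≤ H))
    (hGH.mono (le_max_right _ _ : _ ≤ H)) (fun x => (hF x).trans (le_max_left _ _ : _ ≤ M))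
    (fun x => (hG x).trans (le_max_right _ _ : _ ≤ M))
  have hs : 0 < r₁ + r₂ + 1 := by positivity
  have hbd : ∀ x y, ‖K x y * ((F : EuclideanSpace ℝ (Fin N) → 𝕜) y *
      (G : EuclideanSpace ℝ (Fin N) → 𝕜) x - (G : EuclideanSpace ℝ (Fin N) → 𝕜) y *
      (F : EuclideanSpace ℝ (Fin N) → 𝕜) x)‖ ≤ C * (2 * M * H) *
        (Set.Iio (r₁ + r₂ + 1)).indicator (fun t => t ^ (η₀ - N)) (orbitDist R x y) := by
    intro x y
    refine norm_kernel_mul_le hC hK hη₀ (by positivity) ?_ fun h => ?_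
    · rw [orbitDist_comm x y]
      exact hanti x y
    -- If one of the two products is nonzero, then one of `x`, `y` lies in the support of `F` and
    -- the other in that of `G`, whence `‖x‖ + ‖y‖ ≤ r₁ + r₂`.
    · refine (orbitDist_le_norm x y).trans_lt ((norm_sub_le x y).trans_lt ?_)
      by_contra h'
      refine h ?_
      have h1 : (F : EuclideanSpace ℝ (Fin N) → 𝕜) y * (G : EuclideanSpace ℝ (Fin N) → 𝕜) x = 0 := by
        by_cases hy : r₁ < ‖y‖
        · rw [hFr y hy, zero_mul]
        · rw [hGr x (by linarith), mul_zero]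
      have h2 : (G : EuclideanSpace ℝ (Fin N) → 𝕜) y * (F : EuclideanSpace ℝ (Fin N) → 𝕜) x = 0 := by
        by_cases hy : r₂ < ‖y‖
        · rw [hGr y hy, zero_mul]
        · rw [hFr x (by linarith), mul_zero]
      rw [h1, h2, sub_zero]
  have ha : Measurable (Function.uncurry fun x y => (F : EuclideanSpace ℝ (Fin N) → 𝕜) y *
      (G : EuclideanSpace ℝ (Fin N) → 𝕜) x - (G : EuclideanSpace ℝ (Fin N) → 𝕜) y *
      (F : EuclideanSpace ℝ (Fin N) → 𝕜) x) := by
    have hFm := F.2.1.1.measurable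
    have hGm := G.2.1.1.measurable
    exact ((hFm.comp measurable_snd).mul (hGm.comp measurable_fst)).sub
      ((hGm.comp measurable_snd).mul (hFm.comp measurable_fst))
  refine ⟨fun x => ((hnear x _ hs).1.const_mul _).mono' ?_ (Eventually.of_forall (hbd x)),
    measurable_integral_kernel_mul hT.measurable ha,
    C * (2 * M * H) * (D * (r₁ + r₂ + 1) ^ η₀), fun x => ?_⟩
  · exact ((hT.measurable_right x).mul (ha.comp measurable_prodMk_left)).aestronglyMeasurable
  · refine (norm_integral_le_of_norm_le ((hnear x _ hs).1.const_mul _)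
      (Eventually.of_forall (hbd x))).trans ?_
    rw [integral_const_mul]
    exact mul_le_mul_of_nonneg_left (hnear x _ hs).2 (by positivity)

theorem IsSingularIntegral.integrable_commutatorKernel_mul (hN : 1 ≤ N) (hη₀ : 0 < η₀)
    (hT : IsSingularIntegral R η₀ ε T K) (F G h : holderCompact 𝕜 R η₀) :
    Integrable fun x => commutatorKernel K (F : EuclideanSpace ℝ (Fin N) → 𝕜) G x *
      (h : EuclideanSpace ℝ (Fin N) → 𝕜) x := by
  obtain ⟨-, hm, B, hB⟩ := hT.integrable_commutator hN hη₀ F G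
  exact (integrable_of_mem_holderCompact h.2).bdd_mul hm.aestronglyMeasurable
    (Eventually.of_forall hB)

/-- The difference between the two sides of the commutator identity, as a functional of the test
function. -/
noncomputable def commutatorDefect (hN : 1 ≤ N) (hη₀ : 0 < η₀)
    (hT : IsSingularIntegral R η₀ ε T K) (F G : holderCompact 𝕜 R η₀) :
    holderCompact 𝕜 R η₀ →ₗ[𝕜] 𝕜 where
  toFun h := T F (mulHolder hN hη₀ G h) - T G (mulHolder hN hη₀ F h) -
    ∫ x, commutatorKernel K (F : EuclideanSpace ℝ (Fin N) → 𝕜) G x *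
      (h : EuclideanSpace ℝ (Fin N) → 𝕜) x
  map_add' h k := by
    have h1 : ∀ x, commutatorKernel K (F : EuclideanSpace ℝ (Fin N) → 𝕜) G x *
        ((h + k : holderCompact 𝕜 R η₀) : EuclideanSpace ℝ (Fin N) → 𝕜) x =
        commutatorKernel K (F : EuclideanSpace ℝ (Fin N) → 𝕜) G x *
          (h : EuclideanSpace ℝ (Fin N) → 𝕜) x +
        commutatorKernel K (F : EuclideanSpace ℝ (Fin N) → 𝕜) G x *
          (k : EuclideanSpace ℝ (Fin N) → 𝕜) x := fun x => mul_add _ _ _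
    simp only [h1, map_add]
    rw [integral_add (hT.integrable_commutatorKernel_mul hN hη₀ F G h)
      (hT.integrable_commutatorKernel_mul hN hη₀ F G k)]
    ring
  map_smul' c h := by
    have h1 : ∀ x, commutatorKernel K (F : EuclideanSpace ℝ (Fin N) → 𝕜) G x *
        ((c • h : holderCompact 𝕜 R η₀) : EuclideanSpace ℝ (Fin N) → 𝕜) x =
        c * (commutatorKernel K (F : EuclideanSpace ℝ (Fin N) → 𝕜) G x *
          (h : EuclideanSpace ℝ (Fin N) → 𝕜) x) := fun x => by
      change _ * (c * (h : EuclideanSpace ℝ (Fin N) → 𝕜) x) = _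
      ring
    simp only [h1, map_smul, integral_const_mul, RingHom.id_apply, smul_eq_mul]
    ring

/-- On a test function of scale `ρ`, the commutator defect reduces to the diagonal. -/
theorem commutatorDefect_eq (hN : 1 ≤ N) (hη₀ : 0 < η₀)
    (hT : IsSingularIntegral R η₀ ε T K) (F G h χ : holderCompact 𝕜 R η₀)
    {ρ : ℝ} (hρ : 0 < ρ) {z : EuclideanSpace ℝ (Fin N)}
    (hχ : (χ : EuclideanSpace ℝ (Fin N) → 𝕜) = fun y => (cutoff R z ρ y : 𝕜))
    (hh : ∀ x, ρ < orbitDist R z x → (h : EuclideanSpace ℝ (Fin N) → 𝕜) x = 0) :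
    commutatorDefect hN hη₀ hT F G h =
      T (mulHolder hN hη₀ F χ) (mulHolder hN hη₀ G h) -
        T (mulHolder hN hη₀ G χ) (mulHolder hN hη₀ F h) -
      ∫ x, (∫ y, K x y * ((F : EuclideanSpace ℝ (Fin N) → 𝕜) y *
        (G : EuclideanSpace ℝ (Fin N) → 𝕜) x - (G : EuclideanSpace ℝ (Fin N) → 𝕜) y *
        (F : EuclideanSpace ℝ (Fin N) → 𝕜) x) * (χ : EuclideanSpace ℝ (Fin N) → 𝕜) y) *
          (h : EuclideanSpace ℝ (Fin N) → 𝕜) x := by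
  -- On the support of `h`, `d(z,x) ≤ ρ`; on that of `P (1 - χ)`, `d(z,y) ≥ 2ρ`. So the kernel
  -- represents `T` on `P (1 - χ)`, and only `P χ` remains.
  have hdist : ∀ (P : holderCompact 𝕜 R η₀) (x y : EuclideanSpace ℝ (Fin N)),
      (h : EuclideanSpace ℝ (Fin N) → 𝕜) x ≠ 0 →
      ((P - mulHolder hN hη₀ P χ : holderCompact 𝕜 R η₀) : EuclideanSpace ℝ (Fin N) → 𝕜) y ≠ 0 →
      ρ ≤ orbitDist R x y := by
    intro P x y hx hy
    have hx' : orbitDist R z x ≤ ρ := by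
      by_contra h'
      exact hx (hh x (not_le.1 h'))
    have hy' : 2 * ρ ≤ orbitDist R z y := by
      by_contra h'
      refine hy ?_
      change (P : EuclideanSpace ℝ (Fin N) → 𝕜) y - (P : EuclideanSpace ℝ (Fin N) → 𝕜) y *
        (χ : EuclideanSpace ℝ (Fin N) → 𝕜) y = 0
      rw [hχ]
      simp only
      rw [cutoff_eq_one hρ (not_le.1 h').le, RCLike.ofReal_one, mul_one, sub_self]
    linarith [orbitDist_triangle (R := R) z x y]
  have key := fun P Q : holderCompact 𝕜 R η₀ =>
    hT.apply_of_separated (P - mulHolder hN hη₀ P χ) (mulHolder hN hη₀ Q h) hρ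
      fun x y hx hy => hdist P x y (right_ne_zero_of_mul hx) hy
  have hsep := fun P : holderCompact 𝕜 R η₀ =>
    (hT.apply_of_separated (P - mulHolder hN hη₀ P χ) h hρ (hdist P)).2.2
  obtain ⟨hi1, he1, -⟩ := key F G
  obtain ⟨hi2, he2, -⟩ := key G F
  have hi3 := hT.integrable_commutatorKernel_mul hN hη₀ F G h
  have hinner := (hT.integrable_commutator hN hη₀ F G).1
  -- Removing the off-diagonal contributions of `F (1 - χ)` and `G (1 - χ)` from the commutator
  -- integral leaves its integrand multiplied by `χ(y)`.
  have hpt : ∀ x, commutatorKernel K (F : EuclideanSpace ℝ (Fin N) → 𝕜) G x *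
      (h : EuclideanSpace ℝ (Fin N) → 𝕜) x -
      ((∫ y, K x y *
        ((F - mulHolder hN hη₀ F χ : holderCompact 𝕜 R η₀) : EuclideanSpace ℝ (Fin N) → 𝕜) y) *
        (mulHolder hN hη₀ G h : EuclideanSpace ℝ (Fin N) → 𝕜) x -
      (∫ y, K x y *
        ((G - mulHolder hN hη₀ G χ : holderCompact 𝕜 R η₀) : EuclideanSpace ℝ (Fin N) → 𝕜) y) *
        (mulHolder hN hη₀ F h : EuclideanSpace ℝ (Fin N) → 𝕜) x) =
      (∫ y, K x y * ((F : EuclideanSpace ℝ (Fin N) → 𝕜) y *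
        (G : EuclideanSpace ℝ (Fin N) → 𝕜) x - (G : EuclideanSpace ℝ (Fin N) → 𝕜) y *
        (F : EuclideanSpace ℝ (Fin N) → 𝕜) x) * (χ : EuclideanSpace ℝ (Fin N) → 𝕜) y) *
          (h : EuclideanSpace ℝ (Fin N) → 𝕜) x := by
    intro x
    by_cases hx : (h : EuclideanSpace ℝ (Fin N) → 𝕜) x = 0
    · simp [mulHolder_apply, hx]
    have hs1 := (hsep F x hx).mul_const ((G : EuclideanSpace ℝ (Fin N) → 𝕜) x)
    have hs2 := (hsep G x hx).mul_const ((F : EuclideanSpace ℝ (Fin N) → 𝕜) x)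
    have hs3 : Integrable fun y => K x y * ((F - mulHolder hN hη₀ F χ : holderCompact 𝕜 R η₀) :
        EuclideanSpace ℝ (Fin N) → 𝕜) y * (G : EuclideanSpace ℝ (Fin N) → 𝕜) x -
        K x y * ((G - mulHolder hN hη₀ G χ : holderCompact 𝕜 R η₀) :
        EuclideanSpace ℝ (Fin N) → 𝕜) y * (F : EuclideanSpace ℝ (Fin N) → 𝕜) x := hs1.sub hs2
    rw [mulHolder_apply, mulHolder_apply, ← mul_assoc, ← mul_assoc, ← sub_mul, ← sub_mul,
      ← integral_mul_const, ← integral_mul_const, ← integral_sub hs1 hs2, commutatorKernel,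
      ← integral_sub (hinner x) hs3]
    congr 2
    ext y
    change _ - (K x y * ((F : EuclideanSpace ℝ (Fin N) → 𝕜) y -
      (F : EuclideanSpace ℝ (Fin N) → 𝕜) y * (χ : EuclideanSpace ℝ (Fin N) → 𝕜) y) * _ -
      K x y * ((G : EuclideanSpace ℝ (Fin N) → 𝕜) y -
      (G : EuclideanSpace ℝ (Fin N) → 𝕜) y * (χ : EuclideanSpace ℝ (Fin N) → 𝕜) y) * _) = _
    ring
  simp_rw [← hpt]
  have hi4 : Integrable fun x => (∫ y, K x y *
        ((F - mulHolder hN hη₀ F χ : holderCompact 𝕜 R η₀) : EuclideanSpace ℝ (Fin N) → 𝕜) y) *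
        (mulHolder hN hη₀ G h : EuclideanSpace ℝ (Fin N) → 𝕜) x -
      (∫ y, K x y *
        ((G - mulHolder hN hη₀ G χ : holderCompact 𝕜 R η₀) : EuclideanSpace ℝ (Fin N) → 𝕜) y) *
        (mulHolder hN hη₀ F h : EuclideanSpace ℝ (Fin N) → 𝕜) x := hi1.sub hi2
  rw [integral_sub hi3 hi4, integral_sub hi1 hi2, ← he1, ← he2]
  change T F (mulHolder hN hη₀ G h) - T G (mulHolder hN hη₀ F h) - _ = _
  rw [map_sub, map_sub, LinearMap.sub_apply, LinearMap.sub_apply]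
  ring

end Commutator

/-! ### The commutator identity -/

section CommutatorIdentity

variable {N : ℕ} {𝕜 : Type*} [RCLike 𝕜] {R : Set (EuclideanSpace ℝ (Fin N))} {η₀ ε : ℝ}
  {T : holderCompact 𝕜 R η₀ →ₗ[𝕜] holderCompact 𝕜 R η₀ →ₗ[𝕜] 𝕜}
  {K : EuclideanSpace ℝ (Fin N) → EuclideanSpace ℝ (Fin N) → 𝕜}
  [Finite (reflectionGroup R)]

theorem exists_holder_const (hN : 1 ≤ N) (hη₀ : 0 < η₀) (f : holderCompact 𝕜 R η₀) :
    ∃ B, 0 < B ∧ (∀ x, ‖(f : EuclideanSpace ℝ (Fin N) → 𝕜) x‖ ≤ B) ∧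
      HolderBound R η₀ B (f : EuclideanSpace ℝ (Fin N) → 𝕜) := by
  obtain ⟨M, hM, hf⟩ := exists_norm_le_of_mem_holderCompact f.2
  have h := holderBound_of_mem_holderSpace hN hη₀ f.2.1
  have h0 := holderNorm_nonneg (R := R) η₀ (f : EuclideanSpace ℝ (Fin N) → 𝕜)
  exact ⟨M + holderNorm R η₀ (f : EuclideanSpace ℝ (Fin N) → 𝕜), by positivity,
    fun x => (hf x).trans (by linarith), h.mono (by linarith)⟩

theorem tsupport_mul_bump_subset {z : EuclideanSpace ℝ (Fin N)} {ρ : ℝ} (hρ : 0 < ρ)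
    {f θ : EuclideanSpace ℝ (Fin N) → 𝕜} (hθ : ∀ x, 4 * ρ < orbitDist R z x → θ x = 0)
    (hf : ∀ x, θ x = 0 → f x = 0) : tsupport f ⊆ orbitBall R z (5 * ρ) :=
  tsupport_subset_orbitBall (r := 4 * ρ) (by linarith) fun x hx => hf x (hθ x hx)

/-- The weak boundedness property controls the commutator near the diagonal. -/
theorem WeakBoundedness.exists_commutator_le (hN : 1 ≤ N) (hη₀ : 0 < η₀) (hη₁ : η₀ ≤ 1)
    (hW : WeakBoundedness T) (F G g : holderCompact 𝕜 R η₀) {L : ℝ} (hL : 0 ≤ L) :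
    ∃ C, ∀ (ρ : ℝ) (z : EuclideanSpace ℝ (Fin N)) (θ χ : holderCompact 𝕜 R η₀), 0 < ρ → ρ ≤ 1 →
      (χ : EuclideanSpace ℝ (Fin N) → 𝕜) = (fun y => (cutoff R z ρ y : 𝕜)) →
      (∀ x, ‖(θ : EuclideanSpace ℝ (Fin N) → 𝕜) x‖ ≤ 1) →
      HolderBound R η₀ (L * ρ ^ (-η₀)) (θ : EuclideanSpace ℝ (Fin N) → 𝕜) →
      (∀ x, ρ < orbitDist R z x → (θ : EuclideanSpace ℝ (Fin N) → 𝕜) x = 0) →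
      ‖T (mulHolder hN hη₀ F χ) (mulHolder hN hη₀ G (mulHolder hN hη₀ g θ)) -
        T (mulHolder hN hη₀ G χ) (mulHolder hN hη₀ F (mulHolder hN hη₀ g θ))‖ ≤
        C * (ρ ^ η₀ * ρ ^ N) := by
  obtain ⟨C, hC, hW⟩ := hW.exists_norm_le
  obtain ⟨B₁, hB₁, hF, hFH⟩ := exists_holder_const hN hη₀ F
  obtain ⟨B₂, hB₂, hG, hGH⟩ := exists_holder_const hN hη₀ G
  obtain ⟨B₃, hB₃, hg, -⟩ := exists_holder_const hN hη₀ g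
  obtain ⟨B₄, hB₄, hFg, hFgH⟩ := exists_holder_const hN hη₀ (mulHolder hN hη₀ F g)
  obtain ⟨B₅, hB₅, hGg, hGgH⟩ := exists_holder_const hN hη₀ (mulHolder hN hη₀ G g)
  obtain ⟨B, hB, h1, h2, h3, h4, h5⟩ : ∃ B, 0 < B ∧ B₁ ≤ B ∧ B₂ ≤ B ∧ B₃ ≤ B ∧ B₄ ≤ B ∧ B₅ ≤ B :=
    ⟨B₁ + B₂ + B₃ + B₄ + B₅, by positivity, by linarith, by linarith, by linarith, by linarith,
      by linarith⟩
  have hA : 0 < 5 * (4 * B * 1 + B) + 4 * B := by positivity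
  have hA' : 0 < 5 * (B * L + B) + B := by positivity
  have hA'' : 0 < 5 * (4 * (2 * B * B * B) * L + (B * B + B * B)) + 4 * (2 * B * B * B) := by
    positivity
  set a := 5 * (4 * B * 1 + B) + 4 * B
  set a' := 5 * (B * L + B) + B
  set a'' := 5 * (4 * (2 * B * B * B) * L + (B * B + B * B)) + 4 * (2 * B * B * B)
  refine ⟨C * 5 ^ N * (a * a' + a * a' + 5 * a''), ?_⟩
  intro ρ z θ χ hρ hρ1 hχ hθ hθH hθs
  have hρη : 0 < ρ ^ η₀ := by positivity
  have hχ1 : ∀ x, ‖(χ : EuclideanSpace ℝ (Fin N) → 𝕜) x‖ ≤ 1 := by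
    rw [hχ]; exact norm_ofReal_cutoff_le 𝕜 z ρ
  have hχH : HolderBound R η₀ (1 * ρ ^ (-η₀)) (χ : EuclideanSpace ℝ (Fin N) → 𝕜) := by
    rw [hχ, one_mul]; exact holderBound_cutoff 𝕜 hη₀ hη₁ hρ z
  have hχs : ∀ x, 4 * ρ < orbitDist R z x → (χ : EuclideanSpace ℝ (Fin N) → 𝕜) x = 0 := by
    intro x hx
    rw [hχ]
    simp only
    rw [cutoff_eq_zero hρ hx.le, RCLike.ofReal_zero]
  have hθs' : ∀ x, 4 * ρ < orbitDist R z x → (θ : EuclideanSpace ℝ (Fin N) → 𝕜) x = 0 :=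
    fun x hx => hθs x (by linarith)
  -- After subtraction of `P(z)`, the first argument vanishes at the centre of the bump, so weak
  -- boundedness gains a factor `ρ ^ η₀`.
  have main : ∀ (P Q : holderCompact 𝕜 R η₀),
      HolderBound R η₀ B (P : EuclideanSpace ℝ (Fin N) → 𝕜) →
      (∀ x, ‖(mulHolder hN hη₀ Q g : EuclideanSpace ℝ (Fin N) → 𝕜) x‖ ≤ B) →
      HolderBound R η₀ B (mulHolder hN hη₀ Q g : EuclideanSpace ℝ (Fin N) → 𝕜) →
      ‖T (mulHolder hN hη₀ P χ - (P : EuclideanSpace ℝ (Fin N) → 𝕜) z • χ)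
        (mulHolder hN hη₀ Q (mulHolder hN hη₀ g θ))‖ ≤ C * (a * ρ ^ η₀ * a' * (5 * ρ) ^ N) := by
    intro P Q hP hQ hQH
    have hu := (hP.sub_const ((P : EuclideanSpace ℝ (Fin N) → 𝕜) z)).mul_bump_of_vanishing hη₀ hη₁
      hB.le hB.le zero_le_one hρ (z := z) (fun x => by rw [orbitDist_comm z x]; exact hP x z)
      hχH hχ1 hχs
    have hv := hQH.mul_bump hη₀ hη₁ hB.le hB.le hL hρ hρ1 hQ hθH hθ
    have hu' : ((mulHolder hN hη₀ P χ - (P : EuclideanSpace ℝ (Fin N) → 𝕜) z • χ :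
        holderCompact 𝕜 R η₀) : EuclideanSpace ℝ (Fin N) → 𝕜) = fun x =>
        ((P : EuclideanSpace ℝ (Fin N) → 𝕜) x - (P : EuclideanSpace ℝ (Fin N) → 𝕜) z) *
          (χ : EuclideanSpace ℝ (Fin N) → 𝕜) x := by
      funext x; exact (sub_mul _ _ _).symm
    have hv' : (mulHolder hN hη₀ Q (mulHolder hN hη₀ g θ) : EuclideanSpace ℝ (Fin N) → 𝕜) =
        fun x => (mulHolder hN hη₀ Q g : EuclideanSpace ℝ (Fin N) → 𝕜) x *
          (θ : EuclideanSpace ℝ (Fin N) → 𝕜) x := by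
      funext x; exact (mul_assoc _ _ _).symm
    refine hW z z (5 * ρ) (a * ρ ^ η₀) a' _ _ (by positivity) (by positivity) hA' ?_ ?_ ?_ ?_ ?_ ?_
    · rw [hu']; exact tsupport_mul_bump_subset hρ hχs fun x hx => by simp only [hx, mul_zero]
    · rw [hv']; exact tsupport_mul_bump_subset hρ hθs' fun x hx => by simp only [hx, mul_zero]
    · rw [hu']; exact hu.1
    · rw [hv']; exact hv.1
    · rw [hu']; exact hu.2
    · rw [hv']; exact hv.2
  have hmain1 := main F G (hFH.mono h1) (fun x => (hGg x).trans h5) (hGgH.mono h5)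
  have hmain2 := main G F (hGH.mono h2) (fun x => (hFg x).trans h4) (hFgH.mono h4)
  -- The frozen terms gain it through the second argument: `F(z) G - G(z) F` also vanishes at `z`.
  have hmain3 : ‖T χ ((F : EuclideanSpace ℝ (Fin N) → 𝕜) z •
      mulHolder hN hη₀ G (mulHolder hN hη₀ g θ) - (G : EuclideanSpace ℝ (Fin N) → 𝕜) z •
      mulHolder hN hη₀ F (mulHolder hN hη₀ g θ))‖ ≤ C * (5 * (a'' * ρ ^ η₀) * (5 * ρ) ^ N) := by
    have hFz := (hF z).trans h1
    have hGz := (hG z).trans h2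
    have hq := (((hGgH.mono h5).const_mul ((F : EuclideanSpace ℝ (Fin N) → 𝕜) z)).mono
      (mul_le_mul_of_nonneg_right hFz hB.le)).sub (((hFgH.mono h4).const_mul
      ((G : EuclideanSpace ℝ (Fin N) → 𝕜) z)).mono (mul_le_mul_of_nonneg_right hGz hB.le))
    have hqz : ∀ x, ‖(F : EuclideanSpace ℝ (Fin N) → 𝕜) z *
        (mulHolder hN hη₀ G g : EuclideanSpace ℝ (Fin N) → 𝕜) x -
        (G : EuclideanSpace ℝ (Fin N) → 𝕜) z *
        (mulHolder hN hη₀ F g : EuclideanSpace ℝ (Fin N) → 𝕜) x‖ ≤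
        2 * B * B * B * orbitDist R z x ^ η₀ := by
      intro x
      have h6 := norm_antisymm_le (hFH.mono h1) (hGH.mono h2) (fun x => (hF x).trans h1)
        (fun x => (hG x).trans h2) x z
      have h7 : (F : EuclideanSpace ℝ (Fin N) → 𝕜) z *
          (mulHolder hN hη₀ G g : EuclideanSpace ℝ (Fin N) → 𝕜) x -
          (G : EuclideanSpace ℝ (Fin N) → 𝕜) z *
          (mulHolder hN hη₀ F g : EuclideanSpace ℝ (Fin N) → 𝕜) x =
          ((F : EuclideanSpace ℝ (Fin N) → 𝕜) z * (G : EuclideanSpace ℝ (Fin N) → 𝕜) x -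
          (G : EuclideanSpace ℝ (Fin N) → 𝕜) z * (F : EuclideanSpace ℝ (Fin N) → 𝕜) x) *
          (g : EuclideanSpace ℝ (Fin N) → 𝕜) x := by
        rw [mulHolder_apply, mulHolder_apply]; ring
      rw [h7, norm_mul]
      refine (mul_le_mul h6 ((hg x).trans h3) (norm_nonneg _)
        ((norm_nonneg _).trans h6)).trans (le_of_eq ?_)
      ring
    have hw := hq.mul_bump_of_vanishing hη₀ hη₁ (by positivity) (by positivity) hL hρ hqz hθH hθ
      hθs'
    have hw' : (((F : EuclideanSpace ℝ (Fin N) → 𝕜) z • mulHolder hN hη₀ G (mulHolder hN hη₀ g θ) -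
        (G : EuclideanSpace ℝ (Fin N) → 𝕜) z • mulHolder hN hη₀ F (mulHolder hN hη₀ g θ) :
        holderCompact 𝕜 R η₀) : EuclideanSpace ℝ (Fin N) → 𝕜) = fun x =>
        ((F : EuclideanSpace ℝ (Fin N) → 𝕜) z *
        (mulHolder hN hη₀ G g : EuclideanSpace ℝ (Fin N) → 𝕜) x -
        (G : EuclideanSpace ℝ (Fin N) → 𝕜) z *
        (mulHolder hN hη₀ F g : EuclideanSpace ℝ (Fin N) → 𝕜) x) *
        (θ : EuclideanSpace ℝ (Fin N) → 𝕜) x := by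
      funext x
      change (F : EuclideanSpace ℝ (Fin N) → 𝕜) z * (_ * (_ * _)) - _ * (_ * (_ * _)) =
        (_ * (_ * _) - _ * (_ * _)) * _
      ring
    -- The size `5` for `χ`, although `‖χ‖ ≤ 1`, absorbs the passage of its Hölder constant from
    -- scale `ρ` to `5ρ`.
    refine hW z z (5 * ρ) 5 (a'' * ρ ^ η₀) _ _ (by positivity) (by norm_num) (by positivity)
      ?_ ?_ ?_ ?_ ?_ ?_
    · exact tsupport_mul_bump_subset hρ hχs fun x hx => hx
    · rw [hw']; exact tsupport_mul_bump_subset hρ hθs' fun x hx => by simp only [hx, mul_zero]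
    · exact fun x => (hχ1 x).trans (by norm_num)
    · rw [hw']; exact hw.1
    · exact hχH.mono (by simpa using le_five_mul_rpow_neg hη₁ hρ zero_le_one)
    · rw [hw']; exact hw.2
  have hid : T (mulHolder hN hη₀ F χ) (mulHolder hN hη₀ G (mulHolder hN hη₀ g θ)) -
      T (mulHolder hN hη₀ G χ) (mulHolder hN hη₀ F (mulHolder hN hη₀ g θ)) =
      T (mulHolder hN hη₀ F χ - (F : EuclideanSpace ℝ (Fin N) → 𝕜) z • χ)
        (mulHolder hN hη₀ G (mulHolder hN hη₀ g θ)) -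
      T (mulHolder hN hη₀ G χ - (G : EuclideanSpace ℝ (Fin N) → 𝕜) z • χ)
        (mulHolder hN hη₀ F (mulHolder hN hη₀ g θ)) +
      T χ ((F : EuclideanSpace ℝ (Fin N) → 𝕜) z • mulHolder hN hη₀ G (mulHolder hN hη₀ g θ) -
        (G : EuclideanSpace ℝ (Fin N) → 𝕜) z • mulHolder hN hη₀ F (mulHolder hN hη₀ g θ)) := by
    simp only [map_sub, map_smul, LinearMap.sub_apply, LinearMap.smul_apply, smul_eq_mul]
    ring
  rw [hid]
  refine (norm_add_le _ _).trans ((add_le_add ((norm_sub_le _ _).trans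
    (add_le_add hmain1 hmain2)) hmain3).trans (le_of_eq ?_))
  rw [mul_pow]
  ring

/-- The part of the commutator integral near the diagonal is small. -/
theorem IsSingularIntegral.exists_diagonal_le (hN : 1 ≤ N) (hη₀ : 0 < η₀) (hη₁ : η₀ ≤ 1)
    (hT : IsSingularIntegral R η₀ ε T K) (F G : holderCompact 𝕜 R η₀) {M : ℝ} (hM : 0 ≤ M) :
    ∃ C, ∀ (ρ : ℝ) (z : EuclideanSpace ℝ (Fin N)) (h χ : EuclideanSpace ℝ (Fin N) → 𝕜), 0 < ρ →
      χ = (fun y => (cutoff R z ρ y : 𝕜)) → (∀ x, ‖h x‖ ≤ M) →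
      (∀ x, ρ < orbitDist R z x → h x = 0) →
      ‖∫ x, (∫ y, K x y * ((F : EuclideanSpace ℝ (Fin N) → 𝕜) y *
        (G : EuclideanSpace ℝ (Fin N) → 𝕜) x - (G : EuclideanSpace ℝ (Fin N) → 𝕜) y *
        (F : EuclideanSpace ℝ (Fin N) → 𝕜) x) * χ y) * h x‖ ≤ C * (ρ ^ η₀ * ρ ^ N) := by
  obtain ⟨C, hC, hK⟩ := hT.exists_size
  obtain ⟨B₁, hB₁, hF, hFH⟩ := exists_holder_const hN hη₀ F
  obtain ⟨B₂, hB₂, hG, hGH⟩ := exists_holder_const hN hη₀ G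
  obtain ⟨B, hB, h1, h2⟩ : ∃ B, 0 < B ∧ B₁ ≤ B ∧ B₂ ≤ B :=
    ⟨B₁ + B₂, by positivity, by linarith, by linarith⟩
  obtain ⟨D, hD, hnear⟩ := exists_integral_near_le (R := R) hN hη₀
  obtain ⟨V, hV, hvol⟩ := exists_volume_orbitBall_le (R := R) hN
  refine ⟨C * (2 * B * B) * D * 5 * M * V * 2 ^ N, ?_⟩
  intro ρ z h χ hρ hχ hhM hh
  have h5 : (5 * ρ) ^ η₀ ≤ 5 * ρ ^ η₀ := by
    rw [Real.mul_rpow (by norm_num) hρ.le]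
    gcongr
    simpa using Real.rpow_le_rpow_of_exponent_le (by norm_num : (1 : ℝ) ≤ 5) hη₁
  -- Here `d(z,x) ≤ ρ` and `d(z,y) < 4ρ`, so the inner integral runs over `d(x,y) < 5ρ` and is `O(ρ
  -- ^ η₀)`; the volume of the support of `h` supplies `ρ ^ N`.
  have hinner : ∀ x, h x ≠ 0 → ‖∫ y, K x y * ((F : EuclideanSpace ℝ (Fin N) → 𝕜) y *
        (G : EuclideanSpace ℝ (Fin N) → 𝕜) x - (G : EuclideanSpace ℝ (Fin N) → 𝕜) y *
        (F : EuclideanSpace ℝ (Fin N) → 𝕜) x) * χ y‖ ≤ C * (2 * B * B) * (D * (5 * ρ) ^ η₀) := by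
    intro x hx
    have hx' : orbitDist R z x ≤ ρ := not_lt.1 fun h' => hx (hh x h')
    have hbd : ∀ y, ‖K x y * ((F : EuclideanSpace ℝ (Fin N) → 𝕜) y *
        (G : EuclideanSpace ℝ (Fin N) → 𝕜) x - (G : EuclideanSpace ℝ (Fin N) → 𝕜) y *
        (F : EuclideanSpace ℝ (Fin N) → 𝕜) x) * χ y‖ ≤ C * (2 * B * B) *
        (Set.Iio (5 * ρ)).indicator (fun t => t ^ (η₀ - N)) (orbitDist R x y) := by
      intro y
      rw [mul_assoc]
      refine norm_kernel_mul_le hC hK hη₀ (by positivity) ?_ fun hne => ?_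
      · rw [norm_mul]
        have h3 := norm_antisymm_le (hFH.mono h1) (hGH.mono h2) (fun x => (hF x).trans h1)
          (fun x => (hG x).trans h2) x y
        rw [orbitDist_comm y x] at h3
        refine (mul_le_of_le_one_right (norm_nonneg _) ?_).trans h3
        rw [hχ]; exact norm_ofReal_cutoff_le 𝕜 z ρ y
      · have hy : orbitDist R z y < 4 * ρ := by
          by_contra h'
          refine hne ?_
          rw [hχ]
          simp only
          rw [cutoff_eq_zero hρ (not_lt.1 h'), RCLike.ofReal_zero, mul_zero]
        linarith [orbitDist_triangle (R := R) x z y, orbitDist_comm (R := R) x z]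
    have hn := hnear x (5 * ρ) (by positivity)
    refine (norm_integral_le_of_norm_le (hn.1.const_mul _) (Eventually.of_forall hbd)).trans ?_
    rw [integral_const_mul]
    exact mul_le_mul_of_nonneg_left hn.2 (by positivity)
  obtain ⟨hv1, hv2⟩ := hvol z (2 * ρ) (by positivity)
  have hm := (isOpen_orbitBall (R := R) z (2 * ρ)).measurableSet
  have hi : Integrable ((orbitBall R z (2 * ρ)).indicator fun _ =>
      C * (2 * B * B) * (D * (5 * ρ) ^ η₀) * M) :=
    (integrable_indicator_iff hm).2 (integrableOn_const hv1)
  refine (norm_integral_le_of_norm_le hi (Eventually.of_forall fun x => ?_)).trans ?_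
  · by_cases hx : h x = 0
    · rw [hx, mul_zero, norm_zero]
      exact Set.indicator_apply_nonneg fun _ => by positivity
    · have hx' : x ∈ orbitBall R z (2 * ρ) := by
        have : orbitDist R z x ≤ ρ := not_lt.1 fun h' => hx (hh x h')
        exact lt_of_le_of_lt this (by linarith)
      rw [Set.indicator_of_mem hx', norm_mul]
      exact mul_le_mul (hinner x hx) (hhM x) (norm_nonneg _) (by positivity)
  · rw [integral_indicator_const _ hm, smul_eq_mul]
    calc volume.real (orbitBall R z (2 * ρ)) * (C * (2 * B * B) * (D * (5 * ρ) ^ η₀) * M)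
        ≤ (V * (2 * ρ) ^ N) * (C * (2 * B * B) * (D * (5 * ρ ^ η₀)) * M) := by gcongr
      _ = _ := by rw [mul_pow]; ring

/-- The commutator identity: although `T` need not be given by its kernel on the diagonal, the
antisymmetrized pairing `⟨T F, G g⟩ - ⟨T G, F g⟩` is. -/
theorem IsSingularIntegral.commutator_identity (hN : 1 ≤ N) (hη₀ : 0 < η₀) (hη₁ : η₀ ≤ 1)
    (hT : IsSingularIntegral R η₀ ε T K) (hW : WeakBoundedness T) (F G g : holderCompact 𝕜 R η₀) :
    T F (mulHolder hN hη₀ G g) - T G (mulHolder hN hη₀ F g) =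
      ∫ x, commutatorKernel K (F : EuclideanSpace ℝ (Fin N) → 𝕜) G x *
        (g : EuclideanSpace ℝ (Fin N) → 𝕜) x := by
  obtain ⟨_⟩ := nonempty_fintype (reflectionGroup R)
  obtain ⟨M, hM, hg⟩ := exists_norm_le_of_mem_holderCompact g.2
  obtain ⟨r, hr, hgr⟩ := exists_orbitDist_le_of_mem_holderCompact g.2
  have hN' : (1 : ℝ) ≤ N := by exact_mod_cast hN
  -- A tent on the lattice of mesh `δ` has support radius `ρ = N δ` and Lipschitz constant `2N/δ =
  -- 2N² / ρ`.
  obtain ⟨C₁, hC₁⟩ := hW.exists_commutator_le hN hη₀ hη₁ F G g (L := 2 * N * N) (by positivity)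
  obtain ⟨C₂, hC₂⟩ := hT.exists_diagonal_le hN hη₀ hη₁ F G hM.le
  have key : ∀ n : ℕ, 1 ≤ n → N * (r / n) ≤ 1 → ‖commutatorDefect hN hη₀ hT F G g‖ ≤
      (|C₁| + |C₂|) * (3 * (N * r)) ^ N * (N * (r / n)) ^ η₀ := by
    intro n hn hsmall
    have hn' : (1 : ℝ) ≤ n := by exact_mod_cast hn
    have hδ : 0 < r / n := by positivity
    set δ := r / n with hδdef
    have hρ : 0 < N * δ := by positivity
    have htH : ∀ k : Fin N → ℝ, HolderBound R η₀ (2 * N * N * (N * δ) ^ (-η₀))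
        (fun x => (orbitTent R δ k x : 𝕜)) := by
      intro k
      refine HolderBound.of_lipschitz hη₀ hη₁ hρ (fun x y => ?_) (fun x y => ?_)
      · rw [← RCLike.ofReal_sub, RCLike.norm_ofReal]
        refine (abs_orbitTent_sub_le R hδ k x y).trans (le_of_eq ?_)
        field_simp
      · rw [← RCLike.ofReal_sub, RCLike.norm_ofReal]
        have h1 : (1 : ℝ) ≤ 2 * N * N := by nlinarith
        refine le_trans ?_ h1
        rw [abs_le]
        constructor <;> linarith [orbitTent_nonneg R δ k x, orbitTent_le_one R δ k x,
          orbitTent_nonneg R δ k y, orbitTent_le_one R δ k y]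
    have hts : ∀ (k : Fin N → ℝ) (x : EuclideanSpace ℝ (Fin N)),
        N * δ < orbitDist R (WithLp.toLp 2 fun i => δ * k i) x → (orbitTent R δ k x : 𝕜) = 0 :=
      fun k x hx => by rw [orbitTent_eq_zero R hδ hx, RCLike.ofReal_zero]
    have ht1 : ∀ (k : Fin N → ℝ) (x : EuclideanSpace ℝ (Fin N)),
        ‖(orbitTent R δ k x : 𝕜)‖ ≤ 1 := fun k x => by
      rw [RCLike.norm_ofReal, abs_of_nonneg (orbitTent_nonneg R δ k x)]
      exact orbitTent_le_one R δ k x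
    let θ : (Fin N → Fin (2 * n + 1)) → holderCompact 𝕜 R η₀ := fun k =>
      ⟨fun x => (orbitTent R δ (fun i => ((k i : ℕ) - n : ℝ)) x : 𝕜),
        (htH _).mem_holderCompact hη₀ (hts _)⟩
    have hsum : g = ∑ k, mulHolder hN hη₀ g (θ k) := by
      rw [← map_sum]
      ext x
      rw [mulHolder_apply, Submodule.coe_sum, Finset.sum_apply]
      by_cases hx : r < ‖x‖
      · rw [hgr x hx, zero_mul]
      · have hx' : ‖x‖ ≤ δ * n := by
          rw [hδdef, div_mul_cancel₀ _ (by positivity)]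
          exact not_lt.1 hx
        have h1 := sum_orbitTent R hδ hx'
        have h2 : ∑ k, (θ k : EuclideanSpace ℝ (Fin N) → 𝕜) x = 1 := by
          change ∑ k : Fin N → Fin (2 * n + 1),
            (orbitTent R δ (fun i => ((k i : ℕ) - n : ℝ)) x : 𝕜) = 1
          rw [← RCLike.ofReal_sum, h1, RCLike.ofReal_one]
        rw [h2, mul_one]
    have hterm : ∀ k, ‖commutatorDefect hN hη₀ hT F G (mulHolder hN hη₀ g (θ k))‖ ≤
        (|C₁| + |C₂|) * ((N * δ) ^ η₀ * (N * δ) ^ N) := by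
      intro k
      have hs : ∀ x, N * δ < orbitDist R (WithLp.toLp 2 fun i => δ * ((k i : ℕ) - n : ℝ)) x →
        (mulHolder hN hη₀ g (θ k) : EuclideanSpace ℝ (Fin N) → 𝕜) x = 0 := fun x hx => by
          rw [mulHolder_apply]
          exact mul_eq_zero_of_right _ (hts _ x hx)
      rw [commutatorDefect_eq hN hη₀ hT F G (mulHolder hN hη₀ g (θ k))
        ⟨_, cutoff_mem_holderCompact 𝕜 hη₀ hη₁ hρ _⟩ hρ rfl hs]
      have h1 := hC₁ (N * δ) (WithLp.toLp 2 fun i => δ * ((k i : ℕ) - n : ℝ)) (θ k)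
        ⟨_, cutoff_mem_holderCompact 𝕜 hη₀ hη₁ hρ _⟩ hρ hsmall rfl (ht1 _) (htH _) (hts _)
      have h2 := hC₂ (N * δ) (WithLp.toLp 2 fun i => δ * ((k i : ℕ) - n : ℝ))
        (mulHolder hN hη₀ g (θ k)) _ hρ rfl (fun x => by
          rw [mulHolder_apply, norm_mul]
          exact (mul_le_of_le_one_right (norm_nonneg _) (ht1 _ x)).trans (hg x)) hs
      have h0 : 0 ≤ (N * δ) ^ η₀ * (N * δ) ^ N := by positivity
      rw [add_mul]
      exact (norm_sub_le _ _).trans (add_le_add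
        (h1.trans (mul_le_mul_of_nonneg_right (le_abs_self _) h0))
        (h2.trans (mul_le_mul_of_nonneg_right (le_abs_self _) h0)))
    rw [hsum, map_sum]
    refine (norm_sum_le _ _).trans ((Finset.sum_le_sum fun k _ => hterm k).trans ?_)
    rw [Finset.sum_const, Finset.card_univ, Fintype.card_fun, Fintype.card_fin, Fintype.card_fin,
      nsmul_eq_mul]
    push_cast
    -- The number of pieces times `ρ ^ N` stays bounded, so the total error is `O(ρ ^ η₀)`.
    have h3 : (2 * (n : ℝ) + 1) * (N * δ) ≤ 3 * (N * r) := by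
      have : r = δ * n := by rw [hδdef, div_mul_cancel₀ _ (by positivity)]
      rw [this]
      nlinarith
    calc (2 * (n : ℝ) + 1) ^ N * ((|C₁| + |C₂|) * ((N * δ) ^ η₀ * (N * δ) ^ N))
        = (|C₁| + |C₂|) * ((2 * (n : ℝ) + 1) * (N * δ)) ^ N * (N * δ) ^ η₀ := by
          rw [mul_pow (2 * (n : ℝ) + 1)]; ring
      _ ≤ _ := by gcongr
  have hlim0 : Tendsto (fun n : ℕ => (N : ℝ) * (r / n)) atTop (𝓝 0) := by
    simpa using (tendsto_const_div_atTop_nhds_zero_nat r).const_mul (N : ℝ)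
  have hlim : Tendsto (fun n : ℕ => (|C₁| + |C₂|) * (3 * (N * r)) ^ N * (N * (r / n)) ^ η₀) atTop
      (𝓝 0) := by
    have := (hlim0.rpow_const (Or.inr hη₀.le : (0 : ℝ) ≠ 0 ∨ 0 ≤ η₀)).const_mul
      ((|C₁| + |C₂|) * (3 * (N * r)) ^ N)
    rwa [Real.zero_rpow hη₀.ne', mul_zero] at this
  have hev : ∀ᶠ n : ℕ in atTop, ‖commutatorDefect hN hη₀ hT F G g‖ ≤
      (|C₁| + |C₂|) * (3 * (N * r)) ^ N * (N * (r / n)) ^ η₀ := by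
    filter_upwards [eventually_ge_atTop 1, hlim0.eventually (eventually_le_nhds zero_lt_one)]
      with n hn hn' using key n hn hn'
  have h0 := norm_le_zero_iff.1 (ge_of_tendsto hlim hev)
  exact sub_eq_zero.1 h0

end CommutatorIdentity

/-! ### Normalized bump functions -/

section Bump

variable {N : ℕ} (𝕜 : Type*) [RCLike 𝕜] {R : Set (EuclideanSpace ℝ (Fin N))}
  [Finite (reflectionGroup R)]

variable (R) in
-- The bump is the standard cutoff of radius `r / 8`, which lives on `d ≤ r / 2`, divided by its
-- integral. That cutoff is `1` on the Euclidean ball of radius `r / 4`, which bounds the integral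
-- below by a multiple of `r ^ N`.
theorem exists_bump (hN : 1 ≤ N) {η₀ : ℝ} (hη₀ : 0 < η₀) (hη₁ : η₀ ≤ 1) : ∃ C, 0 < C ∧
    ∀ (x₀ : EuclideanSpace ℝ (Fin N)) (r : ℝ), 0 < r → ∃ b : holderCompact 𝕜 R η₀,
      tsupport (b : EuclideanSpace ℝ (Fin N) → 𝕜) ⊆ orbitBall R x₀ r ∧
      ∫ x, (b : EuclideanSpace ℝ (Fin N) → 𝕜) x = 1 ∧
      (∀ x, ‖(b : EuclideanSpace ℝ (Fin N) → 𝕜) x‖ ≤ C * (r ^ N)⁻¹) ∧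
      HolderBound R η₀ (C * (r ^ N)⁻¹ * r ^ (-η₀)) (b : EuclideanSpace ℝ (Fin N) → 𝕜) := by
  have : Nonempty (Fin N) := ⟨⟨0, hN⟩⟩
  set v := volume.real (Metric.ball (0 : EuclideanSpace ℝ (Fin N)) 1) with hvdef
  have hv : 0 < v := 
    ENNReal.toReal_pos (Metric.measure_ball_pos volume _ zero_lt_one).ne' measure_ball_lt_top.ne
  refine ⟨8 * 4 ^ N / v, by positivity, fun x₀ r hr => ?_⟩
  have h8 : 0 < r / 8 := by positivity
  have hmem := cutoff_mem_holderCompact 𝕜 (R := R) hη₀ hη₁ h8 x₀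
  have hint : Integrable fun y => cutoff R x₀ (r / 8) y := by
    have h := (integrable_of_mem_holderCompact (cutoff_mem_holderCompact ℝ (R := R) hη₀ hη₁ h8 x₀))
    simpa using h
  have hvol : v * (r / 4) ^ N ≤ ∫ y, cutoff R x₀ (r / 8) y := by
    have h1 : volume.real (Metric.ball x₀ (r / 4)) = v * (r / 4) ^ N := by
      rw [measureReal_def, Measure.addHaar_ball volume x₀ (by positivity : 0 ≤ r / 4),
        ENNReal.toReal_mul, ENNReal.toReal_ofReal (by positivity), finrank_euclideanSpace_fin,
        mul_comm, hvdef, measureReal_def]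
    rw [← h1, ← integral_indicator_one measurableSet_ball]
    refine integral_mono ?_ hint fun y => ?_
    · exact (integrable_indicator_iff measurableSet_ball).2
        (integrableOn_const measure_ball_lt_top.ne)
    · by_cases hy : y ∈ Metric.ball x₀ (r / 4)
      · rw [Set.indicator_of_mem hy, cutoff_eq_one h8]
        · rfl
        · rw [Metric.mem_ball, dist_comm, dist_eq_norm] at hy
          linarith [orbitDist_le_norm (R := R) x₀ y]
      · rw [Set.indicator_of_notMem hy]
        exact cutoff_nonneg _ _ _
  set I := ∫ y, cutoff R x₀ (r / 8) y with hI
  have hI0 : 0 < I := lt_of_lt_of_le (by positivity) hvol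
  have hIinv : I⁻¹ ≤ 4 ^ N / v * (r ^ N)⁻¹ := by
    refine (inv_anti₀ (by positivity) hvol).trans (le_of_eq ?_)
    rw [div_pow]
    field_simp
  have hnorm : ‖((I⁻¹ : ℝ) : 𝕜)‖ = I⁻¹ := by rw [RCLike.norm_ofReal, abs_of_pos (by positivity)]
  have hC : I⁻¹ * 8 ≤ 8 * 4 ^ N / v * (r ^ N)⁻¹ := by
    refine (mul_le_mul_of_nonneg_right hIinv (by norm_num)).trans (le_of_eq ?_)
    ring
  refine ⟨((I⁻¹ : ℝ) : 𝕜) • ⟨_, hmem⟩, ?_, ?_, fun x => ?_, ?_⟩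
  · refine tsupport_subset_orbitBall (r := r / 2) (by linarith) fun y hy => ?_
    change ((I⁻¹ : ℝ) : 𝕜) * (cutoff R x₀ (r / 8) y : 𝕜) = 0
    rw [cutoff_eq_zero h8 (by linarith), RCLike.ofReal_zero, mul_zero]
  · change ∫ x, ((I⁻¹ : ℝ) : 𝕜) * (cutoff R x₀ (r / 8) x : 𝕜) = 1
    rw [integral_const_mul, integral_ofReal, ← hI, ← RCLike.ofReal_mul, inv_mul_cancel₀ hI0.ne',
      RCLike.ofReal_one]
  · change ‖((I⁻¹ : ℝ) : 𝕜) * (cutoff R x₀ (r / 8) x : 𝕜)‖ ≤ _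
    rw [norm_mul, hnorm]
    have h1 := norm_ofReal_cutoff_le (R := R) 𝕜 x₀ (r / 8) x
    have h2 : 0 < I⁻¹ := by positivity
    nlinarith
  · have h1 := (holderBound_cutoff 𝕜 (R := R) hη₀ hη₁ h8 x₀).const_mul ((I⁻¹ : ℝ) : 𝕜)
    rw [hnorm] at h1
    refine h1.mono ?_
    have h2 : (r / 8) ^ (-η₀) ≤ 8 * r ^ (-η₀) := by
      rw [Real.div_rpow hr.le (by norm_num), Real.rpow_neg (by norm_num : (0 : ℝ) ≤ 8), div_inv_eq_mul,
        mul_comm]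
      gcongr
      simpa using Real.rpow_le_rpow_of_exponent_le (by norm_num : (1 : ℝ) ≤ 8) hη₁
    calc I⁻¹ * (r / 8) ^ (-η₀) ≤ I⁻¹ * (8 * r ^ (-η₀)) := by gcongr
      _ = I⁻¹ * 8 * r ^ (-η₀) := by ring
      _ ≤ _ := by gcongr

end Bump

/-! ### The function `T ξ` on the ball of a cutoff `ξ` -/

section Localization

variable {N : ℕ} {𝕜 : Type*} [RCLike 𝕜] {R : Set (EuclideanSpace ℝ (Fin N))} {η₀ ε : ℝ}
  {T : holderCompact 𝕜 R η₀ →ₗ[𝕜] holderCompact 𝕜 R η₀ →ₗ[𝕜] 𝕜}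
  {K : EuclideanSpace ℝ (Fin N) → EuclideanSpace ℝ (Fin N) → 𝕜}

variable (K) in
/-- The regularized kernel `[K(x,y) - K(x₀,y)] (1 - ξ(y))` away from the centre. -/
def farKernel (x₀ : EuclideanSpace ℝ (Fin N)) (ξ : EuclideanSpace ℝ (Fin N) → 𝕜)
    (x y : EuclideanSpace ℝ (Fin N)) : 𝕜 := (K x y - K x₀ y) * (1 - ξ y)

variable (T K) in
/-- A cutoff function `ξ` for the orbit ball of centre `x₀` and radius `r`, together with the
constant `c` such that `T ξ` is the function `c - ∫ [K(x,y) - K(x₀,y)] (1 - ξ(y)) dy` on that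
ball. -/
structure Localization where
  center : EuclideanSpace ℝ (Fin N)
  radius : ℝ
  cut : EuclideanSpace ℝ (Fin N) → 𝕜
  const : 𝕜
  radius_pos : 0 < radius
  isCutoff : IsCutoff R η₀ center radius cut
  apply_cut : ∀ h : holderCompact 𝕜 R η₀,
    tsupport (h : EuclideanSpace ℝ (Fin N) → 𝕜) ⊆ orbitBall R center radius →
    T ⟨cut, isCutoff.1⟩ h = ∫ x, (const - ∫ y, farKernel K center cut x y) *
      (h : EuclideanSpace ℝ (Fin N) → 𝕜) x

theorem IsCutoff.exists_bound {x₀ : EuclideanSpace ℝ (Fin N)} {r : ℝ}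
    {ξ : EuclideanSpace ℝ (Fin N) → 𝕜} (hξ : IsCutoff R η₀ x₀ r ξ) :
    ∃ B, 0 ≤ B ∧ ∀ y, ‖1 - ξ y‖ ≤ B := by
  obtain ⟨M, hM, h⟩ := exists_norm_le_of_mem_holderCompact hξ.1
  exact ⟨1 + M, by positivity, fun y => (norm_sub_le _ _).trans (by simpa using h y)⟩

theorem measurable_farKernel (hT : IsSingularIntegral R η₀ ε T K) {x₀ : EuclideanSpace ℝ (Fin N)}
    {ξ : EuclideanSpace ℝ (Fin N) → 𝕜} (hξ : Measurable ξ) :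
    Measurable (Function.uncurry (farKernel K x₀ ξ)) :=
  (hT.measurable.sub ((hT.measurable_right x₀).comp measurable_snd)).mul
    (measurable_const.sub (hξ.comp measurable_snd))

theorem integrable_mul_of_norm_le {φ h : EuclideanSpace ℝ (Fin N) → 𝕜} (hφ : Measurable φ)
    (hh : Integrable h) {B : ℝ} (hB : ∀ x, h x ≠ 0 → ‖φ x‖ ≤ B) :
    Integrable fun x => φ x * h x := by
  refine (hh.norm.const_mul B).mono' (hφ.aestronglyMeasurable.mul hh.1)
    (Eventually.of_forall fun x => ?_)
  by_cases hx : h x = 0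
  · simp [hx]
  · rw [norm_mul]
    exact mul_le_mul_of_nonneg_right (hB x hx) (norm_nonneg _)

theorem ne_zero_mem_of_tsupport_subset {h : EuclideanSpace ℝ (Fin N) → 𝕜}
    {U : Set (EuclideanSpace ℝ (Fin N))} (hU : tsupport h ⊆ U) {x : EuclideanSpace ℝ (Fin N)}
    (hx : h x ≠ 0) : x ∈ U := hU (subset_tsupport h hx)

variable [Finite (reflectionGroup R)]

/-- Only `y` with `d(x₀,y) ≥ 2r` contribute. There smoothness of `K` applies with decay `d ^ (-N -
ε)`, and `d(x,y)` is comparable to `d(x₀,y)`; convergence is exactly `η < ε`. -/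
theorem IsSingularIntegral.exists_farKernel_le (hN : 1 ≤ N) (hε₀ : 0 < ε) (hε₁ : ε ≤ 1)
    (hT : IsSingularIntegral R η₀ ε T K) {η : ℝ} (hη : 0 ≤ η) (hηε : η < ε) :
    ∃ C, 0 ≤ C ∧ ∀ (x₀ : EuclideanSpace ℝ (Fin N)) (r : ℝ) (ξ : EuclideanSpace ℝ (Fin N) → 𝕜)
      (B : ℝ), 0 < r → IsCutoff R η₀ x₀ r ξ → (∀ y, ‖1 - ξ y‖ ≤ B) → ∀ x ∈ orbitBall R x₀ r,
      (Integrable fun y => ‖farKernel K x₀ ξ x y‖ * orbitDist R x y ^ η) ∧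
      ∫ y, ‖farKernel K x₀ ξ x y‖ * orbitDist R x y ^ η ≤ C * B * r ^ η := by
  obtain ⟨C, hC, hK⟩ := hT.exists_smooth
  obtain ⟨D, hD, hfar⟩ := exists_integral_far_le (R := R) hN (sub_pos.2 hηε)
  refine ⟨C * 2 * D, by positivity, fun x₀ r ξ B hr hξ hB x hx => ?_⟩
  have hB0 : 0 ≤ B := (norm_nonneg _).trans (hB 0)
  have hxr : orbitDist R x₀ x < r := hx
  have hbd : ∀ y, ‖farKernel K x₀ ξ x y‖ * orbitDist R x y ^ η ≤ C * B * 2 * r ^ ε *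
      (Set.Ici (2 * r)).indicator (fun t => t ^ (-(N + (ε - η)))) (orbitDist R x₀ y) := by
    intro y
    by_cases hy : orbitDist R x₀ y < 2 * r
    · rw [farKernel, hξ.2.1 y hy, sub_self, mul_zero, norm_zero, zero_mul]
      exact mul_nonneg (by positivity)
        (Set.indicator_apply_nonneg fun _ => Real.rpow_nonneg (orbitDist_nonneg _ _ _) _)
    · have hy' := not_lt.1 hy
      have hd : 0 < orbitDist R x₀ y := by linarith
      rw [Set.indicator_of_mem (Set.mem_Ici.2 hy'), farKernel, norm_mul]
      have h1 : ‖K x y - K x₀ y‖ ≤ C * (r ^ ε * orbitDist R x₀ y ^ (-(N + ε))) := by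
        rw [norm_sub_rev]
        refine (hK x₀ x y hd.ne' (by linarith)).trans ?_
        have := orbitDist_nonneg R x₀ x
        gcongr
      have h2 : orbitDist R x y ^ η ≤ 2 * orbitDist R x₀ y ^ η := by
        have h3 : orbitDist R x y ≤ 2 * orbitDist R x₀ y := by
          linarith [orbitDist_triangle (R := R) x x₀ y, orbitDist_comm (R := R) x x₀]
        refine (Real.rpow_le_rpow (orbitDist_nonneg _ _ _) h3 hη).trans ?_
        rw [Real.mul_rpow (by norm_num) hd.le]
        gcongr
        simpa using Real.rpow_le_rpow_of_exponent_le (by norm_num : (1 : ℝ) ≤ 2)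
          (by linarith : η ≤ 1)
      have h4 : orbitDist R x₀ y ^ (-(N + (ε - η))) =
          orbitDist R x₀ y ^ (-(N + ε)) * orbitDist R x₀ y ^ η := by
        rw [← Real.rpow_add hd]; ring_nf
      have h5 := mul_le_mul (mul_le_mul h1 (hB y) (norm_nonneg _) (by positivity)) h2
        (orbitDist_rpow_nonneg x y η) (by positivity)
      refine h5.trans (le_of_eq ?_)
      rw [h4]
      ring
  have hf := hfar x₀ (2 * r) (by positivity)
  have hm : Measurable fun y => ‖farKernel K x₀ ξ x y‖ * orbitDist R x y ^ η :=
    (((measurable_farKernel hT hξ.1.1.1.measurable).comp measurable_prodMk_left).norm).mul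
      ((continuous_orbitDist_right R x).measurable.pow_const η)
  have hi : Integrable fun y => ‖farKernel K x₀ ξ x y‖ * orbitDist R x y ^ η := by
    refine (hf.1.const_mul (C * B * 2 * r ^ ε)).mono' hm.aestronglyMeasurable (Eventually.of_forall fun y => ?_)
    rw [Real.norm_of_nonneg (mul_nonneg (norm_nonneg _) (orbitDist_rpow_nonneg _ _ _))]
    exact hbd y
  refine ⟨hi, (integral_mono hi (hf.1.const_mul _) hbd).trans ?_⟩
  rw [integral_const_mul]
  have h6 : (2 * r) ^ (-(ε - η)) ≤ r ^ (-(ε - η)) :=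
    Real.rpow_le_rpow_of_nonpos hr (by linarith) (by linarith)
  have h7 : r ^ ε * r ^ (-(ε - η)) = r ^ η := by rw [← Real.rpow_add hr]; ring_nf
  calc C * B * 2 * r ^ ε * ∫ y, (Set.Ici (2 * r)).indicator (fun t => t ^ (-(N + (ε - η))))
        (orbitDist R x₀ y) ≤ C * B * 2 * r ^ ε * (D * r ^ (-(ε - η))) := by
        gcongr
        exact hf.2.trans (by gcongr)
    _ = C * 2 * D * B * (r ^ ε * r ^ (-(ε - η))) := by ring
    _ = _ := by rw [h7]

/-- Off `d(x₀,y) < 4r` the cutoff vanishes, so only `d(x,y) < 5r` matters, and `η > 0` makes the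
size bound of `K` integrable there. -/
theorem IsSingularIntegral.exists_nearKernel_le (hN : 1 ≤ N)
    (hT : IsSingularIntegral R η₀ ε T K) {η : ℝ} (hη : 0 < η) (hη1 : η ≤ 1) :
    ∃ C, 0 ≤ C ∧ ∀ (x₀ : EuclideanSpace ℝ (Fin N)) (r : ℝ) (ξ : EuclideanSpace ℝ (Fin N) → 𝕜)
      (B : ℝ), 0 < r → IsCutoff R η₀ x₀ r ξ → (∀ y, ‖1 - ξ y‖ ≤ B) → ∀ x ∈ orbitBall R x₀ r,
      (Integrable fun y => ‖K x y * ξ y‖ * orbitDist R x y ^ η) ∧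
      ∫ y, ‖K x y * ξ y‖ * orbitDist R x y ^ η ≤ C * (B + 1) * r ^ η := by
  obtain ⟨C, hC, hK⟩ := hT.exists_size
  obtain ⟨D, hD, hnear⟩ := exists_integral_near_le (R := R) hN hη
  refine ⟨C * 5 * D, by positivity, fun x₀ r ξ B hr hξ hB x hx => ?_⟩
  have hB0 : 0 ≤ B := (norm_nonneg _).trans (hB 0)
  have hxr : orbitDist R x₀ x < r := hx
  have hξB : ∀ y, ‖ξ y‖ ≤ B + 1 := by
    intro y
    have h1 : ξ y = 1 - (1 - ξ y) := by ring
    rw [h1]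
    refine (norm_sub_le _ _).trans ?_
    rw [norm_one]
    linarith [hB y]
  have hbd : ∀ y, ‖K x y * ξ y‖ * orbitDist R x y ^ η ≤ C * (B + 1) *
      (Set.Iio (5 * r)).indicator (fun t => t ^ (η - N)) (orbitDist R x y) := by
    intro y
    have hn : ‖((orbitDist R x y ^ η : ℝ) : 𝕜)‖ = orbitDist R x y ^ η := by
      rw [RCLike.norm_ofReal, abs_of_nonneg (orbitDist_rpow_nonneg _ _ _)]
    have h1 := norm_kernel_mul_le hC hK hη (A := B + 1) (s := 5 * r) (by positivity) (x := x)
      (y := y) (a := ξ y * ((orbitDist R x y ^ η : ℝ) : 𝕜)) ?_ ?_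
    · rwa [← mul_assoc, norm_mul, hn] at h1
    · rw [norm_mul, hn]
      exact mul_le_mul_of_nonneg_right (hξB y) (orbitDist_rpow_nonneg _ _ _)
    · intro hne
      have hy : orbitDist R x₀ y < 4 * r := by
        by_contra h'
        exact hne (by rw [hξ.2.2 y h', zero_mul])
      linarith [orbitDist_triangle (R := R) x x₀ y, orbitDist_comm (R := R) x x₀]
  have hf := hnear x (5 * r) (by positivity)
  have hm : Measurable fun y => ‖K x y * ξ y‖ * orbitDist R x y ^ η :=
    (((hT.measurable_right x).mul hξ.1.1.1.measurable).norm).mul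
      ((continuous_orbitDist_right R x).measurable.pow_const η)
  have hi : Integrable fun y => ‖K x y * ξ y‖ * orbitDist R x y ^ η := by
    refine (hf.1.const_mul (C * (B + 1))).mono' hm.aestronglyMeasurable (Eventually.of_forall fun y => ?_)
    rw [Real.norm_of_nonneg (mul_nonneg (norm_nonneg _) (orbitDist_rpow_nonneg _ _ _))]
    exact hbd y
  refine ⟨hi, (integral_mono hi (hf.1.const_mul _) hbd).trans ?_⟩
  rw [integral_const_mul]
  have h5 : (5 * r) ^ η ≤ 5 * r ^ η := by
    rw [Real.mul_rpow (by norm_num) hr.le]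
    gcongr
    simpa using Real.rpow_le_rpow_of_exponent_le (by norm_num : (1 : ℝ) ≤ 5) hη1
  calc C * (B + 1) * ∫ y, (Set.Iio (5 * r)).indicator (fun t => t ^ (η - N)) (orbitDist R x y)
      ≤ C * (B + 1) * (D * (5 * r ^ η)) := by
        gcongr
        exact hf.2.trans (by gcongr)
    _ = _ := by ring

/-- The integral of the regularized kernel away from the centre is bounded. -/
theorem IsSingularIntegral.exists_integral_farKernel_le (hN : 1 ≤ N) (hε₀ : 0 < ε) (hε₁ : ε ≤ 1)
    (hT : IsSingularIntegral R η₀ ε T K) :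
    ∃ C, 0 ≤ C ∧ ∀ (x₀ : EuclideanSpace ℝ (Fin N)) (r : ℝ) (ξ : EuclideanSpace ℝ (Fin N) → 𝕜)
      (B : ℝ), 0 < r → IsCutoff R η₀ x₀ r ξ → (∀ y, ‖1 - ξ y‖ ≤ B) →
      Measurable (fun x => ∫ y, farKernel K x₀ ξ x y) ∧ ∀ x ∈ orbitBall R x₀ r,
      (Integrable fun y => farKernel K x₀ ξ x y) ∧ ‖∫ y, farKernel K x₀ ξ x y‖ ≤ C * B := by
  -- This is the far estimate with exponent `η = 0`.
  obtain ⟨C, hC, h⟩ := hT.exists_farKernel_le hN hε₀ hε₁ le_rfl hε₀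
  refine ⟨C, hC, fun x₀ r ξ B hr hξ hB => ⟨?_, fun x hx => ?_⟩⟩
  · exact ((measurable_farKernel hT hξ.1.1.1.measurable).stronglyMeasurable.integral_prod_right
      (ν := volume)).measurable
  · have h1 := h x₀ r ξ B hr hξ hB x hx
    simp only [Real.rpow_zero, mul_one] at h1
    refine ⟨(integrable_norm_iff ?_).1 h1.1, (norm_integral_le_integral_norm _).trans h1.2⟩
    exact ((measurable_farKernel hT hξ.1.1.1.measurable).comp
      measurable_prodMk_left).aestronglyMeasurable

/-- `T(1) = 0` determines `T ξ` on the ball where `ξ = 1`, up to a constant. -/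
theorem exists_localization (hN : 1 ≤ N) (hη₀ : 0 < η₀) (hη₁ : η₀ ≤ 1) (hε₀ : 0 < ε) (hε₁ : ε ≤ 1)
    (hT : IsSingularIntegral R η₀ ε T K) (hT1 : AnnihilatesOne T K)
    {x₀ : EuclideanSpace ℝ (Fin N)} {r : ℝ} {ξ : EuclideanSpace ℝ (Fin N) → 𝕜} (hr : 0 < r)
    (hξ : IsCutoff R η₀ x₀ r ξ) :
    ∃ L : Localization T K, L.center = x₀ ∧ L.radius = r ∧ L.cut = ξ := by
  obtain ⟨_, _, hbump⟩ := exists_bump 𝕜 R hN hη₀ hη₁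
  obtain ⟨b, hb, hb1, -, -⟩ := hbump x₀ r hr
  obtain ⟨B, hB0, hB⟩ := hξ.exists_bound
  obtain ⟨C, hC, hfar⟩ := hT.exists_integral_farKernel_le hN hε₀ hε₁
  obtain ⟨hκm, hκ⟩ := hfar x₀ r ξ B hr hξ hB
  have hκi : ∀ h : holderCompact 𝕜 R η₀,
      tsupport (h : EuclideanSpace ℝ (Fin N) → 𝕜) ⊆ orbitBall R x₀ r →
      Integrable fun x => (∫ y, farKernel K x₀ ξ x y) *
        (h : EuclideanSpace ℝ (Fin N) → 𝕜) x := fun h hh =>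
    integrable_mul_of_norm_le hκm (integrable_of_mem_holderCompact h.2)
      fun x hx => (hκ x (ne_zero_mem_of_tsupport_subset hh hx)).2
  -- The required formula, tested on the bump `b` of integral `1`, forces this constant. For general
  -- `h`, `T(1) = 0` is applied to `h - (∫ h) b`, which has mean zero.
  refine ⟨⟨x₀, r, ξ, T ⟨ξ, hξ.1⟩ b + ∫ x, (∫ y, farKernel K x₀ ξ x y) *
    (b : EuclideanSpace ℝ (Fin N) → 𝕜) x, hr, hξ, fun h hh => ?_⟩, rfl, rfl, rfl⟩
  have hbi := integrable_of_mem_holderCompact b.2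
  have hhi := integrable_of_mem_holderCompact h.2
  set J := ∫ x, (h : EuclideanSpace ℝ (Fin N) → 𝕜) x with hJ
  have hmean : ∫ x, ((h - J • b : holderCompact 𝕜 R η₀) : EuclideanSpace ℝ (Fin N) → 𝕜) x = 0 := by
    change ∫ x, ((h : EuclideanSpace ℝ (Fin N) → 𝕜) x -
      J * (b : EuclideanSpace ℝ (Fin N) → 𝕜) x) = 0
    rw [integral_sub hhi (hbi.const_mul J), integral_const_mul, hb1, mul_one, sub_self]
  have hsupp : tsupport ((h - J • b : holderCompact 𝕜 R η₀) : EuclideanSpace ℝ (Fin N) → 𝕜) ⊆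
      orbitBall R x₀ r := by
    refine (tsupport_sub _ _).trans (Set.union_subset hh ?_)
    exact (closure_mono (Function.support_const_smul_subset _ _)).trans hb
  have hξ1 : ξ * 1 ∈ holderCompact 𝕜 R η₀ := by rw [mul_one]; exact hξ.1
  have h1 := hT1 (h - J • b) hmean x₀ r ξ hr hξ hsupp hξ1
  have h2 : (⟨ξ * 1, hξ1⟩ : holderCompact 𝕜 R η₀) = ⟨ξ, hξ.1⟩ := Subtype.ext (mul_one ξ)
  rw [extPairing, h2] at h1
  have h3 : ∀ x, ∫ y, (K x y - K x₀ y) * ((1 - ξ y) * (1 : EuclideanSpace ℝ (Fin N) → 𝕜) y) *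
      ((h - J • b : holderCompact 𝕜 R η₀) : EuclideanSpace ℝ (Fin N) → 𝕜) x =
      (∫ y, farKernel K x₀ ξ x y) * (h : EuclideanSpace ℝ (Fin N) → 𝕜) x -
        J * ((∫ y, farKernel K x₀ ξ x y) * (b : EuclideanSpace ℝ (Fin N) → 𝕜) x) := by
    intro x
    simp only [Pi.one_apply, mul_one]
    rw [integral_mul_const]
    change _ * ((h : EuclideanSpace ℝ (Fin N) → 𝕜) x -
      J * (b : EuclideanSpace ℝ (Fin N) → 𝕜) x) = _
    simp only [farKernel]
    ring
  simp_rw [h3] at h1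
  rw [integral_sub (hκi h hh) ((hκi b hb).const_mul J), integral_const_mul, map_sub, map_smul,
    smul_eq_mul] at h1
  simp_rw [sub_mul]
  rw [integral_sub (hhi.const_mul _) (hκi h hh), integral_const_mul, ← hJ]
  linear_combination h1

end Localization

/-! ### The formula for `T f` on an orbit ball -/

section LocalOperator

variable {N : ℕ} {𝕜 : Type*} [RCLike 𝕜] {R : Set (EuclideanSpace ℝ (Fin N))} {η₀ ε : ℝ}
  {T : holderCompact 𝕜 R η₀ →ₗ[𝕜] holderCompact 𝕜 R η₀ →ₗ[𝕜] 𝕜}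
  {K : EuclideanSpace ℝ (Fin N) → EuclideanSpace ℝ (Fin N) → 𝕜}

namespace Localization

/-- The kernel `K(x,y) - (1 - ξ(y)) K(x₀,y)`. -/
noncomputable def kernel (L : Localization T K) (x y : EuclideanSpace ℝ (Fin N)) : 𝕜 :=
  K x y - (1 - L.cut y) * K L.center y

/-- The orbit ball on which the cutoff function localizes. -/
def ball (L : Localization T K) : Set (EuclideanSpace ℝ (Fin N)) := orbitBall R L.center L.radius

/-- The function `T f` on the orbit ball, normalized by the cutoff function. -/
noncomputable def op (L : Localization T K) (f : EuclideanSpace ℝ (Fin N) → 𝕜)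
    (x : EuclideanSpace ℝ (Fin N)) : 𝕜 :=
  L.const * f x + ∫ y, L.kernel x y * (f y - f x)

theorem kernel_eq (L : Localization T K) (x y : EuclideanSpace ℝ (Fin N)) :
    L.kernel x y = K x y * L.cut y + farKernel K L.center L.cut x y := by
  rw [kernel, farKernel]; ring

theorem measurable_cut (L : Localization T K) : Measurable L.cut := L.isCutoff.1.1.1.measurable

theorem measurable_kernel (L : Localization T K) (hT : IsSingularIntegral R η₀ ε T K)
    (x : EuclideanSpace ℝ (Fin N)) : Measurable (L.kernel x) :=
  (hT.measurable_right x).sub ((measurable_const.sub L.measurable_cut).mul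
    (hT.measurable_right L.center))

theorem op_smul (L : Localization T K) (c : 𝕜) (f : EuclideanSpace ℝ (Fin N) → 𝕜)
    (x : EuclideanSpace ℝ (Fin N)) : L.op (c • f) x = c * L.op f x := by
  have h : ∀ y, L.kernel x y * ((c • f) y - (c • f) x) =
      c * (L.kernel x y * (f y - f x)) := fun y => by
    simp only [Pi.smul_apply, smul_eq_mul]; ring
  simp only [op, h]
  rw [integral_const_mul, Pi.smul_apply, smul_eq_mul]
  ring

variable [Finite (reflectionGroup R)]

/-- The kernel splits as `K ξ` plus the far kernel; the near part uses `η > 0`, the far part `η <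
ε`. -/
theorem exists_kernel_le (hN : 1 ≤ N) (hε₀ : 0 < ε) (hε₁ : ε ≤ 1)
    (hT : IsSingularIntegral R η₀ ε T K) {η : ℝ} (hη : 0 < η) (hηε : η < ε) :
    ∃ C, 0 ≤ C ∧ ∀ (L : Localization T K) (B : ℝ), (∀ y, ‖1 - L.cut y‖ ≤ B) → ∀ x ∈ L.ball,
      (Integrable fun y => ‖L.kernel x y‖ * orbitDist R x y ^ η) ∧
      ∫ y, ‖L.kernel x y‖ * orbitDist R x y ^ η ≤ C * (B + 1) * L.radius ^ η := by
  obtain ⟨C₁, hC₁, h₁⟩ := hT.exists_farKernel_le hN hε₀ hε₁ hη.le hηε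
  obtain ⟨C₂, hC₂, h₂⟩ := hT.exists_nearKernel_le hN hη (by linarith)
  refine ⟨C₁ + C₂, by positivity, fun L B hB x hx => ?_⟩
  have hB0 : 0 ≤ B := (norm_nonneg _).trans (hB 0)
  obtain ⟨i₁, b₁⟩ := h₁ L.center L.radius L.cut B L.radius_pos L.isCutoff hB x hx
  obtain ⟨i₂, b₂⟩ := h₂ L.center L.radius L.cut B L.radius_pos L.isCutoff hB x hx
  have hbd : ∀ y, ‖L.kernel x y‖ * orbitDist R x y ^ η ≤
      ‖K x y * L.cut y‖ * orbitDist R x y ^ η +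
        ‖farKernel K L.center L.cut x y‖ * orbitDist R x y ^ η := by
    intro y
    rw [← add_mul, L.kernel_eq]
    exact mul_le_mul_of_nonneg_right (norm_add_le _ _) (orbitDist_rpow_nonneg _ _ _)
  have hi : Integrable fun y => ‖L.kernel x y‖ * orbitDist R x y ^ η := by
    refine (i₂.add i₁).mono' ?_ (Eventually.of_forall fun y => ?_)
    · exact ((L.measurable_kernel hT x).norm.mul
        ((continuous_orbitDist_right R x).measurable.pow_const η)).aestronglyMeasurable
    · rw [Real.norm_of_nonneg (mul_nonneg (norm_nonneg _) (orbitDist_rpow_nonneg _ _ _))]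
      exact hbd y
  refine ⟨hi, (integral_mono hi (i₂.add i₁) hbd).trans ?_⟩
  have hr := Real.rpow_nonneg L.radius_pos.le η
  rw [integral_add' i₂ i₁]
  have h3 : C₁ * B * L.radius ^ η ≤ C₁ * (B + 1) * L.radius ^ η := by gcongr; linarith
  nlinarith

theorem integrable_kernel_weight (hN : 1 ≤ N) (hε₀ : 0 < ε) (hε₁ : ε ≤ 1)
    (hT : IsSingularIntegral R η₀ ε T K) {η : ℝ} (hη : 0 < η) (hηε : η < ε)
    (L : Localization T K) {x : EuclideanSpace ℝ (Fin N)} (hx : x ∈ L.ball) :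
    Integrable fun y => ‖L.kernel x y‖ * orbitDist R x y ^ η := by
  obtain ⟨C, hC, h⟩ := exists_kernel_le (T := T) (K := K) hN hε₀ hε₁ hT hη hηε
  obtain ⟨B, hB0, hB⟩ := L.isCutoff.exists_bound
  exact (h L B hB x hx).1

theorem norm_kernel_mul_sub_le (hN : 1 ≤ N) {η : ℝ} (hη : 0 < η) (L : Localization T K)
    {f : EuclideanSpace ℝ (Fin N) → 𝕜} (hf : f ∈ holderSpace 𝕜 R η)
    (x y : EuclideanSpace ℝ (Fin N)) : ‖L.kernel x y * (f y - f x)‖ ≤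
      holderNorm R η f * (‖L.kernel x y‖ * orbitDist R x y ^ η) := by
  rw [norm_mul, norm_sub_rev (f y)]
  refine (mul_le_mul_of_nonneg_left (holderBound_of_mem_holderSpace hN hη hf x y)
    (norm_nonneg _)).trans (le_of_eq ?_)
  ring

theorem integrable_kernel_mul (hN : 1 ≤ N) (hε₀ : 0 < ε) (hε₁ : ε ≤ 1)
    (hT : IsSingularIntegral R η₀ ε T K) {η : ℝ} (hη : 0 < η) (hηε : η < ε)
    (L : Localization T K) {f : EuclideanSpace ℝ (Fin N) → 𝕜} (hf : f ∈ holderSpace 𝕜 R η)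
    {x : EuclideanSpace ℝ (Fin N)} (hx : x ∈ L.ball) :
    Integrable fun y => L.kernel x y * (f y - f x) := by
  refine ((L.integrable_kernel_weight hN hε₀ hε₁ hT hη hηε hx).const_mul
    (holderNorm R η f)).mono' ?_ (Eventually.of_forall fun y => L.norm_kernel_mul_sub_le hN hη hf x y)
  exact ((L.measurable_kernel hT x).mul (hf.1.measurable.sub_const _)).aestronglyMeasurable

theorem op_add (hN : 1 ≤ N) (hε₀ : 0 < ε) (hε₁ : ε ≤ 1)
    (hT : IsSingularIntegral R η₀ ε T K) {η : ℝ} (hη : 0 < η) (hηε : η < ε)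
    (L : Localization T K) {f g : EuclideanSpace ℝ (Fin N) → 𝕜} (hf : f ∈ holderSpace 𝕜 R η)
    (hg : g ∈ holderSpace 𝕜 R η) {x : EuclideanSpace ℝ (Fin N)} (hx : x ∈ L.ball) :
    L.op (f + g) x = L.op f x + L.op g x := by
  have h : ∀ y, L.kernel x y * ((f + g) y - (f + g) x) =
      L.kernel x y * (f y - f x) + L.kernel x y * (g y - g x) := fun y => by
    simp only [Pi.add_apply]; ring
  simp only [op, h]
  rw [integral_add (L.integrable_kernel_mul hN hε₀ hε₁ hT hη hηε hf hx)
    (L.integrable_kernel_mul hN hε₀ hε₁ hT hη hηε hg hx), Pi.add_apply]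
  ring

/-- This is the local form of the theorem: on a ball of radius `r`, `T f` stays within a multiple of
`r ^ η ‖f‖` of a number independent of `x`. -/
theorem exists_norm_op_sub_le (hN : 1 ≤ N) (hε₀ : 0 < ε) (hε₁ : ε ≤ 1)
    (hT : IsSingularIntegral R η₀ ε T K) {η : ℝ} (hη : 0 < η) (hηε : η < ε) :
    ∃ C, 0 ≤ C ∧ ∀ (L : Localization T K) (B : ℝ), (∀ y, ‖1 - L.cut y‖ ≤ B) → ∀ x ∈ L.ball,
      ∀ f ∈ holderSpace 𝕜 R η, ‖L.op f x - L.const * f L.center‖ ≤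
        (‖L.const‖ + C * (B + 1)) * L.radius ^ η * holderNorm R η f := by
  obtain ⟨C, hC, h⟩ := exists_kernel_le (T := T) (K := K) hN hε₀ hε₁ hT hη hηε
  refine ⟨C, hC, fun L B hB x hx f hf => ?_⟩
  obtain ⟨hi, hb⟩ := h L B hB x hx
  have hx' : orbitDist R L.center x < L.radius := hx
  have h1 : L.op f x - L.const * f L.center =
      L.const * (f x - f L.center) + ∫ y, L.kernel x y * (f y - f x) := by rw [op]; ring
  have hf0 := holderNorm_nonneg (R := R) η f
  have h2 : ‖f x - f L.center‖ ≤ holderNorm R η f * L.radius ^ η := by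
    rw [norm_sub_rev]
    refine (holderBound_of_mem_holderSpace hN hη hf _ _).trans ?_
    have := orbitDist_nonneg R L.center x
    gcongr
  have h3 : ‖∫ y, L.kernel x y * (f y - f x)‖ ≤
      holderNorm R η f * (C * (B + 1) * L.radius ^ η) := by
    refine (norm_integral_le_of_norm_le (hi.const_mul (holderNorm R η f))
      (Eventually.of_forall fun y => L.norm_kernel_mul_sub_le hN hη hf x y)).trans ?_
    rw [integral_const_mul]
    exact mul_le_mul_of_nonneg_left hb hf0
  rw [h1]
  refine (norm_add_le _ _).trans ?_
  rw [norm_mul]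
  refine (add_le_add (mul_le_mul_of_nonneg_left h2 (norm_nonneg _)) h3).trans (le_of_eq ?_)
  ring

/-- The constants of the standard localizations are uniformly bounded. -/
theorem exists_uniform (hN : 1 ≤ N) (hη₀ : 0 < η₀) (hη₁ : η₀ ≤ 1) (hε₀ : 0 < ε) (hε₁ : ε ≤ 1)
    (hT : IsSingularIntegral R η₀ ε T K) (hT1 : AnnihilatesOne T K) (hW : WeakBoundedness T) :
    ∃ C, 0 ≤ C ∧ ∀ (x₀ : EuclideanSpace ℝ (Fin N)) (r : ℝ), 0 < r → ∃ L : Localization T K,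
      L.center = x₀ ∧ L.radius = r ∧ (L.cut = fun y => (cutoff R x₀ r y : 𝕜)) ∧ ‖L.const‖ ≤ C := by
  obtain ⟨Cb, hCb, hbump⟩ := exists_bump 𝕜 R hN hη₀ hη₁
  obtain ⟨C, hC, hfar⟩ := hT.exists_integral_farKernel_le hN hε₀ hε₁
  obtain ⟨W, hW0, hW⟩ := hW.exists_norm_le
  obtain ⟨V, hV, hvol⟩ := exists_volume_orbitBall_le (R := R) hN
  refine ⟨W * (5 * (5 * Cb) * 5 ^ N) + C * Cb * V, by positivity, fun x₀ r hr => ?_⟩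
  obtain ⟨L, hL1, hL2, hL3⟩ := exists_localization hN hη₀ hη₁ hε₀ hε₁ hT hT1 hr
    (isCutoff_cutoff 𝕜 hη₀ hη₁ hr x₀)
  refine ⟨L, hL1, hL2, hL3, ?_⟩
  obtain ⟨b, hbs, hb1, hbn, hbh⟩ := hbump x₀ r hr
  have hball : orbitBall R L.center L.radius = orbitBall R x₀ r := by rw [hL1, hL2]
  have hbs' := hbs
  rw [← hball] at hbs'
  have hspec := L.apply_cut b hbs'
  obtain ⟨hm, hκ⟩ := hfar L.center L.radius L.cut 1 L.radius_pos L.isCutoff fun y => by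
    rw [hL3, ← RCLike.ofReal_one, ← RCLike.ofReal_sub, RCLike.norm_ofReal, abs_of_nonneg
      (sub_nonneg.2 (cutoff_le_one _ _ _))]
    linarith [cutoff_nonneg (R := R) x₀ r y]
  have hbi := integrable_of_mem_holderCompact b.2
  have hκi := integrable_mul_of_norm_le hm hbi fun x hx =>
    (hκ x (ne_zero_mem_of_tsupport_subset hbs' hx)).2
  simp_rw [sub_mul] at hspec
  rw [integral_sub (hbi.const_mul _) hκi, integral_const_mul, hb1, mul_one] at hspec
  -- Testing on a normalized bump isolates the constant: it is `⟨T ξ, b⟩`, bounded by weak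
  -- boundedness, plus the mean of the far integral against `b`. The powers of `r` cancel because
  -- `b` has size `r ^ (-N)`.
  have hconst := (sub_eq_iff_eq_add.1 hspec.symm)
  have hrN : 0 < r ^ N := by positivity
  have h1 : ‖T ⟨L.cut, L.isCutoff.1⟩ b‖ ≤ W * (5 * (5 * Cb * (r ^ N)⁻¹) * (5 * r) ^ N) := by
    refine hW x₀ x₀ (5 * r) 5 (5 * Cb * (r ^ N)⁻¹) _ _ (by positivity) (by norm_num)
      (by positivity) ?_ (hbs.trans fun x hx => ?_) ?_ (fun x => (hbn x).trans ?_) ?_ (hbh.mono ?_)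
    · simp only [hL3]
      exact tsupport_subset_orbitBall (r := 4 * r) (by linarith) fun y hy => by
        rw [cutoff_eq_zero hr hy.le, RCLike.ofReal_zero]
    · have hx' : orbitDist R x₀ x < r := hx
      exact lt_of_lt_of_le hx' (by linarith)
    · intro x
      simp only [hL3]
      exact (norm_ofReal_cutoff_le 𝕜 x₀ r x).trans (by norm_num)
    · have : 0 < Cb * (r ^ N)⁻¹ := by positivity
      nlinarith
    · simp only [hL3]
      exact (holderBound_cutoff 𝕜 hη₀ hη₁ hr x₀).mono
        (by simpa using le_five_mul_rpow_neg hη₁ hr zero_le_one)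
    · exact (le_five_mul_rpow_neg hη₁ hr (by positivity)).trans (le_of_eq (by ring))
  obtain ⟨hv1, hv2⟩ := hvol x₀ r hr
  have hms := (isOpen_orbitBall (R := R) x₀ r).measurableSet
  have h2 : ‖∫ x, (∫ y, farKernel K L.center L.cut x y) *
      (b : EuclideanSpace ℝ (Fin N) → 𝕜) x‖ ≤ V * r ^ N * (C * 1 * (Cb * (r ^ N)⁻¹)) := by
    refine (norm_integral_le_of_norm_le (g := (orbitBall R x₀ r).indicator fun _ =>
      C * 1 * (Cb * (r ^ N)⁻¹)) ((integrable_indicator_iff hms).2 (integrableOn_const hv1))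
      (Eventually.of_forall fun x => ?_)).trans ?_
    · by_cases hx : (b : EuclideanSpace ℝ (Fin N) → 𝕜) x = 0
      · rw [hx, mul_zero, norm_zero]
        exact Set.indicator_apply_nonneg fun _ => by positivity
      · rw [Set.indicator_of_mem (ne_zero_mem_of_tsupport_subset hbs hx), norm_mul]
        exact mul_le_mul (hκ x (ne_zero_mem_of_tsupport_subset hbs' hx)).2 (hbn x)
          (norm_nonneg _) (by positivity)
    · rw [integral_indicator_const _ hms, smul_eq_mul]
      gcongr
  rw [hconst]
  refine (norm_add_le _ _).trans ((add_le_add h1 h2).trans (le_of_eq ?_))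
  rw [mul_pow]
  field_simp

/-- On functions with a localized Hölder product `ξ f`, the pairing is given by the local
operator. -/
theorem extPairing_eq (hN : 1 ≤ N) (hη₀ : 0 < η₀) (hη₁ : η₀ ≤ 1) (hε₀ : 0 < ε) (hε₁ : ε ≤ 1)
    (hT : IsSingularIntegral R η₀ ε T K) (hW : WeakBoundedness T) {η : ℝ} (hη : 0 < η)
    (hηε : η < ε) (L : Localization T K) {f : EuclideanSpace ℝ (Fin N) → 𝕜}
    (hf : f ∈ holderSpace 𝕜 R η) (h : L.cut * f ∈ holderCompact 𝕜 R η₀) (g : holderCompact 𝕜 R η₀)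
    (hg : tsupport (g : EuclideanSpace ℝ (Fin N) → 𝕜) ⊆ L.ball) :
    (Integrable fun x => L.op f x * (g : EuclideanSpace ℝ (Fin N) → 𝕜) x) ∧
    extPairing T K L.center L.cut f h g =
      ∫ x, L.op f x * (g : EuclideanSpace ℝ (Fin N) → 𝕜) x := by
  obtain ⟨B, hB0, hB⟩ := L.isCutoff.exists_bound
  obtain ⟨C, hC, hfar⟩ := hT.exists_integral_farKernel_le hN hε₀ hε₁
  obtain ⟨C', hC', hfar'⟩ := hT.exists_farKernel_le hN hε₀ hε₁ hη.le hηε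
  obtain ⟨hκm, hκ⟩ := hfar L.center L.radius L.cut B L.radius_pos L.isCutoff hB
  have hweight := hfar' L.center L.radius L.cut B L.radius_pos L.isCutoff hB
  have hgi := integrable_of_mem_holderCompact g.2
  have hgx : ∀ x, (g : EuclideanSpace ℝ (Fin N) → 𝕜) x ≠ 0 → x ∈ L.ball :=
    fun x hx => ne_zero_mem_of_tsupport_subset hg hx
  have hcut1 : ∀ x ∈ L.ball, L.cut x = 1 := fun x hx => L.isCutoff.2.1 x <| by
    have hx' : orbitDist R L.center x < L.radius := hx
    have := L.radius_pos
    exact hx'.trans (by linarith)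
  have hfH := holderBound_of_mem_holderSpace hN hη hf
  have hf0 := holderNorm_nonneg (R := R) η f
  set G : holderCompact 𝕜 R η₀ := ⟨L.cut, L.isCutoff.1⟩ with hG
  set F : holderCompact 𝕜 R η₀ := ⟨L.cut * f, h⟩ with hF
  have hGg : mulHolder hN hη₀ G g = g := by
    ext x
    rw [mulHolder_apply]
    by_cases hx : (g : EuclideanSpace ℝ (Fin N) → 𝕜) x = 0
    · rw [hx, mul_zero]
    · change L.cut x * _ = _
      rw [hcut1 x (hgx x hx), one_mul]
  -- Since `ξ = 1` on the support of `g`, `⟨T(ξ f), g⟩` is `⟨T F, G g⟩`. The identity replaces it by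
  -- `⟨T ξ, (ξ f) g⟩`, which the localization computes, plus an integral.
  have hcomm := hT.commutator_identity hN hη₀ hη₁ hW F G g
  rw [hGg, L.apply_cut (mulHolder hN hη₀ F g)
    ((closure_mono (Function.support_mul_subset_right _ _)).trans hg)] at hcomm
  have hfarfm : Measurable fun x => ∫ y, (K x y - K L.center y) * ((1 - L.cut y) * f y) :=
    measurable_integral_kernel_mul (K := fun x y => K x y - K L.center y)
      (a := fun _ y => (1 - L.cut y) * f y)
      (hT.measurable.sub ((hT.measurable_right L.center).comp measurable_snd))
      (((measurable_const.sub L.measurable_cut).mul hf.1.measurable).comp measurable_snd)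
  have hfari : ∀ x ∈ L.ball, Integrable fun y => farKernel K L.center L.cut x y * (f y - f x) := by
    intro x hx
    refine ((hweight x hx).1.const_mul (holderNorm R η f)).mono' ?_
      (Eventually.of_forall fun y => ?_)
    · exact ((((measurable_farKernel hT L.measurable_cut)).comp measurable_prodMk_left).mul
        (hf.1.measurable.sub_const _)).aestronglyMeasurable
    · rw [norm_mul, norm_sub_rev (f y), mul_left_comm]
      exact mul_le_mul_of_nonneg_left (hfH x y) (norm_nonneg _)
  -- Writing `f(y) = (f(y) - f(x)) + f(x)` isolates a multiple of `f(x)` that cancels the far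
  -- integral in the formula for `T ξ`.
  have hsplit : ∀ x ∈ L.ball, ∫ y, (K x y - K L.center y) * ((1 - L.cut y) * f y) =
      (∫ y, farKernel K L.center L.cut x y * (f y - f x)) +
        (∫ y, farKernel K L.center L.cut x y) * f x := by
    intro x hx
    rw [← integral_mul_const, ← integral_add (hfari x hx) ((hκ x hx).1.mul_const _)]
    congr 1
    ext y
    rw [farKernel]
    ring
  have hfarg : Integrable fun x => (∫ y, (K x y - K L.center y) * ((1 - L.cut y) * f y)) *
      (g : EuclideanSpace ℝ (Fin N) → 𝕜) x := by
    obtain ⟨M, hM, hfM⟩ : ∃ M, 0 ≤ M ∧ ∀ x ∈ L.ball, ‖f x‖ ≤ M := by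
      refine ⟨‖f L.center‖ + holderNorm R η f * L.radius ^ η, ?_, fun x hx => ?_⟩
      · have := Real.rpow_nonneg L.radius_pos.le η
        positivity
      · have hx' : orbitDist R L.center x < L.radius := hx
        have h1 : ‖f L.center - f x‖ ≤ holderNorm R η f * L.radius ^ η := by
          refine (hfH _ _).trans ?_
          have := orbitDist_nonneg R L.center x
          gcongr
        rw [norm_sub_rev] at h1
        linarith [norm_sub_norm_le (f x) (f L.center)]
    refine integrable_mul_of_norm_le hfarfm hgi
      (B := holderNorm R η f * (C' * B * L.radius ^ η) + C * B * M) fun x hx => ?_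
    rw [hsplit x (hgx x hx)]
    refine (norm_add_le _ _).trans (add_le_add ?_ ?_)
    · refine (norm_integral_le_of_norm_le ((hweight x (hgx x hx)).1.const_mul (holderNorm R η f))
        (Eventually.of_forall fun y => ?_)).trans ?_
      · rw [norm_mul, norm_sub_rev (f y), mul_left_comm]
        exact mul_le_mul_of_nonneg_left (hfH x y) (norm_nonneg _)
      · rw [integral_const_mul]
        exact mul_le_mul_of_nonneg_left (hweight x (hgx x hx)).2 hf0
    · rw [norm_mul]
      exact mul_le_mul (hκ x (hgx x hx)).2 (hfM x (hgx x hx)) (norm_nonneg _) (by positivity)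
  have hcommi := hT.integrable_commutatorKernel_mul hN hη₀ F G g
  have hconsti : Integrable fun x => (L.const - ∫ y, farKernel K L.center L.cut x y) *
      (mulHolder hN hη₀ F g : EuclideanSpace ℝ (Fin N) → 𝕜) x := by
    refine integrable_mul_of_norm_le (measurable_const.sub hκm)
      (integrable_of_mem_holderCompact (mulHolder hN hη₀ F g).2) (B := ‖L.const‖ + C * B)
      fun x hx => (norm_sub_le _ _).trans (add_le_add le_rfl (hκ x (hgx x ?_)).2)
    rw [mulHolder_apply] at hx
    exact right_ne_zero_of_mul hx
  have hpt : ∀ x, L.op f x * (g : EuclideanSpace ℝ (Fin N) → 𝕜) x =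
      commutatorKernel K (F : EuclideanSpace ℝ (Fin N) → 𝕜) G x *
        (g : EuclideanSpace ℝ (Fin N) → 𝕜) x +
      (L.const - ∫ y, farKernel K L.center L.cut x y) *
        (mulHolder hN hη₀ F g : EuclideanSpace ℝ (Fin N) → 𝕜) x +
      (∫ y, (K x y - K L.center y) * ((1 - L.cut y) * f y)) *
        (g : EuclideanSpace ℝ (Fin N) → 𝕜) x := by
    intro x
    by_cases hx : (g : EuclideanSpace ℝ (Fin N) → 𝕜) x = 0
    · rw [mulHolder_apply, hx]; ring
    have hxb := hgx x hx
    have hFx : (F : EuclideanSpace ℝ (Fin N) → 𝕜) x = f x := by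
      change L.cut x * f x = f x
      rw [hcut1 x hxb, one_mul]
    have hci := (hT.integrable_commutator hN hη₀ F G).1 x
    have hop : ∫ y, L.kernel x y * (f y - f x) =
        commutatorKernel K (F : EuclideanSpace ℝ (Fin N) → 𝕜) G x +
          ∫ y, farKernel K L.center L.cut x y * (f y - f x) := by
      rw [commutatorKernel, ← integral_add hci (hfari x hxb)]
      congr 1
      ext y
      rw [hFx, L.kernel_eq]
      change _ = K x y * (L.cut y * f y * L.cut x - L.cut y * f x) + _
      rw [hcut1 x hxb]
      ring
    rw [op, hop, hsplit x hxb, mulHolder_apply, hFx]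
    ring
  simp_rw [hpt]
  have hsum := hcommi.add hconsti
  refine ⟨hsum.add hfarg, ?_⟩
  have hsum' : Integrable fun x => commutatorKernel K (F : EuclideanSpace ℝ (Fin N) → 𝕜) G x *
        (g : EuclideanSpace ℝ (Fin N) → 𝕜) x +
      (L.const - ∫ y, farKernel K L.center L.cut x y) *
        (mulHolder hN hη₀ F g : EuclideanSpace ℝ (Fin N) → 𝕜) x := hsum
  rw [integral_add hsum' hfarg, integral_add hcommi hconsti, ← hcomm, extPairing]
  simp_rw [integral_mul_const]
  ring

end Localization

end LocalOperator

/-! ### Gluing the local formulas -/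

section GlobalOperator

variable {N : ℕ} {𝕜 : Type*} [RCLike 𝕜] {R : Set (EuclideanSpace ℝ (Fin N))} {η₀ ε : ℝ}
  {T : holderCompact 𝕜 R η₀ →ₗ[𝕜] holderCompact 𝕜 R η₀ →ₗ[𝕜] 𝕜}
  {K : EuclideanSpace ℝ (Fin N) → EuclideanSpace ℝ (Fin N) → 𝕜}

/-- Given localizations to the balls of centre `0` and radius `n + 1`, the function `T f`,
normalized to vanish at `0`. -/
noncomputable def globalOp (Λ : ℕ → Localization T K) (f : EuclideanSpace ℝ (Fin N) → 𝕜)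
    (x : EuclideanSpace ℝ (Fin N)) : 𝕜 :=
  (Λ ⌈‖x‖⌉₊).op f x - (Λ ⌈‖x‖⌉₊).op f 0

theorem globalOp_zero (Λ : ℕ → Localization T K) (f : EuclideanSpace ℝ (Fin N) → 𝕜) :
    globalOp Λ f 0 = 0 := sub_self _

theorem globalOp_smul (Λ : ℕ → Localization T K) (c : 𝕜) (f : EuclideanSpace ℝ (Fin N) → 𝕜) :
    globalOp Λ (c • f) = c • globalOp Λ f := by
  ext x
  rw [Pi.smul_apply, globalOp, globalOp, (Λ _).op_smul, (Λ _).op_smul, smul_eq_mul]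
  ring

variable [Finite (reflectionGroup R)]

/-- Near a common point, two localizations differ by an integrable kernel in `y` alone, whose
integral is the difference of the constants. -/
theorem Localization.const_sub_const (hN : 1 ≤ N) (hη₀ : 0 < η₀) (hη₁ : η₀ ≤ 1) (hε₀ : 0 < ε)
    (hε₁ : ε ≤ 1) (hT : IsSingularIntegral R η₀ ε T K) (L L' : Localization T K)
    {x₁ : EuclideanSpace ℝ (Fin N)} (hx : x₁ ∈ L.ball) (hx' : x₁ ∈ L'.ball) :
    (Integrable fun y => (1 - L'.cut y) * K L'.center y - (1 - L.cut y) * K L.center y) ∧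
    L.const - L'.const = ∫ y, ((1 - L'.cut y) * K L'.center y - (1 - L.cut y) * K L.center y) := by
  obtain ⟨C, hC, hfar⟩ := hT.exists_integral_farKernel_le hN hε₀ hε₁
  obtain ⟨B, hB0, hB⟩ := L.isCutoff.exists_bound
  obtain ⟨B', hB0', hB'⟩ := L'.isCutoff.exists_bound
  obtain ⟨hm, hκ⟩ := hfar L.center L.radius L.cut B L.radius_pos L.isCutoff hB
  obtain ⟨hm', hκ'⟩ := hfar L'.center L'.radius L'.cut B' L'.radius_pos L'.isCutoff hB'
  set s := min L.radius L'.radius with hs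
  have hs0 : 0 < s := lt_min L.radius_pos L'.radius_pos
  -- Within distance `s` of a point common to both balls both cutoffs are `1`, so near such points
  -- `T` of their difference is given by the kernel.
  have hsep : ∀ x ∈ L.ball, x ∈ L'.ball → ∀ y, L.cut y - L'.cut y ≠ 0 → s ≤ orbitDist R x y := by
    intro x h1 h2 y hy
    have h1' : orbitDist R L.center x < L.radius := h1
    have h2' : orbitDist R L'.center x < L'.radius := h2
    by_contra h3
    have h4 : orbitDist R x y < L.radius := (not_le.1 h3).trans_le (min_le_left _ _)
    have h5 : orbitDist R x y < L'.radius := (not_le.1 h3).trans_le (min_le_right _ _)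
    have h6 : orbitDist R L.center y < 2 * L.radius := by
      linarith [orbitDist_triangle (R := R) L.center x y]
    have h7 : orbitDist R L'.center y < 2 * L'.radius := by
      linarith [orbitDist_triangle (R := R) L'.center x y]
    exact hy (by rw [L.isCutoff.2.1 y h6, L'.isCutoff.2.1 y h7, sub_self])
  obtain ⟨t, ht, htL, htL'⟩ : ∃ t, 0 < t ∧ orbitBall R x₁ t ⊆ L.ball ∧ orbitBall R x₁ t ⊆ L'.ball := by
    have h1 : orbitDist R L.center x₁ < L.radius := hx
    have h2 : orbitDist R L'.center x₁ < L'.radius := hx'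
    refine ⟨min (L.radius - orbitDist R L.center x₁) (L'.radius - orbitDist R L'.center x₁),
      lt_min (by linarith) (by linarith), fun y hy => ?_, fun y hy => ?_⟩
    · have h3 : orbitDist R x₁ y < _ := lt_of_lt_of_le hy (min_le_left _ _)
      change orbitDist R L.center y < L.radius
      linarith [orbitDist_triangle (R := R) L.center x₁ y]
    · have h3 : orbitDist R x₁ y < _ := lt_of_lt_of_le hy (min_le_right _ _)
      change orbitDist R L'.center y < L'.radius
      linarith [orbitDist_triangle (R := R) L'.center x₁ y]
  obtain ⟨_, _, hbump⟩ := exists_bump 𝕜 R hN hη₀ hη₁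
  obtain ⟨b, hbs, hb1, -, -⟩ := hbump x₁ t ht
  have hbL := fun x hx => htL (ne_zero_mem_of_tsupport_subset hbs (x := x) hx)
  have hbL' := fun x hx => htL' (ne_zero_mem_of_tsupport_subset hbs (x := x) hx)
  have hbi := integrable_of_mem_holderCompact b.2
  have hb0 : ∃ x, (b : EuclideanSpace ℝ (Fin N) → 𝕜) x ≠ 0 := by
    by_contra! h
    simp [h] at hb1
  obtain ⟨hTi, hTe, hTin⟩ := hT.apply_of_separated
    ((⟨L.cut, L.isCutoff.1⟩ : holderCompact 𝕜 R η₀) - ⟨L'.cut, L'.isCutoff.1⟩) b hs0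
    fun x y h1 h2 => hsep x (hbL x h1) (hbL' x h1) y h2
  -- The left side does not involve `x`, while each term on the right is integrable for `x` in both
  -- balls. Comparing the two expressions for `⟨T(ξ - ξ'), b⟩` then yields the constants.
  have hpt : ∀ x y, (1 - L'.cut y) * K L'.center y - (1 - L.cut y) * K L.center y =
      K x y * ((((⟨L.cut, L.isCutoff.1⟩ : holderCompact 𝕜 R η₀) - ⟨L'.cut, L'.isCutoff.1⟩ :
        holderCompact 𝕜 R η₀) : EuclideanSpace ℝ (Fin N) → 𝕜) y) -
      (farKernel K L'.center L'.cut x y - farKernel K L.center L.cut x y) := by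
    intro x y
    change _ = K x y * (L.cut y - L'.cut y) - _
    rw [farKernel, farKernel]
    ring
  have hfi : ∀ x, (b : EuclideanSpace ℝ (Fin N) → 𝕜) x ≠ 0 → Integrable fun y =>
      farKernel K L'.center L'.cut x y - farKernel K L.center L.cut x y :=
    fun x h => (hκ' x (hbL' x h)).1.sub (hκ x (hbL x h)).1
  have hmi : Integrable fun y => (1 - L'.cut y) * K L'.center y - (1 - L.cut y) * K L.center y := by
    obtain ⟨x, h⟩ := hb0
    simp_rw [hpt x]
    exact (hTin x h).sub (hfi x h)
  refine ⟨hmi, ?_⟩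
  set m := ∫ y, ((1 - L'.cut y) * K L'.center y - (1 - L.cut y) * K L.center y) with hmdef
  have hmx : ∀ x, (b : EuclideanSpace ℝ (Fin N) → 𝕜) x ≠ 0 → m = (∫ y, K x y *
      ((((⟨L.cut, L.isCutoff.1⟩ : holderCompact 𝕜 R η₀) - ⟨L'.cut, L'.isCutoff.1⟩ :
        holderCompact 𝕜 R η₀) : EuclideanSpace ℝ (Fin N) → 𝕜) y)) -
      ((∫ y, farKernel K L'.center L'.cut x y) - ∫ y, farKernel K L.center L.cut x y) := by
    intro x h
    rw [hmdef, ← integral_sub (hκ' x (hbL' x h)).1 (hκ x (hbL x h)).1,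
      ← integral_sub (hTin x h) (hfi x h)]
    simp_rw [← hpt x]
  have hLi : Integrable fun x => (L.const - ∫ y, farKernel K L.center L.cut x y) *
      (b : EuclideanSpace ℝ (Fin N) → 𝕜) x :=
    integrable_mul_of_norm_le (measurable_const.sub hm) hbi (B := ‖L.const‖ + C * B)
      fun x h => (norm_sub_le _ _).trans (add_le_add le_rfl (hκ x (hbL x h)).2)
  have hLi' : Integrable fun x => (L'.const - ∫ y, farKernel K L'.center L'.cut x y) *
      (b : EuclideanSpace ℝ (Fin N) → 𝕜) x :=
    integrable_mul_of_norm_le (measurable_const.sub hm') hbi (B := ‖L'.const‖ + C * B')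
      fun x h => (norm_sub_le _ _).trans (add_le_add le_rfl (hκ' x (hbL' x h)).2)
  have heq : ∀ x, (L.const - ∫ y, farKernel K L.center L.cut x y) *
        (b : EuclideanSpace ℝ (Fin N) → 𝕜) x -
      (L'.const - ∫ y, farKernel K L'.center L'.cut x y) *
        (b : EuclideanSpace ℝ (Fin N) → 𝕜) x =
      (L.const - L'.const - m) * (b : EuclideanSpace ℝ (Fin N) → 𝕜) x + (∫ y, K x y *
      ((((⟨L.cut, L.isCutoff.1⟩ : holderCompact 𝕜 R η₀) - ⟨L'.cut, L'.isCutoff.1⟩ :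
        holderCompact 𝕜 R η₀) : EuclideanSpace ℝ (Fin N) → 𝕜) y)) *
        (b : EuclideanSpace ℝ (Fin N) → 𝕜) x := by
    intro x
    by_cases h : (b : EuclideanSpace ℝ (Fin N) → 𝕜) x = 0
    · simp [h]
    · rw [hmx x h]; ring
  rw [map_sub, LinearMap.sub_apply, L.apply_cut b (hbs.trans htL), L'.apply_cut b (hbs.trans htL'),
    ← integral_sub hLi hLi', integral_congr_ae (Eventually.of_forall heq),
    integral_add (hbi.const_mul _) hTi, integral_const_mul, hb1, mul_one] at hTe
  exact sub_eq_zero.1 (add_eq_right.1 hTe)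

/-- The two kernels differ by a function `m(y)` with `∫ m = c - c'`. So the operators differ at `w`
by `(c - c') f(w) + ∫ m(y) (f(y) - f(w)) dy`, in which `f(w)` cancels. -/
theorem Localization.op_sub_op (hN : 1 ≤ N) (hη₀ : 0 < η₀) (hη₁ : η₀ ≤ 1) (hε₀ : 0 < ε)
    (hε₁ : ε ≤ 1) (hT : IsSingularIntegral R η₀ ε T K) {η : ℝ} (hη : 0 < η) (hηε : η < ε)
    (L L' : Localization T K) {f : EuclideanSpace ℝ (Fin N) → 𝕜} (hf : f ∈ holderSpace 𝕜 R η)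
    {x z : EuclideanSpace ℝ (Fin N)} (hx : x ∈ L.ball) (hx' : x ∈ L'.ball) (hz : z ∈ L.ball)
    (hz' : z ∈ L'.ball) : L.op f x - L.op f z = L'.op f x - L'.op f z := by
  obtain ⟨hmi, hm⟩ := L.const_sub_const hN hη₀ hη₁ hε₀ hε₁ hT L' hx hx'
  have hker : ∀ w ∈ L.ball, w ∈ L'.ball → (Integrable fun y =>
      ((1 - L'.cut y) * K L'.center y - (1 - L.cut y) * K L.center y) * (f y - f w)) ∧
      L.op f w - L'.op f w = (L.const - L'.const) * f w +
      ∫ y, ((1 - L'.cut y) * K L'.center y - (1 - L.cut y) * K L.center y) * (f y - f w) := by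
    intro w hw hw'
    have h1 := L.integrable_kernel_mul hN hε₀ hε₁ hT hη hηε hf hw
    have h2 := L'.integrable_kernel_mul hN hε₀ hε₁ hT hη hηε hf hw'
    have h3 : ∀ y, ((1 - L'.cut y) * K L'.center y - (1 - L.cut y) * K L.center y) * (f y - f w) =
        L.kernel w y * (f y - f w) - L'.kernel w y * (f y - f w) := fun y => by
      rw [Localization.kernel, Localization.kernel]; ring
    simp_rw [h3]
    refine ⟨h1.sub h2, ?_⟩
    rw [integral_sub h1 h2, Localization.op, Localization.op]
    ring
  obtain ⟨hix, hex⟩ := hker x hx hx'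
  obtain ⟨hiz, hez⟩ := hker z hz hz'
  have hdiff : (∫ y, ((1 - L'.cut y) * K L'.center y - (1 - L.cut y) * K L.center y) *
      (f y - f x)) - ∫ y, ((1 - L'.cut y) * K L'.center y - (1 - L.cut y) * K L.center y) *
      (f y - f z) = (L.const - L'.const) * (f z - f x) := by
    rw [← integral_sub hix hiz, hm, ← integral_mul_const]
    congr 1
    ext y
    ring
  linear_combination hex - hez + hdiff

theorem mem_ball_of_norm_lt {Λ : ℕ → Localization T K}
    (hΛ : ∀ n, (Λ n).center = 0 ∧ (Λ n).radius = n + 1) {n : ℕ} {x : EuclideanSpace ℝ (Fin N)}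
    (hx : ‖x‖ < n + 1) : x ∈ (Λ n).ball := by
  change orbitDist R (Λ n).center x < (Λ n).radius
  rwa [(hΛ n).1, (hΛ n).2, orbitDist_zero_left]

/-- Both points and `0` lie in a ball of the family `Λ` large enough for either, which serves as an
intermediary. Hence any localization may be used to estimate an oscillation. -/
theorem globalOp_sub_globalOp (hN : 1 ≤ N) (hη₀ : 0 < η₀) (hη₁ : η₀ ≤ 1) (hε₀ : 0 < ε)
    (hε₁ : ε ≤ 1) (hT : IsSingularIntegral R η₀ ε T K) {η : ℝ} (hη : 0 < η) (hηε : η < ε)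
    {Λ : ℕ → Localization T K} (hΛ : ∀ n, (Λ n).center = 0 ∧ (Λ n).radius = n + 1)
    {f : EuclideanSpace ℝ (Fin N) → 𝕜} (hf : f ∈ holderSpace 𝕜 R η) (L : Localization T K)
    {x z : EuclideanSpace ℝ (Fin N)} (hx : x ∈ L.ball) (hz : z ∈ L.ball) :
    globalOp Λ f x - globalOp Λ f z = L.op f x - L.op f z := by
  have hceil : ∀ w : EuclideanSpace ℝ (Fin N), ‖w‖ < (⌈‖w‖⌉₊ : ℝ) + 1 := fun w => by
    linarith [Nat.le_ceil ‖w‖]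
  have h0 : ∀ n : ℕ, (0 : EuclideanSpace ℝ (Fin N)) ∈ (Λ n).ball := fun n =>
    mem_ball_of_norm_lt hΛ (by rw [norm_zero]; positivity)
  set n := max ⌈‖x‖⌉₊ ⌈‖z‖⌉₊ with hn
  have hxn : x ∈ (Λ n).ball := mem_ball_of_norm_lt hΛ ((hceil x).trans_le (by
    gcongr; exact le_max_left _ _))
  have hzn : z ∈ (Λ n).ball := mem_ball_of_norm_lt hΛ ((hceil z).trans_le (by
    gcongr; exact le_max_right _ _))
  have key : ∀ (L L' : Localization T K) (x z : EuclideanSpace ℝ (Fin N)), x ∈ L.ball →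
      x ∈ L'.ball → z ∈ L.ball → z ∈ L'.ball → L.op f x - L.op f z = L'.op f x - L'.op f z :=
    fun L L' x z h1 h2 h3 h4 => L.op_sub_op hN hη₀ hη₁ hε₀ hε₁ hT hη hηε L' hf h1 h2 h3 h4
  have h1 := key (Λ ⌈‖x‖⌉₊) (Λ n) _ _ (mem_ball_of_norm_lt hΛ (hceil x)) hxn (h0 _) (h0 _)
  have h2 := key (Λ ⌈‖z‖⌉₊) (Λ n) _ _ (mem_ball_of_norm_lt hΛ (hceil z)) hzn (h0 _) (h0 _)
  have h3 := key (Λ n) L _ _ hxn hx hzn hz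
  rw [globalOp, globalOp]
  linear_combination h1 - h2 + h3

/-- The oscillation between `x` and `z` is measured in the standard localization centred at `x` with
a radius just above `d(x,z)`, whose constant is uniformly bounded. -/
theorem exists_holderBound_globalOp (hN : 1 ≤ N) (hη₀ : 0 < η₀) (hη₁ : η₀ ≤ 1) (hε₀ : 0 < ε)
    (hε₁ : ε ≤ 1) (hT : IsSingularIntegral R η₀ ε T K) (hT1 : AnnihilatesOne T K)
    (hW : WeakBoundedness T) {η : ℝ} (hη : 0 < η) (hηε : η < ε)
    {Λ : ℕ → Localization T K} (hΛ : ∀ n, (Λ n).center = 0 ∧ (Λ n).radius = n + 1) :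
    ∃ C, 0 ≤ C ∧ ∀ f ∈ holderSpace 𝕜 R η, HolderBound R η (C * holderNorm R η f) (globalOp Λ f) := by
  obtain ⟨C₁, hC₁, huni⟩ := Localization.exists_uniform hN hη₀ hη₁ hε₀ hε₁ hT hT1 hW
  obtain ⟨C₂, hC₂, hop⟩ := Localization.exists_norm_op_sub_le (T := T) (K := K) hN hε₀ hε₁ hT hη hηε
  refine ⟨2 * (C₁ + C₂ * 2), by positivity, fun f hf x z => ?_⟩
  have hf0 := holderNorm_nonneg (R := R) η f
  have key : ∀ r, orbitDist R x z < r → ‖globalOp Λ f x - globalOp Λ f z‖ ≤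
      2 * (C₁ + C₂ * 2) * holderNorm R η f * r ^ η := by
    intro r hr
    have hr0 : 0 < r := (orbitDist_nonneg R x z).trans_lt hr
    obtain ⟨L, hL1, hL2, hL3, hL4⟩ := huni x r hr0
    have hcut : ∀ y, ‖1 - L.cut y‖ ≤ 1 := fun y => by
      rw [hL3, ← RCLike.ofReal_one, ← RCLike.ofReal_sub, RCLike.norm_ofReal, abs_of_nonneg
        (sub_nonneg.2 (cutoff_le_one _ _ _))]
      linarith [cutoff_nonneg (R := R) x r y]
    have hx : x ∈ L.ball := by
      change orbitDist R L.center x < L.radius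
      rwa [hL1, hL2, orbitDist_self]
    have hz : z ∈ L.ball := by
      change orbitDist R L.center z < L.radius
      rwa [hL1, hL2]
    have h1 := hop L 1 hcut x hx f hf
    have h2 := hop L 1 hcut z hz f hf
    rw [hL2] at h1 h2
    rw [globalOp_sub_globalOp hN hη₀ hη₁ hε₀ hε₁ hT hη hηε hΛ hf L hx hz]
    have h3 : L.op f x - L.op f z =
        (L.op f x - L.const * f L.center) - (L.op f z - L.const * f L.center) := by ring
    have h4 : (‖L.const‖ + C₂ * (1 + 1)) * r ^ η * holderNorm R η f ≤
        (C₁ + C₂ * 2) * r ^ η * holderNorm R η f := by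
      gcongr
      linarith
    rw [h3]
    refine (norm_sub_le _ _).trans ?_
    linarith
  -- Orbit balls are open, so `r` must exceed `d(x,z)`; letting `r` decrease to it also covers
  -- `d(x,z) = 0`.
  have hlim : Tendsto (fun r => 2 * (C₁ + C₂ * 2) * holderNorm R η f * r ^ η)
      (𝓝[>] (orbitDist R x z))
      (𝓝 (2 * (C₁ + C₂ * 2) * holderNorm R η f * orbitDist R x z ^ η)) :=
    ((continuous_const.mul (continuous_id.rpow_const fun _ => Or.inr hη.le)).tendsto _).mono_left
      nhdsWithin_le_nhds
  exact ge_of_tendsto hlim (eventually_nhdsWithin_of_forall key)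

theorem globalOp_add (hN : 1 ≤ N) (hε₀ : 0 < ε) (hε₁ : ε ≤ 1)
    (hT : IsSingularIntegral R η₀ ε T K) {η : ℝ} (hη : 0 < η) (hηε : η < ε)
    {Λ : ℕ → Localization T K} (hΛ : ∀ n, (Λ n).center = 0 ∧ (Λ n).radius = n + 1)
    {f g : EuclideanSpace ℝ (Fin N) → 𝕜} (hf : f ∈ holderSpace 𝕜 R η)
    (hg : g ∈ holderSpace 𝕜 R η) : globalOp Λ (f + g) = globalOp Λ f + globalOp Λ g := by
  ext x
  have hx : x ∈ (Λ ⌈‖x‖⌉₊).ball := mem_ball_of_norm_lt hΛ (by linarith [Nat.le_ceil ‖x‖])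
  have h0 : (0 : EuclideanSpace ℝ (Fin N)) ∈ (Λ ⌈‖x‖⌉₊).ball :=
    mem_ball_of_norm_lt hΛ (by rw [norm_zero]; positivity)
  rw [Pi.add_apply, globalOp, globalOp, globalOp,
    (Λ _).op_add hN hε₀ hε₁ hT hη hηε hf hg hx, (Λ _).op_add hN hε₀ hε₁ hT hη hηε hf hg h0]
  ring

/-- The global operator represents `T f` modulo constants. -/
theorem extPairing_eq_integral_globalOp (hN : 1 ≤ N) (hη₀ : 0 < η₀) (hη₁ : η₀ ≤ 1) (hε₀ : 0 < ε)
    (hε₁ : ε ≤ 1) (hT : IsSingularIntegral R η₀ ε T K) (hW : WeakBoundedness T)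
    {η : ℝ} (hη : 0 < η) (hηε : η < ε)
    {Λ : ℕ → Localization T K} (hΛ : ∀ n, (Λ n).center = 0 ∧ (Λ n).radius = n + 1)
    {f : EuclideanSpace ℝ (Fin N) → 𝕜} (hf : f ∈ holderSpace 𝕜 R η) (L : Localization T K)
    (h : L.cut * f ∈ holderCompact 𝕜 R η₀) (g : holderCompact 𝕜 R η₀)
    (hg0 : ∫ x, (g : EuclideanSpace ℝ (Fin N) → 𝕜) x = 0)
    (hg : tsupport (g : EuclideanSpace ℝ (Fin N) → 𝕜) ⊆ L.ball) :
    extPairing T K L.center L.cut f h g =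
      ∫ x, globalOp Λ f x * (g : EuclideanSpace ℝ (Fin N) → 𝕜) x := by
  obtain ⟨hi, he⟩ := L.extPairing_eq hN hη₀ hη₁ hε₀ hε₁ hT hW hη hηε hf h g hg
  have hc : L.center ∈ L.ball := mem_orbitBall_self L.radius_pos
  have hpt : ∀ x, globalOp Λ f x * (g : EuclideanSpace ℝ (Fin N) → 𝕜) x =
      L.op f x * (g : EuclideanSpace ℝ (Fin N) → 𝕜) x +
      (globalOp Λ f L.center - L.op f L.center) * (g : EuclideanSpace ℝ (Fin N) → 𝕜) x := by
    intro x
    by_cases hx : (g : EuclideanSpace ℝ (Fin N) → 𝕜) x = 0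
    · simp [hx]
    · have := globalOp_sub_globalOp hN hη₀ hη₁ hε₀ hε₁ hT hη hηε hΛ hf L
        (ne_zero_mem_of_tsupport_subset hg hx) hc
      linear_combination this * (g : EuclideanSpace ℝ (Fin N) → 𝕜) x
  simp_rw [hpt]
  rw [integral_add hi ((integrable_of_mem_holderCompact g.2).const_mul _), integral_const_mul, hg0,
    mul_zero, add_zero, he]

/-- For compactly supported `f`, the global operator represents `T f` modulo constants. -/
theorem apply_eq_integral_globalOp (hN : 1 ≤ N) (hη₀ : 0 < η₀) (hη₁ : η₀ ≤ 1) (hε₀ : 0 < ε)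
    (hε₁ : ε ≤ 1) (hT : IsSingularIntegral R η₀ ε T K) (hW : WeakBoundedness T)
    {η : ℝ} (hη : 0 < η) (hηε : η < ε)
    {Λ : ℕ → Localization T K} (hΛ : ∀ n, (Λ n).center = 0 ∧ (Λ n).radius = n + 1)
    {f : EuclideanSpace ℝ (Fin N) → 𝕜} (hf : f ∈ holderSpace 𝕜 R η)
    (hf' : f ∈ holderCompact 𝕜 R η₀) (g : holderCompact 𝕜 R η₀)
    (hg0 : ∫ x, (g : EuclideanSpace ℝ (Fin N) → 𝕜) x = 0) :
    T ⟨f, hf'⟩ g = ∫ x, globalOp Λ f x * (g : EuclideanSpace ℝ (Fin N) → 𝕜) x := by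
  obtain ⟨r₁, hr₁, hfr⟩ := exists_orbitDist_le_of_mem_holderCompact hf'
  obtain ⟨r₂, hr₂, hgr⟩ := exists_orbitDist_le_of_mem_holderCompact g.2
  obtain ⟨n, hn⟩ := exists_nat_ge (max r₁ r₂)
  have hn1 := (le_max_left r₁ r₂).trans hn
  have hn2 := (le_max_right r₁ r₂).trans hn
  have hcutf : ∀ y, (Λ n).cut y * f y = f y := by
    intro y
    by_cases hy : r₁ < ‖y‖
    · rw [hfr y hy, mul_zero]
    · rw [(Λ n).isCutoff.2.1 y, one_mul]
      change orbitDist R (Λ n).center y < 2 * (Λ n).radius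
      rw [(hΛ n).1, (hΛ n).2, orbitDist_zero_left]
      linarith
  -- The cutoff is `1` on the support of `f`, so the far term of the extended pairing vanishes.
  have hmul : (Λ n).cut * f = f := funext hcutf
  have hmem : (Λ n).cut * f ∈ holderCompact 𝕜 R η₀ := by rwa [hmul]
  have hg : tsupport (g : EuclideanSpace ℝ (Fin N) → 𝕜) ⊆ (Λ n).ball := by
    refine tsupport_subset_orbitBall (r := r₂) ?_ fun y hy => ?_
    · rw [(hΛ n).2]; linarith
    · rw [(hΛ n).1, orbitDist_zero_left] at hy
      exact hgr y hy
  rw [← extPairing_eq_integral_globalOp hN hη₀ hη₁ hε₀ hε₁ hT hW hη hηε hΛ hf (Λ n) hmem g hg0 hg,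
    extPairing]
  have h1 : (⟨(Λ n).cut * f, hmem⟩ : holderCompact 𝕜 R η₀) = ⟨f, hf'⟩ := Subtype.ext hmul
  have h2 : ∀ y, (1 - (Λ n).cut y) * f y = 0 := fun y => by rw [sub_mul, one_mul, hcutf, sub_self]
  simp [h1, h2]

/-- Weak continuity of the global operator. -/
theorem tendsto_integral_globalOp (hN : 1 ≤ N) (hη₀ : 0 < η₀) (hη₁ : η₀ ≤ 1) (hε₀ : 0 < ε)
    (hε₁ : ε ≤ 1) (hT : IsSingularIntegral R η₀ ε T K) (hT1 : AnnihilatesOne T K)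
    (hW : WeakBoundedness T) {η : ℝ} (hη : 0 < η) (hηε : η < ε)
    {Λ : ℕ → Localization T K} (hΛ : ∀ n, (Λ n).center = 0 ∧ (Λ n).radius = n + 1)
    {v : ℕ → EuclideanSpace ℝ (Fin N) → 𝕜} (hv : ∀ n, v n ∈ holderSpace 𝕜 R η) {M : ℝ}
    (hM : ∀ n, holderNorm R η (v n) ≤ M) (hlim : ∀ x, Tendsto (fun n => v n x) atTop (𝓝 0))
    (g : holderCompact 𝕜 R η₀) :
    Tendsto (fun n => ∫ x, globalOp Λ (v n) x * (g : EuclideanSpace ℝ (Fin N) → 𝕜) x) atTop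
      (𝓝 0) := by
  obtain ⟨C, hC, hH⟩ := exists_holderBound_globalOp hN hη₀ hη₁ hε₀ hε₁ hT hT1 hW hη hηε hΛ
  have hM0 : 0 ≤ M := (holderNorm_nonneg η (v 0)).trans (hM 0)
  have hop : ∀ (L : Localization T K), ∀ x ∈ L.ball,
      Tendsto (fun n => L.op (v n) x) atTop (𝓝 0) := by
    intro L x hx
    have h1 : Tendsto (fun n => ∫ y, L.kernel x y * (v n y - v n x)) atTop
        (𝓝 (∫ _y : EuclideanSpace ℝ (Fin N), (0 : 𝕜))) := by
      refine tendsto_integral_of_dominated_convergence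
        (fun y => M * (‖L.kernel x y‖ * orbitDist R x y ^ η)) (fun n => ?_) ?_ (fun n => ?_) ?_
      · exact (L.integrable_kernel_mul hN hε₀ hε₁ hT hη hηε (hv n) hx).1
      · exact (L.integrable_kernel_weight hN hε₀ hε₁ hT hη hηε hx).const_mul M
      · refine Eventually.of_forall fun y => (L.norm_kernel_mul_sub_le hN hη (hv n) x y).trans ?_
        exact mul_le_mul_of_nonneg_right (hM n)
          (mul_nonneg (norm_nonneg _) (orbitDist_rpow_nonneg _ _ _))
      · refine Eventually.of_forall fun y => ?_
        simpa using ((hlim y).sub (hlim x)).const_mul (L.kernel x y)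
    simpa [Localization.op] using ((hlim x).const_mul L.const).add h1
  have hpt : ∀ x, Tendsto (fun n => globalOp Λ (v n) x) atTop (𝓝 0) := by
    intro x
    have hx : x ∈ (Λ ⌈‖x‖⌉₊).ball := mem_ball_of_norm_lt hΛ (by linarith [Nat.le_ceil ‖x‖])
    have h0 : (0 : EuclideanSpace ℝ (Fin N)) ∈ (Λ ⌈‖x‖⌉₊).ball :=
      mem_ball_of_norm_lt hΛ (by rw [norm_zero]; positivity)
    simpa [globalOp] using (hop _ x hx).sub (hop _ 0 h0)
  have hgc := g.2.1.1
  have key : Tendsto (fun n => ∫ x, globalOp Λ (v n) x * (g : EuclideanSpace ℝ (Fin N) → 𝕜) x) atTop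
      (𝓝 (∫ _x : EuclideanSpace ℝ (Fin N), (0 : 𝕜))) := by
    refine tendsto_integral_of_dominated_convergence
      (fun x => C * M * ‖x‖ ^ η * ‖(g : EuclideanSpace ℝ (Fin N) → 𝕜) x‖) (fun n => ?_) ?_
      (fun n => ?_) ?_
    · exact (((hH _ (hv n)).continuous hη).mul hgc).aestronglyMeasurable
    · refine Continuous.integrable_of_hasCompactSupport ?_ ?_
      · exact (continuous_const.mul (continuous_norm.rpow_const fun _ => Or.inr hη.le)).mul hgc.norm
      · exact g.2.2.norm.mul_left
    · refine Eventually.of_forall fun x => ?_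
      rw [norm_mul]
      refine mul_le_mul_of_nonneg_right ?_ (norm_nonneg _)
      -- The normalization at `0` turns the uniform Hölder bound into the pointwise majorant needed
      -- for dominated convergence.
      have h1 := hH _ (hv n) x 0
      rw [globalOp_zero, sub_zero, orbitDist_comm, orbitDist_zero_left] at h1
      refine h1.trans ?_
      gcongr
      exact hM n
    · refine Eventually.of_forall fun x => ?_
      simpa using (hpt x).mul_const ((g : EuclideanSpace ℝ (Fin N) → 𝕜) x)
  simpa using key

end GlobalOperator

/-! ### Invariance and the choice of additive constants -/

section Extension

variable {N : ℕ} {𝕜 : Type*} [RCLike 𝕜] {R : Set (EuclideanSpace ℝ (Fin N))}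

theorem holderSpace_apply_eq [Finite (reflectionGroup R)] (hN : 1 ≤ N) {η : ℝ} (hη : 0 < η)
    {f : EuclideanSpace ℝ (Fin N) → 𝕜} (hf : f ∈ holderSpace 𝕜 R η)
    {σ : EuclideanSpace ℝ (Fin N) ≃ₗᵢ[ℝ] EuclideanSpace ℝ (Fin N)} (hσ : σ ∈ reflectionGroup R)
    (x : EuclideanSpace ℝ (Fin N)) : f (σ x) = f x := by
  have h := holderBound_of_mem_holderSpace hN hη hf (σ x) x
  rw [orbitDist_apply ⟨σ, hσ⟩ x, Real.zero_rpow hη.ne', mul_zero, norm_le_zero_iff, sub_eq_zero] at h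
  exact h

theorem holderBound_const (η : ℝ) (c : 𝕜) :
    HolderBound R η 0 (fun _ : EuclideanSpace ℝ (Fin N) => c) := fun x y => by simp

theorem integrable_mul_of_mem_holderSpace {η η₀ : ℝ} {f : EuclideanSpace ℝ (Fin N) → 𝕜}
    (hf : f ∈ holderSpace 𝕜 R η) (g : holderCompact 𝕜 R η₀) :
    Integrable fun x => f x * (g : EuclideanSpace ℝ (Fin N) → 𝕜) x :=
  (hf.1.mul g.2.1.1).integrable_of_hasCompactSupport g.2.2.mul_left

/-- A linear map that represents `T` modulo constants can be corrected by constants so that it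
represents `T` on compactly supported functions. -/
theorem exists_linearMap_add_const [Finite (reflectionGroup R)] (hN : 1 ≤ N) {η η₀ : ℝ}
    (hη₀ : 0 < η₀) (hη₁ : η₀ ≤ 1) (T : holderCompact 𝕜 R η₀ →ₗ[𝕜] holderCompact 𝕜 R η₀ →ₗ[𝕜] 𝕜)
    (S : holderSpace 𝕜 R η →ₗ[𝕜] holderSpace 𝕜 R η)
    (hS : ∀ (f : holderSpace 𝕜 R η)
      (hf : (f : EuclideanSpace ℝ (Fin N) → 𝕜) ∈ holderCompact 𝕜 R η₀) (g : holderCompact 𝕜 R η₀),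
      ∫ x, (g : EuclideanSpace ℝ (Fin N) → 𝕜) x = 0 → T ⟨f, hf⟩ g =
        ∫ x, (S f : EuclideanSpace ℝ (Fin N) → 𝕜) x * (g : EuclideanSpace ℝ (Fin N) → 𝕜) x) :
    ∃ c : holderSpace 𝕜 R η →ₗ[𝕜] 𝕜, ∀ (f : holderSpace 𝕜 R η)
      (hf : (f : EuclideanSpace ℝ (Fin N) → 𝕜) ∈ holderCompact 𝕜 R η₀) (g : holderCompact 𝕜 R η₀),
      T ⟨f, hf⟩ g = ∫ x, ((S f : EuclideanSpace ℝ (Fin N) → 𝕜) x + c f) *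
        (g : EuclideanSpace ℝ (Fin N) → 𝕜) x := by
  obtain ⟨_, _, hbump⟩ := exists_bump 𝕜 R hN hη₀ hη₁
  obtain ⟨b, -, hb1, -, -⟩ := hbump 0 1 zero_lt_one
  let P : Submodule 𝕜 (holderSpace 𝕜 R η) := (holderCompact 𝕜 R η₀).comap (holderSpace 𝕜 R η).subtype
  let ι : P →ₗ[𝕜] holderCompact 𝕜 R η₀ :=
    { toFun := fun f => ⟨(f : holderSpace 𝕜 R η), f.2⟩
      map_add' := fun _ _ => rfl
      map_smul' := fun _ _ => rfl }
  let J : holderSpace 𝕜 R η →ₗ[𝕜] 𝕜 :=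
    { toFun := fun f => ∫ x, (S f : EuclideanSpace ℝ (Fin N) → 𝕜) x *
        (b : EuclideanSpace ℝ (Fin N) → 𝕜) x
      map_add' := fun f h => by
        rw [map_add, ← integral_add (integrable_mul_of_mem_holderSpace (S f).2 b)
          (integrable_mul_of_mem_holderSpace (S h).2 b)]
        congr 1
        ext x
        exact add_mul _ _ _
      map_smul' := fun c f => by
        rw [map_smul, RingHom.id_apply, smul_eq_mul, ← integral_const_mul]
        congr 1
        ext x
        exact mul_assoc _ _ _ }
  -- On compactly supported `f` the missing constant is read off by testing on `b`, and is linear in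
  -- `f`. Any linear extension to all of `C^η_G` will do; it need not be bounded.
  obtain ⟨c, hc⟩ := LinearMap.exists_extend ((T.flip b).comp ι - J.comp P.subtype)
  refine ⟨c, fun f hf g => ?_⟩
  have hcf : c f = T ⟨f, hf⟩ b - J f := LinearMap.congr_fun hc (⟨f, hf⟩ : P)
  have hgi := integrable_of_mem_holderCompact g.2
  have hbi := integrable_of_mem_holderCompact b.2
  set m := ∫ x, (g : EuclideanSpace ℝ (Fin N) → 𝕜) x with hm
  have hmean : ∫ x, ((g - m • b : holderCompact 𝕜 R η₀) : EuclideanSpace ℝ (Fin N) → 𝕜) x = 0 := by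
    change ∫ x, ((g : EuclideanSpace ℝ (Fin N) → 𝕜) x -
      m * (b : EuclideanSpace ℝ (Fin N) → 𝕜) x) = 0
    rw [integral_sub hgi (hbi.const_mul m), integral_const_mul, hb1, mul_one, sub_self]
  have h1 := hS f hf (g - m • b) hmean
  have h2 : ∀ x, (S f : EuclideanSpace ℝ (Fin N) → 𝕜) x *
      ((g - m • b : holderCompact 𝕜 R η₀) : EuclideanSpace ℝ (Fin N) → 𝕜) x =
      (S f : EuclideanSpace ℝ (Fin N) → 𝕜) x * (g : EuclideanSpace ℝ (Fin N) → 𝕜) x -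
      m * ((S f : EuclideanSpace ℝ (Fin N) → 𝕜) x * (b : EuclideanSpace ℝ (Fin N) → 𝕜) x) := by
    intro x
    change _ * (_ - m * _) = _
    ring
  simp_rw [h2] at h1
  rw [integral_sub (integrable_mul_of_mem_holderSpace (S f).2 g)
    ((integrable_mul_of_mem_holderSpace (S f).2 b).const_mul m), integral_const_mul, map_sub,
    map_smul, smul_eq_mul] at h1
  simp_rw [add_mul]
  rw [integral_add (integrable_mul_of_mem_holderSpace (S f).2 g) (hgi.const_mul _),
    integral_const_mul, ← hm, hcf]
  change _ = _ + (_ - ∫ x, (S f : EuclideanSpace ℝ (Fin N) → 𝕜) x *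
        (b : EuclideanSpace ℝ (Fin N) → 𝕜) x) * m
  linear_combination h1

end Extension

end ReflectionSI

/-! ### The main theorem -/

open ReflectionSI in
theorem theorem1p1 {N : ℕ} (hN : 1 ≤ N) {𝕜 : Type*} [RCLike 𝕜]
    (R : Set (EuclideanSpace ℝ (Fin N))) (hR : ReflectionSI.IsNormalizedRootSystem R)
    (η₀ : ℝ) (hη₀ : 0 < η₀) (ε : ℝ) (hε₀ : 0 < ε) (hε₁ : ε ≤ 1)
    (T : ReflectionSI.holderCompact 𝕜 R η₀ →ₗ[𝕜] ReflectionSI.holderCompact 𝕜 R η₀ →ₗ[𝕜] 𝕜)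
    (K : EuclideanSpace ℝ (Fin N) → EuclideanSpace ℝ (Fin N) → 𝕜)
    (hT : ReflectionSI.IsSingularIntegral R η₀ ε T K)
    (hT1 : ReflectionSI.AnnihilatesOne T K)
    (hWBP : ReflectionSI.WeakBoundedness T)
    (η : ℝ) (hη : 0 < η) (hηε : η < ε) :
    ∃ S : ReflectionSI.holderSpace 𝕜 R η →ₗ[𝕜] ReflectionSI.holderSpace 𝕜 R η,
      -- `S` is bounded
      (∃ C : ℝ, ∀ f : ReflectionSI.holderSpace 𝕜 R η,
        ReflectionSI.holderNorm R η (S f : EuclideanSpace ℝ (Fin N) → 𝕜) ≤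
          C * ReflectionSI.holderNorm R η (f : EuclideanSpace ℝ (Fin N) → 𝕜)) ∧
      -- `S` extends `T`
      (∀ (f : ReflectionSI.holderSpace 𝕜 R η)
        (hf : (f : EuclideanSpace ℝ (Fin N) → 𝕜) ∈ ReflectionSI.holderCompact 𝕜 R η₀)
        (g : ReflectionSI.holderCompact 𝕜 R η₀),
        T ⟨f, hf⟩ g = ∫ x, (S f : EuclideanSpace ℝ (Fin N) → 𝕜) x *
          (g : EuclideanSpace ℝ (Fin N) → 𝕜) x) ∧
      -- `S f` is the distribution `T f`, also when `f` has no compact support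
      (∀ (f : ReflectionSI.holderSpace 𝕜 R η) (g : ReflectionSI.holderCompact 𝕜 R η₀),
        ∫ x, (g : EuclideanSpace ℝ (Fin N) → 𝕜) x = 0 →
        ∀ (x₀ : EuclideanSpace ℝ (Fin N)) (r : ℝ) (ξ : EuclideanSpace ℝ (Fin N) → 𝕜), 0 < r →
          ReflectionSI.IsCutoff R η₀ x₀ r ξ →
          tsupport (g : EuclideanSpace ℝ (Fin N) → 𝕜) ⊆ ReflectionSI.orbitBall R x₀ r →
          ∀ h : ξ * (f : EuclideanSpace ℝ (Fin N) → 𝕜) ∈ ReflectionSI.holderCompact 𝕜 R η₀,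
            ReflectionSI.extPairing T K x₀ ξ f h g =
              ∫ x, (S f : EuclideanSpace ℝ (Fin N) → 𝕜) x *
                (g : EuclideanSpace ℝ (Fin N) → 𝕜) x) ∧
      -- weak sequential continuity, which determines `S` up to constants also for `η < η₀`
      (∀ (u : ℕ → ReflectionSI.holderSpace 𝕜 R η) (f : ReflectionSI.holderSpace 𝕜 R η),
        (∃ M : ℝ, ∀ n, ReflectionSI.holderNorm R η (u n : EuclideanSpace ℝ (Fin N) → 𝕜) ≤ M) →
        (∀ x, Tendsto (fun n => (u n : EuclideanSpace ℝ (Fin N) → 𝕜) x) atTop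
          (𝓝 ((f : EuclideanSpace ℝ (Fin N) → 𝕜) x))) →
        ∀ g : ReflectionSI.holderCompact 𝕜 R η₀,
          ∫ x, (g : EuclideanSpace ℝ (Fin N) → 𝕜) x = 0 →
          Tendsto (fun n => ∫ x, (S (u n) : EuclideanSpace ℝ (Fin N) → 𝕜) x *
              (g : EuclideanSpace ℝ (Fin N) → 𝕜) x) atTop
            (𝓝 (∫ x, (S f : EuclideanSpace ℝ (Fin N) → 𝕜) x *
              (g : EuclideanSpace ℝ (Fin N) → 𝕜) x))) ∧
      -- `S f` is invariant under the reflection group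
      (∀ (f : ReflectionSI.holderSpace 𝕜 R η), ∀ σ ∈ ReflectionSI.reflectionGroup R,
        ∀ x : EuclideanSpace ℝ (Fin N),
          (S f : EuclideanSpace ℝ (Fin N) → 𝕜) (σ x) = (S f : EuclideanSpace ℝ (Fin N) → 𝕜) x) := by
  have : Finite (ReflectionSI.reflectionGroup R) := finite_reflectionGroup hR
  -- For `η₀ > 1` there are no nonzero test functions and no cutoffs, so `S = 0` serves.
  rcases lt_or_ge 1 η₀ with hη₁ | hη₁
  · refine ⟨0, ⟨0, fun f => ?_⟩, fun f hf g => ?_, fun f g _ x₀ r ξ hr hξ => ?_, ?_, ?_⟩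
    · rw [zero_mul]
      exact HolderBound.holderNorm_le le_rfl (holderBound_const η 0)
    · have hg : g = 0 := Subtype.ext (eq_zero_of_mem_holderCompact hN hη₁ g.2)
      simp [hg]
    · have h1 := hξ.2.1 x₀ (mem_orbitBall_self (by positivity))
      rw [eq_zero_of_mem_holderCompact hN hη₁ hξ.1] at h1
      exact absurd h1 zero_ne_one
    · intro u f _ _ g _
      simp
    · intro f σ _ x
      simp
  obtain ⟨_, _, huni⟩ := Localization.exists_uniform hN hη₀ hη₁ hε₀ hε₁ hT hT1 hWBP
  choose Λ hΛ1 hΛ2 _ using fun n : ℕ => huni 0 (n + 1) (by positivity)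
  have hΛ : ∀ n, (Λ n).center = 0 ∧ (Λ n).radius = n + 1 := fun n => ⟨hΛ1 n, hΛ2 n⟩
  obtain ⟨C, hC, hH⟩ := exists_holderBound_globalOp hN hη₀ hη₁ hε₀ hε₁ hT hT1 hWBP hη hηε hΛ
  let S₀ : holderSpace 𝕜 R η →ₗ[𝕜] holderSpace 𝕜 R η :=
    { toFun := fun f => ⟨globalOp Λ f, (hH f f.2).mem_holderSpace hη⟩
      map_add' := fun f g => Subtype.ext (globalOp_add hN hε₀ hε₁ hT hη hηε hΛ f.2 g.2)
      map_smul' := fun c f => Subtype.ext (globalOp_smul Λ c f) }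
  obtain ⟨c, hc⟩ := exists_linearMap_add_const hN hη₀ hη₁ T S₀ fun f hf g hg =>
    apply_eq_integral_globalOp hN hη₀ hη₁ hε₀ hε₁ hT hWBP hη hηε hΛ f.2 hf g hg
  -- Adding `c f` times the constant function changes neither the Hölder seminorm nor pairings with
  -- functions of mean zero.
  let one : holderSpace 𝕜 R η := ⟨fun _ => 1, (holderBound_const η 1).mem_holderSpace hη⟩
  have hS : ∀ (f : holderSpace 𝕜 R η) (x : EuclideanSpace ℝ (Fin N)),
      ((S₀ + c.smulRight one) f : EuclideanSpace ℝ (Fin N) → 𝕜) x = globalOp Λ f x + c f := by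
    intro f x
    change globalOp Λ f x + c f * 1 = _
    rw [mul_one]
  have hgi : ∀ (f : holderSpace 𝕜 R η) (g : holderCompact 𝕜 R η₀), Integrable fun x =>
      globalOp Λ (f : EuclideanSpace ℝ (Fin N) → 𝕜) x * (g : EuclideanSpace ℝ (Fin N) → 𝕜) x :=
    fun f g => integrable_mul_of_mem_holderSpace (S₀ f).2 g
  have hint : ∀ (f : holderSpace 𝕜 R η) (g : holderCompact 𝕜 R η₀),
      ∫ x, (g : EuclideanSpace ℝ (Fin N) → 𝕜) x = 0 →
      ∫ x, (globalOp Λ (f : EuclideanSpace ℝ (Fin N) → 𝕜) x + c f) *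
        (g : EuclideanSpace ℝ (Fin N) → 𝕜) x =
      ∫ x, globalOp Λ (f : EuclideanSpace ℝ (Fin N) → 𝕜) x *
        (g : EuclideanSpace ℝ (Fin N) → 𝕜) x := by
    intro f g hg
    simp_rw [add_mul]
    rw [integral_add (hgi f g)
      ((integrable_of_mem_holderCompact g.2).const_mul _), integral_const_mul, hg, mul_zero,
      add_zero]
  refine ⟨S₀ + c.smulRight one, ⟨C, fun f => ?_⟩, fun f hf g => ?_,
    fun f g hg x₀ r ξ hr hξ hsupp h => ?_, fun u f hu hlim g hg => ?_, fun f σ hσ x => ?_⟩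
  · refine HolderBound.holderNorm_le (mul_nonneg hC (holderNorm_nonneg _ _)) fun x y => ?_
    rw [hS, hS, add_sub_add_right_eq_sub]
    exact hH f f.2 x y
  · simp_rw [hS]
    exact hc f hf g
  · simp_rw [hS]
    rw [hint f g hg]
    obtain ⟨L, rfl, rfl, rfl⟩ := exists_localization hN hη₀ hη₁ hε₀ hε₁ hT hT1 hr hξ
    exact extPairing_eq_integral_globalOp hN hη₀ hη₁ hε₀ hε₁ hT hWBP hη hηε hΛ f.2 L h g hg hsupp
  · obtain ⟨M, hM⟩ := hu
    simp_rw [hS]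
    rw [hint f g hg]
    simp_rw [fun n => hint (u n) g hg]
    have h1 := tendsto_integral_globalOp hN hη₀ hη₁ hε₀ hε₁ hT hT1 hWBP hη hηε hΛ
      (v := fun n => ((u n - f : holderSpace 𝕜 R η) : EuclideanSpace ℝ (Fin N) → 𝕜))
      (fun n => (u n - f).2) (M := M + holderNorm R η (f : EuclideanSpace ℝ (Fin N) → 𝕜))
      (fun n => HolderBound.holderNorm_le
        (add_nonneg ((holderNorm_nonneg _ _).trans (hM n)) (holderNorm_nonneg _ _))
        (((holderBound_of_mem_holderSpace hN hη (u n).2).mono (hM n)).sub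
          (holderBound_of_mem_holderSpace hN hη f.2)))
      (fun x => tendsto_sub_nhds_zero_iff.2 (hlim x)) g
    have h2 : ∀ n, ∫ x, globalOp Λ ((u n - f : holderSpace 𝕜 R η) :
        EuclideanSpace ℝ (Fin N) → 𝕜) x * (g : EuclideanSpace ℝ (Fin N) → 𝕜) x =
        (∫ x, globalOp Λ (u n : EuclideanSpace ℝ (Fin N) → 𝕜) x *
          (g : EuclideanSpace ℝ (Fin N) → 𝕜) x) -
        ∫ x, globalOp Λ (f : EuclideanSpace ℝ (Fin N) → 𝕜) x *
          (g : EuclideanSpace ℝ (Fin N) → 𝕜) x := by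
      intro n
      rw [← integral_sub (hgi (u n) g) (hgi f g)]
      congr 1
      ext x
      have h3 : S₀ (u n - f) = S₀ (u n) - S₀ f := map_sub _ _ _
      have h4 := congrArg (fun s : holderSpace 𝕜 R η => (s : EuclideanSpace ℝ (Fin N) → 𝕜) x) h3
      change globalOp Λ ((u n - f : holderSpace 𝕜 R η) : EuclideanSpace ℝ (Fin N) → 𝕜) x =
        globalOp Λ (u n : EuclideanSpace ℝ (Fin N) → 𝕜) x -
          globalOp Λ (f : EuclideanSpace ℝ (Fin N) → 𝕜) x at h4
      rw [h4, sub_mul]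
    simp_rw [h2] at h1
    exact tendsto_sub_nhds_zero_iff.1 h1
  · exact holderSpace_apply_eq hN hη ((S₀ + c.smulRight one) f).2 hσ x
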